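/- All manifolds are finite-dimensional, smooth ($C^\infty$) and without boundary. A \emph{Lie groupoid} over a manifold $\Lambda$ is a manifold $\mathcal G$ with smooth submersions $\mathfrak s,\mathfrak t\colon\mathcal G\to\Lambda$ (source and target), an associative smooth composition $(g,h)\mapsto g\cdot h$ defined for $\mathfrak s(g)=\mathfrak t(h)$, a smooth unit map $\lambda\mapsto 1_\lambda$ and a smooth inversion $g\mapsto g^{-1}$ satisfying the groupoid laws. A \emph{(smooth) bundle of Lie groups} over $\Lambda$ is a Lie groupoid over $\Lambda$ with $\mathfrak s=\mathfrak t$; its fibers $G_\lambda=\mathfrak s^{-1}(\lambda)$ are then Lie groups. Its bundle of Lie algebras $\mathrm{Lie}(\mathcal G)$ is the vector bundle over $\Lambda$ with fiber $\ker \mathrm d\mathfrak s(1_\lambda)\subset T_{1_\lambda}\mathcal G$, the Lie algebra of $G_\lambda$, over $\lambda$, i.e. the pull-back by the unit section of the vertical bundle of $\mathfrak s$. \textbf{Proposition.} Let $\Lambda$ be a manifold and let $\widehat G$ be a Lie group with Lie algebra $\widehat{\mathfrak g}$. Let $\mathfrak g$ be a smooth subbundle (of constant rank $r$) of the trivial vector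 bundle $\Lambda\times\widehat{\mathfrak g}$ over $\Lambda$ such that, for every $\lambda\in\Lambda$, the fiber $\mathfrak g_\lambda$ is a Lie subalgebra of $\widehat{\mathfrak g}$. For every $\lambda\in\Lambda$, let $G_\lambda$ be the connected (immersed) Lie subgroup of $\widehat G$ whose tangent space at $1$ is $\mathfrak g_\lambda$, and set $$\mathcal G:=\bigcup_{\lambda\in\Lambda}\big(\{\lambda\}\times G_\lambda\big)\subset\Lambda\times\widehat G.$$ Assume that for every $\lambda_0\in\Lambda$ there exist a (smoothly embedded) submanifold $A\subset\widehat G$ and an open neighborhood $V$ of $\lambda_0$ in $\Lambda$ such that (a) $1\in A$; (b) $T_1A\oplus\mathfrak g_{\lambda_0}=\widehat{\mathfrak g}$; (c) $G_\lambda\cap A=\{1\}$ for all $\lambda\in V$. Then $\mathcal G$ is a smoothly embedded submanifold of $\Lambda\times\widehat G$ and, with the projection onto $\Lambda$ as source and target, composition $(\lambda,a)\cdot(\lambda,b)=(\lambda,ab)$, inversion $(\lambda,a)^{-1}=(\lambda,a^{-1})$ and units $1_\lambda=(\lambda,1)$, it is a bundle of Lie groups over $\Lambda$. Its associated bundle of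 Lie algebras is $\mathfrak g$: the differential of the projection $\mathcal G\to\widehat G$ at the points $1_\lambda$ identifies the vector bundle $\mathrm{Lie}(\mathcal G)$ with $\mathfrak g$ (bijectively on each fiber, with smooth local sections corresponding to smooth local sections). Moreover, for each $\lambda$ the subgroup $G_\lambda$, with the topology induced from $\widehat G$, is a Lie group smoothly embedded in $\mathcal G$ as the fiber over $\lambda$, and the differential at $1$ of the inclusion $G_\lambda\hookrightarrow\widehat G$ is a Lie algebra homomorphism with image $\mathfrak g_\lambda$. -/

import Mathlib

open Set Manifold
open scoped Manifold ContDiff Topology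

/-- A `C^∞` real Lie group is regular enough to carry Mathlib's Lie algebra structure on its tangent
space at the identity. -/
instance instLieGroupMinSmoothness {E H G : Type*} [NormedAddCommGroup E] [NormedSpace ℝ E]
    [TopologicalSpace H] (I : ModelWithCorners ℝ E H) [TopologicalSpace G] [ChartedSpace H G]
    [Group G] [LieGroup I ∞ G] : LieGroup I (minSmoothness ℝ 3) G :=
  LieGroup.of_le (n := ∞) (by
    rw [minSmoothness_of_isRCLikeNormedField]
    exact ENat.LEInfty.out)

/-! ### Smooth subbundles of a trivial vector bundle -/

/-- The family `W x`, `x ∈ B`, of subspaces of `F` is a smooth subbundle of rank `r` of the trivial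
vector bundle `B × F`: near every point it has a smooth local frame. -/
def IsSmoothSubbundle {E H B F : Type*} [NormedAddCommGroup E] [NormedSpace ℝ E]
    [TopologicalSpace H] (I : ModelWithCorners ℝ E H) [TopologicalSpace B] [ChartedSpace H B]
    [NormedAddCommGroup F] [NormedSpace ℝ F] (r : ℕ) (W : B → Submodule ℝ F) : Prop :=
  ∀ x₀ : B, ∃ U : Set B, IsOpen U ∧ x₀ ∈ U ∧ ∃ s : Fin r → B → F,
    (∀ i, ContMDiffOn I 𝓘(ℝ, F) ∞ (s i) U) ∧
    ∀ x ∈ U, LinearIndependent ℝ (fun i => s i x) ∧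
      Submodule.span ℝ (range fun i => s i x) = W x

/-! ### Connected Lie subgroups -/

/-- `K` is a connected (immersed, not necessarily closed) Lie subgroup of `G` whose tangent space
at `1` is `h`: it is the image of a connected Lie group `L` under an injective homomorphism which
is a smooth immersion and whose differential at `1` has image `h`. -/
def IsConnectedLieSubgroup.{u, v} {E : Type v} {G : Type u} [NormedAddCommGroup E]
    [NormedSpace ℝ E] [TopologicalSpace G] [ChartedSpace E G] [Group G]
    (K : Subgroup G) (h : Submodule ℝ (GroupLieAlgebra 𝓘(ℝ, E) G)) : Prop :=
  ∃ (n : ℕ) (L : Type u) (_ : TopologicalSpace L) (_ : ChartedSpace (EuclideanSpace ℝ (Fin n)) L)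
    (_ : Group L) (_ : LieGroup (𝓡 n) ∞ L) (_ : ConnectedSpace L) (ι : L →* G),
    Function.Injective ι ∧ IsImmersion (𝓡 n) 𝓘(ℝ, E) ∞ ι ∧ ι.range = K ∧
    (mfderiv (𝓡 n) 𝓘(ℝ, E) ι 1).range = h

/-! ### Lie groupoids and bundles of Lie groups -/

/-- A map defined on a subset `S` of a manifold is smooth if, near every point of `S`, it is the
restriction of a smooth map defined on an open set of the ambient manifold. If `S` is a
submanifold, this is smoothness for the submanifold structure. -/
def SmoothOnSubset {E H M E' H' N : Type*} [NormedAddCommGroup E] [NormedSpace ℝ E]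
    [TopologicalSpace H] (I : ModelWithCorners ℝ E H) [TopologicalSpace M] [ChartedSpace H M]
    [NormedAddCommGroup E'] [NormedSpace ℝ E'] [TopologicalSpace H']
    (I' : ModelWithCorners ℝ E' H') [TopologicalSpace N] [ChartedSpace H' N]
    (S : Set M) (f : S → N) : Prop :=
  ∀ p : S, ∃ (U : Set M) (F : M → N), IsOpen U ∧ (p : M) ∈ U ∧ ContMDiffOn I I' ∞ F U ∧
    ∀ q : S, (q : M) ∈ U → F q = f q

/-- A Lie groupoid with base manifold `B` and manifold of arrows `X`. The composition `comp g h`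
is defined when `source g = target h`. -/
structure LieGroupoid {EB HB B EX HX X : Type*} [NormedAddCommGroup EB] [NormedSpace ℝ EB]
    [TopologicalSpace HB] (I : ModelWithCorners ℝ EB HB) [TopologicalSpace B] [ChartedSpace HB B]
    [NormedAddCommGroup EX] [NormedSpace ℝ EX] [TopologicalSpace HX]
    (J : ModelWithCorners ℝ EX HX) [TopologicalSpace X] [ChartedSpace HX X]
    [IsManifold I ∞ B] [IsManifold J ∞ X] where
  source : X → B
  target : X → B
  isSubmersion_source : IsSubmersion J I ∞ source
  isSubmersion_target : IsSubmersion J I ∞ target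
  comp : (g h : X) → source g = target h → X
  inv : X → X
  unit : B → X
  source_comp : ∀ g h hgh, source (comp g h hgh) = source h
  target_comp : ∀ g h hgh, target (comp g h hgh) = target g
  comp_assoc : ∀ g h k (hgh : source g = target h) (hhk : source h = target k),
    comp (comp g h hgh) k ((source_comp g h hgh).trans hhk) =
      comp g (comp h k hhk) (hgh.trans (target_comp h k hhk).symm)
  source_unit : ∀ x, source (unit x) = x
  target_unit : ∀ x, target (unit x) = x
  unit_comp : ∀ g, comp (unit (target g)) g (source_unit _) = g
  comp_unit : ∀ g, comp g (unit (source g)) (target_unit _).symm = g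
  source_inv : ∀ g, source (inv g) = target g
  target_inv : ∀ g, target (inv g) = source g
  inv_comp : ∀ g, comp (inv g) g (source_inv g) = unit (source g)
  comp_inv : ∀ g, comp g (inv g) (target_inv g).symm = unit (target g)
  smooth_comp : SmoothOnSubset (J.prod J) J {p : X × X | source p.1 = target p.2}
    (fun p => comp p.1.1 p.1.2 p.2)
  contMDiff_inv : ContMDiff J J ∞ inv
  contMDiff_unit : ContMDiff I J ∞ unit

/-- A smooth bundle of Lie groups over `B`: a Lie groupoid over `B` whose source and target maps
coincide. -/
structure LieGroupBundle {EB HB B EX HX X : Type*} [NormedAddCommGroup EB] [NormedSpace ℝ EB]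
    [TopologicalSpace HB] (I : ModelWithCorners ℝ EB HB) [TopologicalSpace B] [ChartedSpace HB B]
    [NormedAddCommGroup EX] [NormedSpace ℝ EX] [TopologicalSpace HX]
    (J : ModelWithCorners ℝ EX HX) [TopologicalSpace X] [ChartedSpace HX X]
    [IsManifold I ∞ B] [IsManifold J ∞ X] extends
    LieGroupoid (B := B) (X := X) I J where
  source_eq_target : source = target

namespace LieGroupBundle

variable {EB HB B EX HX X : Type*} [NormedAddCommGroup EB] [NormedSpace ℝ EB]
  [TopologicalSpace HB] {I : ModelWithCorners ℝ EB HB} [TopologicalSpace B] [ChartedSpace HB B]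
  [NormedAddCommGroup EX] [NormedSpace ℝ EX] [TopologicalSpace HX]
  {J : ModelWithCorners ℝ EX HX} [TopologicalSpace X] [ChartedSpace HX X]
  [IsManifold I ∞ B] [IsManifold J ∞ X]

/-- The fiber over `x` of `Lie(𝒢)`, the pull-back by the unit section of the vertical bundle
(the kernel of the differential of the projection). -/
noncomputable def lieFiber (𝒢 : LieGroupBundle (B := B) (X := X) I J) (x : B) :
    Submodule ℝ (TangentSpace J (𝒢.unit x)) :=
  (mfderiv J I 𝒢.source (𝒢.unit x)).ker

/-- The linear maps `D x`, defined on the tangent spaces `T_{1_x} 𝒢`, identify the vector bundle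
`Lie(𝒢)` with the subbundle `W` of the trivial bundle `B × F`: they map fibers bijectively onto
fibers, and a local section of `Lie(𝒢)` is smooth (as a map into `T𝒢`) if and only if its image
is a smooth local section of `W`. -/
structure IdentifiesLie {F : Type*} [NormedAddCommGroup F] [NormedSpace ℝ F]
    (𝒢 : LieGroupBundle (B := B) (X := X) I J)
    (D : (x : B) → TangentSpace J (𝒢.unit x) →L[ℝ] F) (W : B → Submodule ℝ F) : Prop where
  bijOn : ∀ x, BijOn (D x) (𝒢.lieFiber x) (W x)
  smooth_iff : ∀ σ : (x : B) → TangentSpace J (𝒢.unit x), (∀ x, σ x ∈ 𝒢.lieFiber x) →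
    ∀ U : Set B, IsOpen U →
      (ContMDiffOn I J.tangent ∞ (fun x => (⟨𝒢.unit x, σ x⟩ : TangentBundle J X)) U ↔
        ContMDiffOn I 𝓘(ℝ, F) ∞ (fun x => D x (σ x)) U)

end LieGroupBundle

/-! ### The union of a family of subgroups -/

/-- The union of the sets `{x} × G x` in `B × K`. -/
def familyUnion {B K : Type*} [Group K] (G : B → Subgroup K) : Set (B × K) :=
  ⋃ x : B, {x} ×ˢ (G x : Set K)

/-- The inclusion of the group `G x` as the fiber over `x` of the union. -/
def fiberInclusion {B K : Type*} [Group K] (G : B → Subgroup K) (x : B) (h : G x) :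
    familyUnion G :=
  ⟨(x, (h : K)), mem_iUnion.2 ⟨x, rfl, h.2⟩⟩

/-! ### Smoothness of composition operators and of the flow of a family of vector fields -/

namespace ContinuousMap

variable {X : Type*} [TopologicalSpace X] [CompactSpace X]
  {E F : Type*} [NormedAddCommGroup E] [NormedSpace ℝ E] [NormedAddCommGroup F] [NormedSpace ℝ F]

/-- Pointwise application of a bilinear map to a pair of continuous functions, as a continuous
bilinear map. -/
noncomputable def pointwiseBilinL (X : Type*) [TopologicalSpace X] [CompactSpace X]
    {G E F : Type*} [NormedAddCommGroup G] [NormedSpace ℝ G]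
    [NormedAddCommGroup E] [NormedSpace ℝ E] [NormedAddCommGroup F] [NormedSpace ℝ F]
    (b : G →L[ℝ] E →L[ℝ] F) : C(X, G) →L[ℝ] C(X, E) →L[ℝ] C(X, F) :=
  LinearMap.mkContinuous₂
    (LinearMap.mk₂ ℝ (fun (w : C(X, G)) (u : C(X, E)) =>
      (⟨fun x => b (w x) (u x), by fun_prop⟩ : C(X, F)))
      (fun _ _ _ => by ext; simp) (fun _ _ _ => by ext; simp)
      (fun _ _ _ => by ext; simp) (fun _ _ _ => by ext; simp)) ‖b‖
    (fun w u => by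
      rw [ContinuousMap.norm_le _ (by positivity)]
      intro x
      refine (b.le_opNorm₂ _ _).trans ?_
      gcongr
      · exact w.norm_coe_le_norm x
      · exact u.norm_coe_le_norm x)

@[simp]
theorem pointwiseBilinL_apply {G : Type*} [NormedAddCommGroup G] [NormedSpace ℝ G]
    (b : G →L[ℝ] E →L[ℝ] F) (w : C(X, G)) (u : C(X, E)) (x : X) :
    pointwiseBilinL X b w u x = b (w x) (u x) := rfl

/-- The mean value inequality on the segment from `u x` to `u x + k x` bounds the remainder at each
`x`. The bound is uniform in `x` because `v ↦ f' ∘ v` is continuous for the sup norm. -/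
theorem hasFDerivAt_postcomp {G : Type*} [NormedAddCommGroup G] [NormedSpace ℝ G]
    (b : G →L[ℝ] E →L[ℝ] F) (f : C(E, F)) (f' : C(E, G))
    (hf : ∀ x, HasFDerivAt f (b (f' x)) x) (u : C(X, E)) :
    HasFDerivAt (fun u : C(X, E) => f.comp u) (pointwiseBilinL X b (f'.comp u)) u := by
  rw [hasFDerivAt_iff_isLittleO_nhds_zero, Asymptotics.isLittleO_iff]
  intro ε hε
  have hc : Continuous fun v : C(X, E) => f'.comp v := f'.continuous_postcomp
  -- The radius is `ε / (‖b‖ + 1)` rather than `ε / ‖b‖` since `b` may vanish.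
  obtain ⟨δ, hδ, h⟩ := Metric.mem_nhds_iff.1 (hc.continuousAt.preimage_mem_nhds
    (Metric.ball_mem_nhds (f'.comp u) (div_pos hε (by positivity : 0 < ‖b‖ + 1))))
  filter_upwards [Metric.ball_mem_nhds (0 : C(X, E)) hδ] with k hk
  rw [mem_ball_zero_iff] at hk
  rw [ContinuousMap.norm_le _ (by positivity)]
  intro x
  have key := Convex.norm_image_sub_le_of_norm_hasFDerivWithin_le' (f := f)
    (f' := fun y => b (f' y)) (φ := b (f' (u x))) (C := ε) (s := segment ℝ (u x) (u x + k x))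
    (x := u x) (y := u x + k x) (fun y _ => (hf y).hasFDerivWithinAt) (by
      intro y hy
      rw [segment_eq_image'] at hy
      obtain ⟨s, ⟨hs0, hs1⟩, rfl⟩ := hy
      have hd : dist (u + s • k) u < δ := by
        rw [dist_eq_norm, add_sub_cancel_left, norm_smul, Real.norm_of_nonneg hs0]
        exact (mul_le_of_le_one_left (norm_nonneg _) hs1).trans_lt hk
      have h2 := ((f'.comp (u + s • k) - f'.comp u).norm_coe_le_norm x).trans
        ((dist_eq_norm _ _).symm.le.trans (Metric.mem_ball.1 (h hd)).le)
      have h3 : ‖f' (u x + s • (u x + k x - u x)) - f' (u x)‖ ≤ ε / (‖b‖ + 1) := by simpa using h2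
      rw [← map_sub]
      refine (b.le_opNorm _).trans ((mul_le_mul_of_nonneg_left h3 (norm_nonneg b)).trans ?_)
      rw [mul_div_assoc', div_le_iff₀ (by positivity)]
      nlinarith [norm_nonneg b])
    (convex_segment _ _) (left_mem_segment _ _ _) (right_mem_segment _ _ _)
  rw [add_sub_cancel_left] at key
  refine le_trans ?_ (key.trans (mul_le_mul_of_nonneg_left (k.norm_coe_le_norm x) hε.le))
  simp

/-- The derivative of a composition operator is again a composition operator, that of `f'`, followed
by a bounded linear map; hence one order of smoothness is gained. -/
theorem contDiff_succ_postcomp {G : Type*} [NormedAddCommGroup G] [NormedSpace ℝ G] {n : ℕ}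
    (b : G →L[ℝ] E →L[ℝ] F) (f : C(E, F)) (f' : C(E, G))
    (hf : ∀ x, HasFDerivAt f (b (f' x)) x)
    (hf' : ContDiff ℝ n (fun u : C(X, E) => f'.comp u)) :
    ContDiff ℝ (n + 1) (fun u : C(X, E) => f.comp u) := by
  rw [contDiff_succ_iff_hasFDerivAt]
  exact ⟨_, (pointwiseBilinL X b).contDiff.comp hf', hasFDerivAt_postcomp b f f' hf⟩

/-- Induction on the order, with the codomain varying: the step passes from `F` to `E →L[ℝ] F`. The
common universe of `E` and `F` keeps this space within the scope of the induction. -/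
theorem contDiff_postcomp.{u} {E F : Type u} [NormedAddCommGroup E] [NormedSpace ℝ E]
    [NormedAddCommGroup F] [NormedSpace ℝ F] {f : C(E, F)} (hf : ContDiff ℝ ∞ f) :
    ContDiff ℝ ∞ (fun u : C(X, E) => f.comp u) := by
  rw [contDiff_infty]
  intro n
  induction n generalizing F with
  | zero => exact contDiff_zero.2 f.continuous_postcomp
  | succ n ih =>
    have hf' : ContDiff ℝ ∞ (fderiv ℝ f) := hf.fderiv_right (by simp)
    exact contDiff_succ_postcomp (ContinuousLinearMap.id ℝ (E →L[ℝ] F)) f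
      ⟨fderiv ℝ f, hf'.continuous⟩ (fun x => (hf.differentiable (by simp) x).hasFDerivAt) (ih hf')

end ContinuousMap

/-- The inverse function theorem for maps smooth on an open set. -/
theorem ContDiffOn.exists_openPartialHomeomorph {E F : Type*} [NormedAddCommGroup E]
    [NormedSpace ℝ E] [CompleteSpace E] [NormedAddCommGroup F] [NormedSpace ℝ F] {f : E → F}
    {U : Set E} (hf : ContDiffOn ℝ ∞ f U) (hU : IsOpen U) {a : E} (ha : a ∈ U) {f' : E ≃L[ℝ] F}
    (hf' : HasFDerivAt f (f' : E →L[ℝ] F) a) :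
    ∃ Θ : OpenPartialHomeomorph E F, a ∈ Θ.source ∧ Θ.source ⊆ U ∧ (Θ : E → F) = f ∧
      ContDiffOn ℝ ∞ Θ.symm Θ.target := by
  have hfa := hf.contDiffAt (hU.mem_nhds ha)
  have hc : ContinuousAt (fderiv ℝ f) a :=
    ((hf.fderiv_of_isOpen hU (m := 0) (by simp)).continuousOn).continuousAt (hU.mem_nhds ha)
  -- The derivative stays invertible near `a`. Restricting to such points makes the inverse smooth
  -- on the whole target and not only at `f a`.
  have hn : ∀ᶠ x in 𝓝 a, x ∈ U ∧ ∃ e : E ≃L[ℝ] F, (e : E →L[ℝ] F) = fderiv ℝ f x := by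
    refine (hU.mem_nhds ha |> Filter.Eventually.and <| ?_)
    have := f'.nhds
    rw [← hf'.fderiv] at this
    exact hc this
  obtain ⟨W, hW, hWo, haW⟩ := eventually_nhds_iff.1 hn
  let Θ₀ := hfa.toOpenPartialHomeomorph f hf' (by simp)
  refine ⟨Θ₀.restrOpen W hWo, ⟨hfa.mem_toOpenPartialHomeomorph_source hf' (by simp), haW⟩,
    fun x hx => (hW x hx.2).1, rfl, fun y hy => ContDiffAt.contDiffWithinAt ?_⟩
  have hx := (Θ₀.restrOpen W hWo).map_target hy
  obtain ⟨hxU, e, he⟩ := hW _ hx.2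
  refine (Θ₀.restrOpen W hWo).contDiffAt_symm hy (f₀' := e) ?_ (hf.contDiffAt (hU.mem_nhds hxU))
  rw [he]
  exact ((hf.contDiffAt (hU.mem_nhds hxU)).differentiableAt (by simp)).hasFDerivAt

/-- Integration from `0`, as a continuous linear operator on continuous functions on `[-2, 2]`. -/
noncomputable def integralFromZeroL (E : Type*) [NormedAddCommGroup E] [NormedSpace ℝ E] :
    C(Icc (-2 : ℝ) 2, E) →L[ℝ] C(Icc (-2 : ℝ) 2, E) :=
  LinearMap.mkContinuous
    { toFun := fun u =>
        ⟨fun t => ∫ s in (0 : ℝ)..t, IccExtend (by norm_num : (-2 : ℝ) ≤ 2) u s, by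
          have : Continuous (IccExtend (by norm_num : (-2 : ℝ) ≤ 2) u) := u.continuous.Icc_extend'
          exact (intervalIntegral.continuous_primitive (fun a b => this.intervalIntegrable a b)
            0).comp continuous_subtype_val⟩
      map_add' := fun u v => by
        ext t
        have hu : Continuous (IccExtend (by norm_num : (-2 : ℝ) ≤ 2) u) := u.continuous.Icc_extend'
        have hv : Continuous (IccExtend (by norm_num : (-2 : ℝ) ≤ 2) v) := v.continuous.Icc_extend'
        exact intervalIntegral.integral_add (hu.intervalIntegrable _ _) (hv.intervalIntegrable _ _)
      map_smul' := fun c u => by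
        ext t
        exact intervalIntegral.integral_smul c _ } 2
    (fun u => by
      rw [ContinuousMap.norm_le _ (by positivity)]
      intro t
      refine (intervalIntegral.norm_integral_le_of_norm_le_const (C := ‖u‖)
        (fun s _ => u.norm_coe_le_norm _)).trans ?_
      rw [sub_zero, mul_comm]
      exact mul_le_mul_of_nonneg_right (abs_le.2 t.2) (norm_nonneg _))

/-- Solutions `u` of the equation `u = c + J (B (N u) (L v))`, where `J`, `B`, `L` are bounded
linear, depend smoothly on the parameter `v` near `0`. -/
theorem ContDiff.exists_smooth_solution_of_linear_in_parameter {V X Y Z : Type*}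
    [NormedAddCommGroup V] [NormedSpace ℝ V] [CompleteSpace V]
    [NormedAddCommGroup X] [NormedSpace ℝ X] [CompleteSpace X] [NormedAddCommGroup Y]
    [NormedSpace ℝ Y] [NormedAddCommGroup Z] [NormedSpace ℝ Z] {N : X → Y} (hN : ContDiff ℝ ∞ N)
    (J : X →L[ℝ] X) (B : Y →L[ℝ] Z →L[ℝ] X) (L : V →L[ℝ] Z) (c : X) :
    ∃ (U : Set V) (u : V → X), IsOpen U ∧ 0 ∈ U ∧ u 0 = c ∧ ContDiffOn ℝ ∞ u U ∧
      (∀ v ∈ U, u v = c + J (B (N (u v)) (L v))) ∧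
      HasFDerivAt u (J.comp ((B (N c)).comp L)) 0 := by
  let Q : Y →L[ℝ] V →L[ℝ] X :=
    (ContinuousLinearMap.compL ℝ V X X J).comp
      (((ContinuousLinearMap.compL ℝ V Z X).flip L).comp B)
  have hQ : ∀ w v, Q w v = J (B w (L v)) := fun w v => rfl
  let g : V × X → V →L[ℝ] X := fun p => Q (N p.2)
  have hg : ContDiff ℝ ∞ g := Q.contDiff.comp (hN.comp contDiff_snd)
  -- The equation says that the second component of `Φ` vanishes. Since the nonlinear term is linear
  -- in `v`, its derivative at `v = 0` involves only `v`, so `Φ` has a shear as derivative at `(0,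
  -- c)`.
  let Φ : V × X → V × X := fun p => (p.1, p.2 - c - g p p.1)
  have hΦ : ContDiff ℝ ∞ Φ :=
    contDiff_fst.prodMk ((contDiff_snd.sub contDiff_const).sub (hg.clm_apply contDiff_fst))
  let Φ' : (V × X) ≃L[ℝ] (V × X) :=
    (ContinuousLinearEquiv.refl ℝ V).skewProd (ContinuousLinearEquiv.refl ℝ _) (-(g (0, c)))
  have hΦ' : HasFDerivAt Φ (Φ' : V × X →L[ℝ] V × X) (0, c) := by
    have h1 := ((hg.differentiable (by simp) (0, c)).hasFDerivAt).clm_apply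
      (hasFDerivAt_fst (𝕜 := ℝ) (p := ((0 : V), c)))
    have h2 := (hasFDerivAt_fst (𝕜 := ℝ) (p := ((0 : V), c))).prodMk
      (((hasFDerivAt_snd (𝕜 := ℝ) (p := ((0 : V), c))).sub_const c).sub h1)
    refine h2.congr_fderiv ?_
    ext x <;> simp [Φ']
  obtain ⟨Θ, hΘ0, -, hΘ, hΘs⟩ := hΦ.contDiffOn.exists_openPartialHomeomorph isOpen_univ
    (mem_univ _) hΦ'
  have hΘ00 : Θ (0, c) = (0, 0) := by rw [hΘ]; simp [Φ]
  let u : V → X := fun v => (Θ.symm (v, 0)).2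
  have hu0 : u 0 = c := by
    change (Θ.symm (0, 0)).2 = c
    rw [← hΘ00, Θ.left_inv hΘ0]
  let U : Set V := (fun v : V => (v, (0 : X))) ⁻¹' Θ.target
  have hU : IsOpen U := Θ.open_target.preimage (by fun_prop)
  have h0U : (0 : V) ∈ U := by
    change ((0 : V), (0 : X)) ∈ Θ.target
    rw [← hΘ00]; exact Θ.map_source hΘ0
  have hus : ContDiffOn ℝ ∞ u U :=
    contDiff_snd.comp_contDiffOn (hΘs.comp (by fun_prop) (fun v hv => hv))
  have hue : ∀ v ∈ U, u v = c + Q (N (u v)) v := by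
    intro v hv
    have h : Φ (Θ.symm (v, 0)) = (v, 0) := by rw [← hΘ]; exact Θ.right_inv hv
    have h1 : (Θ.symm (v, 0)).1 = v := congrArg Prod.fst h
    have h2 : u v - c - Q (N (u v)) (Θ.symm (v, 0)).1 = 0 := congrArg Prod.snd h
    rw [h1, sub_sub, sub_eq_zero] at h2
    exact h2
  refine ⟨U, u, hU, h0U, hu0, hus, hue, ?_⟩
  -- Differentiating `u v = c + Q (N (u v)) v` at `0` by the product rule, the term with the
  -- derivative of `Q (N (u v))` is evaluated at `v = 0` and drops out.
  have hw : DifferentiableAt ℝ (fun v => Q (N (u v))) 0 :=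
    ((Q.contDiff.comp hN).differentiable (n := ∞) (by simp) (u 0)).comp (0 : V)
      ((hus.contDiffAt (hU.mem_nhds h0U)).differentiableAt (by simp))
  have h1 := (hw.hasFDerivAt.clm_apply (hasFDerivAt_id (𝕜 := ℝ) (0 : V))).const_add c
  refine (h1.congr_fderiv ?_).congr_of_eventuallyEq ?_
  · ext v
    simp [hu0, hQ]
  · filter_upwards [hU.mem_nhds h0U] with v hv
    exact hue v hv

/-- Solutions of `γ' = b (f γ) v`, `γ 0 = c` exist on `(-2, 2)` for small `v`, stay close to `c`,
and their values at time `1` depend smoothly on `v`. -/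
theorem ContDiff.exists_solution_smooth_in_parameter.{u} {E G : Type u} {V : Type*}
    [NormedAddCommGroup E] [NormedSpace ℝ E] [CompleteSpace E] [NormedAddCommGroup V]
    [NormedSpace ℝ V] [CompleteSpace V] [NormedAddCommGroup G] [NormedSpace ℝ G]
    (b : G →L[ℝ] V →L[ℝ] E) {f : E → G} (hf : ContDiff ℝ ∞ f) (c : E) {W : Set E}
    (hW : W ∈ 𝓝 c) :
    ∃ (N : Set V) (γ : V → ℝ → E), IsOpen N ∧ 0 ∈ N ∧ (∀ v ∈ N, γ v 0 = c) ∧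
      (∀ v ∈ N, ∀ t ∈ Ioo (-2 : ℝ) 2, HasDerivAt (γ v) (b (f (γ v t)) v) t) ∧
      (∀ v ∈ N, ∀ t, γ v t ∈ W) ∧
      ContDiffOn ℝ ∞ (fun v => γ v 1) N ∧ HasFDerivAt (fun v => γ v 1) (b (f c)) 0 := by
  -- The time interval is fixed beforehand, with `0` and `1` in its interior: the equation is linear
  -- in `v`, so a small `v` plays the role of a short time.
  let t0 : Icc (-2 : ℝ) 2 := ⟨0, by norm_num, by norm_num⟩
  let t1 : Icc (-2 : ℝ) 2 := ⟨1, by norm_num, by norm_num⟩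
  let fc : C(E, G) := ⟨f, hf.continuous⟩
  let c0 : C(Icc (-2 : ℝ) 2, E) := ContinuousMap.const _ c
  have h22 : (-2 : ℝ) ≤ 2 := by norm_num
  obtain ⟨U, u, hU, h0U, hu0, hus, hue, hud⟩ :=
    (ContinuousMap.contDiff_postcomp (X := Icc (-2 : ℝ) 2) (f := fc) hf
      ).exists_smooth_solution_of_linear_in_parameter (integralFromZeroL E)
      (ContinuousMap.pointwiseBilinL (Icc (-2 : ℝ) 2) b)
      (ContinuousLinearMap.const ℝ (Icc (-2 : ℝ) 2)) c0
  have hue' : ∀ v ∈ U, ∀ t : Icc (-2 : ℝ) 2, u v t =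
      c + ∫ s in (0 : ℝ)..t, b (IccExtend h22 (fc.comp (u v)) s) v := fun v hv t =>
    congrArg (fun w : C(Icc (-2 : ℝ) 2, E) => w t) (hue v hv)
  obtain ⟨ε, hε, hεW⟩ := Metric.mem_nhds_iff.1 hW
  -- Sup-norm closeness to the constant curve keeps the whole curve in `W`. This includes times
  -- outside `[-2, 2]`, where the curve is extended by its end values.
  let N : Set V := U ∩ u ⁻¹' Metric.ball c0 ε
  have hN : IsOpen N := hus.continuousOn.isOpen_inter_preimage hU Metric.isOpen_ball
  have h0N : (0 : V) ∈ N := ⟨h0U, by rw [mem_preimage, hu0]; exact Metric.mem_ball_self hε⟩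
  have hγt : ∀ v (t : Icc (-2 : ℝ) 2), IccExtend h22 (u v) t = u v t :=
    fun v t => IccExtend_val _ _ _
  refine ⟨N, fun v => IccExtend h22 (u v), hN, h0N, ?_, ?_, ?_, ?_, ?_⟩
  · intro v hv
    change IccExtend h22 (u v) (t0 : ℝ) = c
    rw [hγt, hue' v hv.1]
    simp [t0]
  · intro v hv t ht
    have hc : Continuous fun s : ℝ => b (IccExtend h22 (fc.comp (u v)) s) v :=
      (b.continuous.comp (ContinuousMap.continuous (fc.comp (u v))).Icc_extend').clm_apply
        continuous_const
    have h1 : HasDerivAt (fun t => c + ∫ s in (0 : ℝ)..t, b (IccExtend h22 (fc.comp (u v)) s) v)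
        (b (IccExtend h22 (fc.comp (u v)) t) v) t :=
      (intervalIntegral.integral_hasDerivAt_right (hc.intervalIntegrable _ _)
        (hc.stronglyMeasurableAtFilter _ _) hc.continuousAt).const_add c
    refine h1.congr_of_eventuallyEq ?_
    filter_upwards [Ioo_mem_nhds ht.1 ht.2] with s hs
    change IccExtend h22 (u v) ((⟨s, hs.1.le, hs.2.le⟩ : Icc (-2 : ℝ) 2) : ℝ) = _
    rw [hγt, hue' v hv.1]
  · intro v hv t
    refine hεW ?_
    rw [Metric.mem_ball]
    exact ((ContinuousMap.dist_apply_le_dist (f := u v) (g := c0) _)).trans_lt hv.2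
  · have h : ContDiffOn ℝ ∞ (fun v => u v t1) N :=
      (ContinuousMap.evalCLM ℝ t1 : C(Icc (-2 : ℝ) 2, E) →L[ℝ] E).contDiff.comp_contDiffOn
        (hus.mono inter_subset_left)
    exact h.congr fun v _ => hγt v t1
  · have h2 := ((ContinuousMap.evalCLM ℝ t1 : C(Icc (-2 : ℝ) 2, E) →L[ℝ] E).hasFDerivAt).comp
      (0 : V) hud
    refine (h2.congr_fderiv ?_).congr_of_eventuallyEq (.of_forall fun v => hγt v t1)
    ext v
    change ∫ s in (0 : ℝ)..1, b (f c) v = b (f c) v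
    simp

/-! ### Linear normal forms -/

section LinearAlgebra

variable {E F E'' : Type*} [NormedAddCommGroup E] [NormedSpace ℝ E] [FiniteDimensional ℝ E]
  [NormedAddCommGroup F] [NormedSpace ℝ F] [FiniteDimensional ℝ F]
  [NormedAddCommGroup E''] [NormedSpace ℝ E''] [FiniteDimensional ℝ E'']

/-- The kernel of a linear left inverse of `A` is a complement of the range of `A`, and it is
isomorphic to `F` by dimension. -/
theorem ContinuousLinearMap.exists_equiv_prod_of_injective (A : E →L[ℝ] E'')
    (hA : Function.Injective A)
    (hd : Module.finrank ℝ E + Module.finrank ℝ F = Module.finrank ℝ E'') :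
    ∃ e : (E × F) ≃L[ℝ] E'', ∀ u, e (u, 0) = A u := by
  obtain ⟨P, hP⟩ := (A : E →ₗ[ℝ] E'').exists_leftInverse_of_injective (LinearMap.ker_eq_bot.2 hA)
  have hPA : ∀ u, P (A u) = u := fun u => congrArg (fun T : E →ₗ[ℝ] E => T u) hP
  have hPs : Function.Surjective P := fun u => ⟨A u, hPA u⟩
  have hker : Module.finrank ℝ F = Module.finrank ℝ (LinearMap.ker P) := by
    have := P.finrank_range_add_finrank_ker
    rw [LinearMap.range_eq_top.2 hPs, finrank_top] at this
    omega
  let φ : F ≃ₗ[ℝ] LinearMap.ker P := LinearEquiv.ofFinrankEq _ _ hker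
  let T : E × F →ₗ[ℝ] E'' := (A : E →ₗ[ℝ] E'').coprod ((LinearMap.ker P).subtype ∘ₗ φ.toLinearMap)
  have hT : ∀ u v, T (u, v) = A u + φ v := fun u v => rfl
  have hTi : Function.Injective T := by
    rw [injective_iff_map_eq_zero]
    rintro ⟨u, v⟩ h
    rw [hT] at h
    have h1 : P (φ v : E'') = 0 := (φ v).2
    have hu : u = 0 := by
      have := congrArg P h
      rwa [map_add, hPA, h1, add_zero, map_zero] at this
    subst hu
    rw [map_zero, zero_add] at h
    have hv : v = 0 := by simpa using h
    rw [hv]; rfl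
  refine ⟨(LinearMap.linearEquivOfInjective T hTi
    (by rw [Module.finrank_prod, hd])).toContinuousLinearEquiv, fun u => ?_⟩
  change T (u, 0) = A u
  rw [hT, map_zero]; simp

/-- A linear section `S` of `A` splits `E`. A complement of its range is then sheared along that
range into the kernel of `A`, so that `A` becomes exactly the first projection. -/
theorem ContinuousLinearMap.exists_equiv_prod_of_surjective (A : E →L[ℝ] E'')
    (hA : Function.Surjective A)
    (hd : Module.finrank ℝ E'' + Module.finrank ℝ F = Module.finrank ℝ E) :
    ∃ e : E ≃L[ℝ] (E'' × F), ∀ u, (e u).1 = A u := by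
  obtain ⟨S, hS⟩ := (A : E →ₗ[ℝ] E'').exists_rightInverse_of_surjective
    (LinearMap.range_eq_top.2 hA)
  have hAS : ∀ v, A (S v) = v := fun v => congrArg (fun T : E'' →ₗ[ℝ] E'' => T v) hS
  have hSi : Function.Injective S := fun v w h => by rw [← hAS v, h, hAS]
  obtain ⟨e, he⟩ := (LinearMap.toContinuousLinearMap S).exists_equiv_prod_of_injective
    (F := F) hSi hd
  -- correct the complement so that it lies in the kernel
  let T : E'' × F →ₗ[ℝ] E := S ∘ₗ (LinearMap.fst ℝ E'' F - A.toLinearMap ∘ₗ e.toLinearEquiv.toLinearMap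
    ∘ₗ LinearMap.inr ℝ E'' F ∘ₗ LinearMap.snd ℝ E'' F) + e.toLinearEquiv.toLinearMap ∘ₗ
    LinearMap.inr ℝ E'' F ∘ₗ LinearMap.snd ℝ E'' F
  have hT : ∀ v w, T (v, w) = S (v - A (e (0, w))) + e (0, w) := fun v w => rfl
  have hAT : ∀ z, A (T z) = z.1 := by
    rintro ⟨v, w⟩
    rw [hT, map_add, hAS]; simp
  have hTi : Function.Injective T := by
    rw [injective_iff_map_eq_zero]
    rintro ⟨v, w⟩ h
    have hv : v = 0 := by simpa [h] using (hAT (v, w)).symm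
    subst hv
    rw [hT, ← LinearMap.coe_toContinuousLinearMap' S, ← he, ← map_add, map_eq_zero_iff _ e.injective]
      at h
    have hw : w = 0 := by simpa using congrArg Prod.snd h
    rw [hw]; rfl
  let e' := (LinearMap.linearEquivOfInjective T hTi
    (by rw [Module.finrank_prod, hd])).toContinuousLinearEquiv
  refine ⟨e'.symm, fun u => ?_⟩
  have := hAT (e'.symm u)
  rw [← this]
  exact congrArg A (e'.apply_symm_apply u)

end LinearAlgebra

/-! ### Consequences of the inverse function theorem on manifolds -/

section Charts

variable {E H M : Type*} [NormedAddCommGroup E] [NormedSpace ℝ E] [TopologicalSpace H]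
  (I : ModelWithCorners ℝ E H) [I.Boundaryless] [TopologicalSpace M]

/-- A chart of a manifold without boundary, with values in the model vector space. -/
noncomputable def OpenPartialHomeomorph.extendModel (e : OpenPartialHomeomorph M H) : OpenPartialHomeomorph M E :=
  e.trans I.toHomeomorph.toOpenPartialHomeomorph

@[simp]
theorem OpenPartialHomeomorph.extendModel_source (e : OpenPartialHomeomorph M H) :
    (e.extendModel I).source = e.source := by
  simp [OpenPartialHomeomorph.extendModel]

theorem OpenPartialHomeomorph.extendModel_target (e : OpenPartialHomeomorph M H) :
    (e.extendModel I).target = (e.extend I).target := by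
  ext x
  simp [OpenPartialHomeomorph.extendModel, I.range_eq_univ]

variable {I} [ChartedSpace H M]

theorem OpenPartialHomeomorph.contMDiffOn_extendModel {e : OpenPartialHomeomorph M H}
    (he : e ∈ IsManifold.maximalAtlas I ∞ M) :
    ContMDiffOn I 𝓘(ℝ, E) ∞ (e.extendModel I) e.source :=
  I.contMDiff.comp_contMDiffOn (contMDiffOn_of_mem_maximalAtlas he)

theorem OpenPartialHomeomorph.contMDiffOn_extendModel_symm {e : OpenPartialHomeomorph M H}
    (he : e ∈ IsManifold.maximalAtlas I ∞ M) :
    ContMDiffOn 𝓘(ℝ, E) I ∞ (e.extendModel I).symm (e.extendModel I).target := by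
  refine (contMDiffOn_symm_of_mem_maximalAtlas he).comp
    (I.contMDiffOn_symm.mono (by simp [I.range_eq_univ])) ?_
  intro x hx
  simpa [OpenPartialHomeomorph.extendModel] using hx

/-- A smooth open partial homeomorphism with smooth inverse to the model vector space gives a
chart. -/
theorem OpenPartialHomeomorph.mem_maximalAtlas_of_contMDiffOn_model [IsManifold I ∞ M]
    (φ : OpenPartialHomeomorph M E) (hφ : ContMDiffOn I 𝓘(ℝ, E) ∞ φ φ.source)
    (hφ' : ContMDiffOn 𝓘(ℝ, E) I ∞ φ.symm φ.target) :
    φ.trans I.toHomeomorph.symm.toOpenPartialHomeomorph ∈ IsManifold.maximalAtlas I ∞ M := by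
  apply OpenPartialHomeomorph.mem_maximalAtlas_of_contMDiffOn
  · refine (I.contMDiffOn_symm (n := ∞)).comp (hφ.mono fun x hx => ?_) fun x _ => ?_
    · simpa using hx
    · simp [I.range_eq_univ]
  · refine hφ'.comp I.contMDiff.contMDiffOn fun x hx => ?_
    simpa using hx

end Charts

section

variable {E H M E' H' N : Type*} [NormedAddCommGroup E] [NormedSpace ℝ E] [TopologicalSpace H]
  {I : ModelWithCorners ℝ E H} [I.Boundaryless] [TopologicalSpace M] [ChartedSpace H M]
  [IsManifold I ∞ M]
  [NormedAddCommGroup E'] [NormedSpace ℝ E'] [TopologicalSpace H']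
  {J : ModelWithCorners ℝ E' H'} [J.Boundaryless] [TopologicalSpace N] [ChartedSpace H' N]
  [IsManifold J ∞ N]

/-- The inverse function theorem for a smooth map from an open subset of a vector space to a
manifold. -/
theorem ContMDiffOn.exists_openPartialHomeomorph [CompleteSpace E] {f : E → N} {U : Set E}
    (hf : ContMDiffOn 𝓘(ℝ, E) J ∞ f U) (hU : IsOpen U) {a : E} (ha : a ∈ U)
    (e : E ≃L[ℝ] E') (he : ∀ v : E, mfderiv 𝓘(ℝ, E) J f a v = e v) :
    ∃ Θ : OpenPartialHomeomorph E N, a ∈ Θ.source ∧ Θ.source ⊆ U ∧ EqOn f Θ Θ.source ∧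
      ContMDiffOn 𝓘(ℝ, E) J ∞ Θ Θ.source ∧ ContMDiffOn J 𝓘(ℝ, E) ∞ Θ.symm Θ.target := by
  let c := chartAt H' (f a)
  have hc : c ∈ IsManifold.maximalAtlas J ∞ N := IsManifold.chart_mem_maximalAtlas _
  let C := c.extendModel J
  have hU' : IsOpen (U ∩ f ⁻¹' c.source) := hf.continuousOn.isOpen_inter_preimage hU c.open_source
  have haU' : a ∈ U ∩ f ⁻¹' c.source := ⟨ha, mem_chart_source _ _⟩
  have hg : ContDiffOn ℝ ∞ (C ∘ f) (U ∩ f ⁻¹' c.source) := by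
    rw [← contMDiffOn_iff_contDiffOn]
    exact (OpenPartialHomeomorph.contMDiffOn_extendModel hc).comp (hf.mono inter_subset_left)
      (fun x hx => hx.2)
  have hd : HasFDerivAt (C ∘ f) (e : E →L[ℝ] E') a := by
    have h1 : MDifferentiableAt 𝓘(ℝ, E) J f a :=
      (hf.contMDiffAt (hU.mem_nhds ha)).mdifferentiableAt (by simp)
    have h2 := ((hg.contDiffAt (hU'.mem_nhds haU')).differentiableAt (by simp)).hasFDerivAt
    convert! h2 using 1
    ext v
    change e v = _
    rw [← he v, h1.mfderiv]
    simp only [mfld_simps, fderivWithin_univ]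
    rfl
  obtain ⟨Θ, haΘ, hΘU, hΘ, hΘs⟩ := hg.exists_openPartialHomeomorph hU' haU' hd
  refine ⟨Θ.trans C.symm, ?_, ?_, ?_, ?_, ?_⟩
  · rw [OpenPartialHomeomorph.trans_source]
    refine ⟨haΘ, ?_⟩
    rw [mem_preimage, hΘ]
    exact C.map_source (by simpa [C] using haU'.2)
  · exact fun x hx => (hΘU hx.1).1
  · intro x hx
    rw [OpenPartialHomeomorph.coe_trans, Function.comp_apply, hΘ, Function.comp_apply, C.left_inv]
    simpa [C] using (hΘU hx.1).2
  · refine (OpenPartialHomeomorph.contMDiffOn_extendModel_symm hc).comp ?_ (fun x hx => hx.2)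
    change ContMDiffOn _ _ _ Θ _
    rw [hΘ]
    exact hg.contMDiffOn.mono fun x hx => hΘU hx.1
  · refine hΘs.contMDiffOn.comp ((OpenPartialHomeomorph.contMDiffOn_extendModel hc).mono ?_) ?_
    · intro x hx
      simpa [C] using hx.1
    · exact fun x hx => hx.2

variable [FiniteDimensional ℝ E] [FiniteDimensional ℝ E'] (F : Type*) [NormedAddCommGroup F]
  [NormedSpace ℝ F] [FiniteDimensional ℝ F]

/-- A smooth map is an immersion at the points where its differential is injective. -/
theorem ContMDiffOn.isImmersionAtOfComplement {f : M → N} {U : Set M}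
    (hf : ContMDiffOn I J ∞ f U) (hU : IsOpen U) {x : M} (hx : x ∈ U)
    (hinj : Function.Injective (mfderiv I J f x))
    (hd : Module.finrank ℝ E + Module.finrank ℝ F = Module.finrank ℝ E') :
    IsImmersionAtOfComplement F I J ∞ f x := by
  have : CompleteSpace E := FiniteDimensional.complete ℝ E
  have : CompleteSpace F := FiniteDimensional.complete ℝ F
  let d := chartAt H x
  let c := chartAt H' (f x)
  have hdm : d ∈ IsManifold.maximalAtlas I ∞ M := IsManifold.chart_mem_maximalAtlas _
  have hc : c ∈ IsManifold.maximalAtlas J ∞ N := IsManifold.chart_mem_maximalAtlas _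
  let D := d.extendModel I
  let C := c.extendModel J
  let W : Set M := U ∩ f ⁻¹' c.source
  have hW : IsOpen W := hf.continuousOn.isOpen_inter_preimage hU c.open_source
  let V : Set E := D.target ∩ D.symm ⁻¹' W
  have hV : IsOpen V := D.isOpen_inter_preimage_symm hW
  have hxd : x ∈ d.source := mem_chart_source _ _
  have hxD : x ∈ D.source := by simpa [D] using hxd
  have hxV : D x ∈ V := ⟨D.map_source hxD, by
    rw [mem_preimage, D.left_inv hxD]; exact ⟨hx, mem_chart_source _ _⟩⟩
  let g : E → E' := C ∘ f ∘ D.symm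
  have hg : ContDiffOn ℝ ∞ g V := by
    rw [← contMDiffOn_iff_contDiffOn]
    refine (OpenPartialHomeomorph.contMDiffOn_extendModel hc).comp
      (hf.comp ((OpenPartialHomeomorph.contMDiffOn_extendModel_symm hdm).mono inter_subset_left)
        fun y hy => hy.2.1) fun y hy => hy.2.2
  have h1 : MDifferentiableAt I J f x :=
    (hf.contMDiffAt (hU.mem_nhds hx)).mdifferentiableAt (by simp)
  have hfd : ∀ v : E, fderiv ℝ g (D x) v = mfderiv I J f x v := by
    intro v
    rw [h1.mfderiv]
    simp only [mfld_simps, fderivWithin_univ, I.range_eq_univ]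
    rfl
  obtain ⟨e, he⟩ := (fderiv ℝ g (D x)).exists_equiv_prod_of_injective (F := F)
    (fun v w h => hinj (by
      have h' : fderiv ℝ g (D x) v = fderiv ℝ g (D x) w := h
      rwa [hfd, hfd] at h')) hd
  let S : F →L[ℝ] E' := (e : (E × F) →L[ℝ] E').comp (ContinuousLinearMap.inr ℝ E F)
  -- Adding complementary directions turns `g` into a local diffeomorphism. Its inverse, followed by
  -- `e`, corrects the chart of `N` so that `f` reads `u ↦ e (u, 0)`.
  let Φ : E × F → E' := fun p => g p.1 + S p.2
  have hΦ : ContDiffOn ℝ ∞ Φ (Prod.fst ⁻¹' V) :=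
    (hg.comp contDiffOn_fst fun p hp => hp).add (S.contDiff.comp_contDiffOn contDiffOn_snd)
  have hΦ' : HasFDerivAt Φ (e : (E × F) →L[ℝ] E') (D x, 0) := by
    have h2 := ((hg.contDiffAt (hV.mem_nhds hxV)).differentiableAt (by simp)).hasFDerivAt
    have h3 := (h2.comp ((D x, 0) : E × F) hasFDerivAt_fst).add
      (S.comp (ContinuousLinearMap.snd ℝ E F)).hasFDerivAt
    refine h3.congr_fderiv ?_
    ext v
    · simp [S, he]
    · simp [S]
  obtain ⟨Θ, haΘ, hΘU, hΘ, hΘs⟩ := hΦ.exists_openPartialHomeomorph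
    (hV.preimage continuous_fst) (a := (D x, 0)) hxV hΦ'
  let ψ : OpenPartialHomeomorph N E' :=
    (C.trans Θ.symm).trans e.toHomeomorph.toOpenPartialHomeomorph
  have hψs : ψ.source = (C.trans Θ.symm).source := by simp [ψ]
  have hψ : ContMDiffOn J 𝓘(ℝ, E') ∞ ψ ψ.source := by
    refine e.contDiff.contMDiff.comp_contMDiffOn ?_
    rw [hψs]
    refine hΘs.contMDiffOn.comp ((OpenPartialHomeomorph.contMDiffOn_extendModel hc).mono ?_)
      (fun y hy => hy.2)
    intro y hy
    simpa [C] using hy.1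
  have hψ' : ContMDiffOn 𝓘(ℝ, E') J ∞ ψ.symm ψ.target := by
    have h2 : ContMDiffOn 𝓘(ℝ, E × F) J ∞ (C.trans Θ.symm).symm (C.trans Θ.symm).target := by
      refine (OpenPartialHomeomorph.contMDiffOn_extendModel_symm hc).comp ?_ (fun y hy => hy.2)
      change ContMDiffOn _ _ _ Θ _
      rw [hΘ]
      exact hΦ.contMDiffOn.mono fun y hy => hΘU hy.1
    exact h2.comp e.symm.contDiff.contMDiff.contMDiffOn fun y (hy : y ∈ ψ.target) => hy.2
  have hxΘ : f x ∈ ψ.source := by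
    rw [hψs]
    refine ⟨by simp [C, c], ?_⟩
    have : C (f x) = Θ (D x, 0) := by
      rw [hΘ]; simp only [Φ, map_zero, add_zero, g, Function.comp_apply]; rw [D.left_inv hxD]
    change C (f x) ∈ Θ.target
    rw [this]
    exact Θ.map_source haΘ
  -- The domain chart is cut down to the points whose coordinates `u` satisfy `(u, 0) ∈ Θ.source`,
  -- where the inverse of `Θ` can be applied.
  let s : Set M := d.source ∩ D ⁻¹' ((fun u => (u, (0 : F))) ⁻¹' Θ.source)
  have hs : IsOpen s := by
    have := D.continuousOn.isOpen_inter_preimage D.open_source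
      (Θ.open_source.preimage (by fun_prop : Continuous fun u : E => (u, (0 : F))))
    simpa [D] using this
  refine IsImmersionAtOfComplement.mk_of_continuousAt h1.continuousAt e (d.restr s)
    (ψ.trans J.toHomeomorph.symm.toOpenPartialHomeomorph) ?_ ?_ ?_ ?_ ?_
  · rw [d.restr_source' s hs]
    exact ⟨hxd, hxd, haΘ⟩
  · simpa using hxΘ
  · exact restr_mem_maximalAtlas _ hdm hs
  · exact ψ.mem_maximalAtlas_of_contMDiffOn_model hψ hψ'
  · intro u hu
    rw [← OpenPartialHomeomorph.extendModel_target] at hu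
    have hu1 : u ∈ D.target ∧ D.symm u ∈ s := by
      simp only [OpenPartialHomeomorph.extendModel, OpenPartialHomeomorph.trans_target,
        mem_inter_iff, OpenPartialHomeomorph.restr_target, hs.interior_eq, mem_preimage] at hu
      exact ⟨by simpa [D, OpenPartialHomeomorph.extendModel] using hu.2.1, hu.2.2⟩
    have hu2 : (u, (0 : F)) ∈ Θ.source := by
      have := hu1.2.2
      rwa [mem_preimage, D.right_inv hu1.1] at this
    have hu3 : C (f (D.symm u)) = Θ (u, 0) := by
      rw [hΘ]; simp [Φ, g]
    change J (J.symm (e (Θ.symm (C (f (D.symm u)))))) = e (u, 0)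
    rw [J.right_inv (by simp [J.range_eq_univ]), hu3, Θ.left_inv hu2]

/-- A smooth map is a submersion at the points where its differential is surjective. -/
theorem ContMDiffOn.isSubmersionAtOfComplement {f : M → N} {U : Set M}
    (hf : ContMDiffOn I J ∞ f U) (hU : IsOpen U) {x : M} (hx : x ∈ U)
    (hsurj : Function.Surjective (mfderiv I J f x))
    (hd : Module.finrank ℝ E' + Module.finrank ℝ F = Module.finrank ℝ E) :
    IsSubmersionAtOfComplement F I J ∞ f x := by
  have : CompleteSpace E := FiniteDimensional.complete ℝ E
  let d := chartAt H x
  let c := chartAt H' (f x)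
  have hdm : d ∈ IsManifold.maximalAtlas I ∞ M := IsManifold.chart_mem_maximalAtlas _
  have hc : c ∈ IsManifold.maximalAtlas J ∞ N := IsManifold.chart_mem_maximalAtlas _
  let D := d.extendModel I
  let C := c.extendModel J
  let W : Set M := U ∩ f ⁻¹' c.source
  have hW : IsOpen W := hf.continuousOn.isOpen_inter_preimage hU c.open_source
  let V : Set E := D.target ∩ D.symm ⁻¹' W
  have hV : IsOpen V := D.isOpen_inter_preimage_symm hW
  have hxd : x ∈ d.source := mem_chart_source _ _
  have hxD : x ∈ D.source := by simpa [D] using hxd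
  have hxV : D x ∈ V := ⟨D.map_source hxD, by
    rw [mem_preimage, D.left_inv hxD]; exact ⟨hx, mem_chart_source _ _⟩⟩
  let g : E → E' := C ∘ f ∘ D.symm
  have hg : ContDiffOn ℝ ∞ g V := by
    rw [← contMDiffOn_iff_contDiffOn]
    refine (OpenPartialHomeomorph.contMDiffOn_extendModel hc).comp
      (hf.comp ((OpenPartialHomeomorph.contMDiffOn_extendModel_symm hdm).mono inter_subset_left)
        fun y hy => hy.2.1) fun y hy => hy.2.2
  have h1 : MDifferentiableAt I J f x :=
    (hf.contMDiffAt (hU.mem_nhds hx)).mdifferentiableAt (by simp)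
  have hfd : ∀ v : E, fderiv ℝ g (D x) v = mfderiv I J f x v := by
    intro v
    rw [h1.mfderiv]
    simp only [mfld_simps, fderivWithin_univ, I.range_eq_univ]
    rfl
  obtain ⟨e, he⟩ := (fderiv ℝ g (D x)).exists_equiv_prod_of_surjective (F := F)
    (fun v => by
      obtain ⟨w, hw⟩ := hsurj v
      exact ⟨w, (hfd w).trans hw⟩) hd
  let R : E →L[ℝ] F := (ContinuousLinearMap.snd ℝ E' F).comp (e : E →L[ℝ] E' × F)
  -- Dually to the immersion case, the correction is made to the chart of the source: in the
  -- coordinates `Φ` the map `g` is the first projection.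
  let Φ : E → E' × F := fun u => (g u, R u)
  have hΦ : ContDiffOn ℝ ∞ Φ V := hg.prodMk R.contDiff.contDiffOn
  have hΦ' : HasFDerivAt Φ (e : E →L[ℝ] E' × F) (D x) := by
    have h2 := ((hg.contDiffAt (hV.mem_nhds hxV)).differentiableAt (by simp)).hasFDerivAt
    refine (h2.prodMk R.hasFDerivAt).congr_fderiv ?_
    ext v
    · simp [he]
    · simp [R]
  obtain ⟨Θ, haΘ, hΘU, hΘ, hΘs⟩ := hΦ.exists_openPartialHomeomorph hV hxV hΦ'
  let ψ : OpenPartialHomeomorph M E :=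
    (D.trans Θ).trans e.symm.toHomeomorph.toOpenPartialHomeomorph
  have hψs : ψ.source = (D.trans Θ).source := by simp [ψ]
  have hψ : ContMDiffOn I 𝓘(ℝ, E) ∞ ψ ψ.source := by
    refine e.symm.contDiff.contMDiff.comp_contMDiffOn ?_
    rw [hψs]
    refine ContMDiffOn.comp (t := Θ.source) ?_
      ((OpenPartialHomeomorph.contMDiffOn_extendModel hdm).mono ?_) (fun y hy => hy.2)
    · change ContMDiffOn _ _ _ Θ _
      rw [hΘ]; exact hΦ.contMDiffOn.mono hΘU
    · intro y hy
      simpa [D] using hy.1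
  have hψ' : ContMDiffOn 𝓘(ℝ, E) I ∞ ψ.symm ψ.target := by
    have h2 : ContMDiffOn 𝓘(ℝ, E' × F) I ∞ (D.trans Θ).symm (D.trans Θ).target :=
      (OpenPartialHomeomorph.contMDiffOn_extendModel_symm hdm).comp
        (hΘs.contMDiffOn.mono inter_subset_left) (fun y hy => hy.2)
    exact h2.comp e.contDiff.contMDiff.contMDiffOn fun y (hy : y ∈ ψ.target) => hy.2
  refine IsSubmersionAtOfComplement.mk_of_continuousAt h1.continuousAt e
    (ψ.trans I.toHomeomorph.symm.toOpenPartialHomeomorph) c ?_ (mem_chart_source _ _) ?_ hc ?_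
  · simpa [hψs] using ⟨hxD, haΘ⟩
  · exact ψ.mem_maximalAtlas_of_contMDiffOn_model hψ hψ'
  · intro u hu
    rw [← OpenPartialHomeomorph.extendModel_target] at hu
    have hu1 : e u ∈ Θ.target := by
      have h2 : I (I.symm u) ∈ ψ.target := by
        simpa [OpenPartialHomeomorph.extendModel] using hu
      rw [I.right_inv (by simp [I.range_eq_univ])] at h2
      exact h2.2.1
    change C (f (D.symm (Θ.symm (e (I (I.symm u)))))) = (e u).1
    rw [I.right_inv (by simp [I.range_eq_univ])]
    have h4 : Φ (Θ.symm (e u)) = e u := by rw [← hΘ]; exact Θ.right_inv hu1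
    exact congrArg Prod.fst h4

omit [IsManifold I ∞ M] [IsManifold J ∞ N] [FiniteDimensional ℝ E] [FiniteDimensional ℝ E'] in
/-- An immersion has smooth local left inverses. -/
theorem Manifold.IsImmersionAt.exists_leftInverse {f : M → N} {x : M}
    (hf : IsImmersionAt I J ∞ f x) : ∃ (V : Set N) (ρ : N → M), IsOpen V ∧ f x ∈ V ∧
      ContMDiffOn J I ∞ ρ V ∧ ∀ᶠ y in 𝓝 x, ρ (f y) = y := by
  let D := hf.domChart.extendModel I
  let C := hf.codChart.extendModel J
  have hxD : x ∈ D.source := by simpa [D] using hf.mem_domChart_source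
  have hxC : f x ∈ C.source := by simpa [C] using hf.mem_codChart_source
  -- In the charts of the immersion `f` is `u ↦ hf.equiv (u, 0)`, so discarding the second component
  -- recovers `u`.
  let h : N → E := fun y => (hf.equiv.symm (C y)).1
  have hh : ContMDiffOn J 𝓘(ℝ, E) ∞ h C.source := by
    refine (contDiff_fst.comp hf.equiv.symm.contDiff).contMDiff.comp_contMDiffOn ?_
    have := OpenPartialHomeomorph.contMDiffOn_extendModel hf.codChart_mem_maximalAtlas
    simpa [C] using this
  have key : ∀ y ∈ D.source, h (f y) = D y := by
    intro y hy
    have h0 := hf.writtenInCharts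
    have h1 := h0 (show D y ∈ (hf.domChart.extend I).target by
      rw [← OpenPartialHomeomorph.extendModel_target]; exact D.map_source hy)
    change C (f (D.symm (D y))) = hf.equiv (D y, 0) at h1
    rw [D.left_inv hy] at h1
    simp only [h]
    rw [h1, hf.equiv.symm_apply_apply]
  refine ⟨C.source ∩ h ⁻¹' D.target, D.symm ∘ h,
    hh.continuousOn.isOpen_inter_preimage C.open_source D.open_target, ⟨hxC, ?_⟩, ?_, ?_⟩
  · rw [mem_preimage, key x hxD]; exact D.map_source hxD
  · exact (OpenPartialHomeomorph.contMDiffOn_extendModel_symm hf.domChart_mem_maximalAtlas).comp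
      (hh.mono inter_subset_left) fun y hy => hy.2
  · filter_upwards [D.open_source.mem_nhds hxD] with y hy
    rw [Function.comp_apply, key y hy, D.left_inv hy]

-- The chain rule for `ρ ∘ f = id`. It serves both for injectivity of the differential of `f` and,
-- with `f` a section, for surjectivity of that of `ρ`.
omit [FiniteDimensional ℝ E] [FiniteDimensional ℝ E'] [I.Boundaryless] [J.Boundaryless]
  [IsManifold I ∞ M] [IsManifold J ∞ N] in
theorem mfderiv_injective_of_leftInverse {f : M → N} {ρ : N → M} {x : M}
    (hf : MDifferentiableAt I J f x) (hρ : MDifferentiableAt J I ρ (f x))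
    (h : ∀ᶠ y in 𝓝 x, ρ (f y) = y) (v : TangentSpace I x) :
    mfderiv J I ρ (f x) (mfderiv I J f x v) = v := by
  have h1 := HasMFDerivAt.comp x hρ.hasMFDerivAt hf.hasMFDerivAt
  have h2 := (hasMFDerivAt_id (I := I) x).congr_of_eventuallyEq (f₁ := ρ ∘ f) h
  exact congrArg (fun T : E →L[ℝ] E => T v) (hasMFDerivAt_unique h1 h2)

end

/-! ### Submanifolds from slices -/

section Slices

variable {E H M E₁ E₂ : Type*} [NormedAddCommGroup E] [NormedSpace ℝ E] [TopologicalSpace H]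
  (I : ModelWithCorners ℝ E H) [TopologicalSpace M] [ChartedSpace H M]
  [NormedAddCommGroup E₁] [NormedSpace ℝ E₁] [NormedAddCommGroup E₂] [NormedSpace ℝ E₂]

/-- A local parametrization of a manifold in which the subset `S` corresponds to the points with
vanishing second coordinate. -/
structure IsSlice (S : Set M) (Θ : OpenPartialHomeomorph (E₁ × E₂) M) : Prop where
  contMDiffOn : ContMDiffOn 𝓘(ℝ, E₁ × E₂) I ∞ Θ Θ.source
  contMDiffOn_symm : ContMDiffOn I 𝓘(ℝ, E₁ × E₂) ∞ Θ.symm Θ.target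
  mem_iff : ∀ z ∈ Θ.source, Θ z ∈ S ↔ z.2 = 0

variable {I} {S : Set M}

open Classical in
/-- The chart of a subset given by a slice. -/
noncomputable def IsSlice.chart {Θ : OpenPartialHomeomorph (E₁ × E₂) M} (hΘ : IsSlice I S Θ)
    (p₀ : S) : OpenPartialHomeomorph S E₁ where
  toFun p := (Θ.symm p).1
  -- The point `p₀` is a default value; on the target the first branch always applies.
  invFun x := if h : Θ (x, 0) ∈ S then ⟨Θ (x, 0), h⟩ else p₀
  source := Subtype.val ⁻¹' Θ.target
  target := (fun x => (x, (0 : E₂))) ⁻¹' Θ.source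
  map_source' p hp := by
    have h1 := Θ.map_target hp
    have h2 : (Θ.symm p).2 = 0 := (hΘ.mem_iff _ h1).1 (by rw [Θ.right_inv hp]; exact p.2)
    rw [mem_preimage, ← h2]
    exact h1
  map_target' x hx := by
    have h : Θ (x, 0) ∈ S := (hΘ.mem_iff _ hx).2 rfl
    simp only [h, dite_true]
    exact Θ.map_source hx
  left_inv' p hp := by
    have h1 := Θ.map_target hp
    have h2 : (Θ.symm p).2 = 0 := (hΘ.mem_iff _ h1).1 (by rw [Θ.right_inv hp]; exact p.2)
    have h3 : (((Θ.symm p).1, 0) : E₁ × E₂) = Θ.symm p := by rw [← h2]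
    ext
    simp only [h3, Θ.right_inv hp, p.2, dite_true]
  right_inv' x hx := by
    have h : Θ (x, 0) ∈ S := (hΘ.mem_iff _ hx).2 rfl
    simp only [h, dite_true]
    rw [Θ.left_inv hx]
  open_source := Θ.open_target.preimage continuous_subtype_val
  open_target := Θ.open_source.preimage (by fun_prop)
  continuousOn_toFun := continuous_fst.comp_continuousOn
    (Θ.continuousOn_symm.comp continuous_subtype_val.continuousOn fun p hp => hp)
  continuousOn_invFun := by
    rw [Topology.IsInducing.subtypeVal.continuousOn_iff]
    refine (Θ.continuousOn.comp (by fun_prop : Continuous fun x : E₁ => (x, (0 : E₂))).continuousOn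
      fun x hx => hx).congr fun x hx => ?_
    have h : Θ (x, 0) ∈ S := (hΘ.mem_iff _ hx).2 rfl
    simp only [Function.comp_apply, h, dite_true]

theorem IsSlice.coe_chart_symm {Θ : OpenPartialHomeomorph (E₁ × E₂) M} (hΘ : IsSlice I S Θ)
    (p₀ : S) {x : E₁} (hx : x ∈ (hΘ.chart p₀).target) : ((hΘ.chart p₀).symm x : M) = Θ (x, 0) := by
  have h : Θ (x, 0) ∈ S := (hΘ.mem_iff _ hx).2 rfl
  exact congrArg Subtype.val (dif_pos h)

variable [I.Boundaryless] [IsManifold I ∞ M] [FiniteDimensional ℝ E] [FiniteDimensional ℝ E₁]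
  [FiniteDimensional ℝ E₂]

-- A change of slice charts is the ambient transition map restricted to `E₁ × 0`, followed by the
-- first projection.
omit [I.Boundaryless] [IsManifold I ∞ M] [FiniteDimensional ℝ E] [FiniteDimensional ℝ E₁]
  [FiniteDimensional ℝ E₂] in
theorem IsSlice.contDiffOn_coordChange {Θ Θ' : OpenPartialHomeomorph (E₁ × E₂) M}
    (hΘ : IsSlice I S Θ) (hΘ' : IsSlice I S Θ') (p₀ p₀' : S) :
    ContDiffOn ℝ ∞ ((hΘ.chart p₀).symm.trans (hΘ'.chart p₀'))
      ((hΘ.chart p₀).symm.trans (hΘ'.chart p₀')).source := by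
  have h1 : ∀ x ∈ ((hΘ.chart p₀).symm.trans (hΘ'.chart p₀')).source,
      (x, (0 : E₂)) ∈ Θ.source ∧ Θ (x, 0) ∈ Θ'.target := by
    intro x hx
    refine ⟨hx.1, ?_⟩
    have := hx.2
    rwa [← hΘ.coe_chart_symm p₀ hx.1]
  have h2 : ContMDiffOn 𝓘(ℝ, E₁) 𝓘(ℝ, E₁ × E₂) ∞ (fun x => Θ'.symm (Θ (x, 0)))
      ((hΘ.chart p₀).symm.trans (hΘ'.chart p₀')).source :=
    hΘ'.contMDiffOn_symm.comp (hΘ.contMDiffOn.comp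
      (by fun_prop : ContDiff ℝ ∞ fun x : E₁ => (x, (0 : E₂))).contMDiff.contMDiffOn
      fun x hx => (h1 x hx).1) fun x hx => (h1 x hx).2
  rw [contMDiffOn_iff_contDiffOn] at h2
  refine (contDiff_fst.comp_contDiffOn h2).congr fun x hx => ?_
  change (Θ'.symm ((hΘ.chart p₀).symm x : M)).1 = _
  rw [hΘ.coe_chart_symm p₀ hx.1]
  rfl

variable (E₁ E₂) in
/-- A subset of a manifold which is locally given by slices is a smoothly embedded submanifold. -/
theorem exists_isSmoothEmbedding_of_isSlice
    (hS : ∀ p ∈ S, ∃ Θ : OpenPartialHomeomorph (E₁ × E₂) M, p ∈ Θ.target ∧ IsSlice I S Θ)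
    (hd : S.Nonempty → Module.finrank ℝ E₁ + Module.finrank ℝ E₂ = Module.finrank ℝ E) :
    ∃ (_ : ChartedSpace E₁ S) (_ : IsManifold 𝓘(ℝ, E₁) ∞ S),
      IsSmoothEmbedding 𝓘(ℝ, E₁) I ∞ (Subtype.val : S → M) := by
  choose Θ hpΘ hΘ using hS
  let cs : ChartedSpace E₁ S :=
    { atlas := range fun p : S => (hΘ p p.2).chart p
      chartAt := fun p => (hΘ p p.2).chart p
      mem_chart_source := fun p => hpΘ p p.2
      chart_mem_atlas := fun p => mem_range_self p }
  have hm : IsManifold 𝓘(ℝ, E₁) ∞ S := by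
    apply isManifold_of_contDiffOn
    rintro _ _ ⟨p, rfl⟩ ⟨q, rfl⟩
    simpa using (hΘ p p.2).contDiffOn_coordChange (hΘ q q.2) p q
  refine ⟨cs, hm, ?_, Topology.IsEmbedding.subtypeVal⟩
  have hval : ContMDiff 𝓘(ℝ, E₁) I ∞ (Subtype.val : S → M) := by
    intro p
    let c := (hΘ p p.2).chart p
    have hc : ContMDiffOn 𝓘(ℝ, E₁) 𝓘(ℝ, E₁) ∞ c c.source := contMDiffOn_chart (x := p)
    have h1 : ContMDiffOn 𝓘(ℝ, E₁) I ∞ (fun q => Θ p p.2 (c q, 0)) c.source :=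
      (hΘ p p.2).contMDiffOn.comp ((by fun_prop : ContDiff ℝ ∞ fun x : E₁ => (x, (0 : E₂))
        ).contMDiff.comp_contMDiffOn hc) fun q hq => c.map_source hq
    refine (h1.congr fun q hq => ?_).contMDiffAt (c.open_source.mem_nhds (hpΘ p p.2))
    have := (hΘ p p.2).coe_chart_symm p (c.map_source hq)
    rw [← this, c.left_inv hq]
  -- The dimension relation is assumed only for nonempty `S`; for empty `S` being an immersion is
  -- vacuous and any complement serves.
  rcases isEmpty_or_nonempty S with hE | ⟨⟨p₁, hp₁⟩⟩
  · exact ⟨PUnit, inferInstance, inferInstance, fun p => (hE.false p).elim⟩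
  refine IsImmersionOfComplement.isImmersion (F := E₂) fun p => ?_
  refine hval.contMDiffOn.isImmersionAtOfComplement E₂ isOpen_univ (mem_univ p) ?_ (hd ⟨p₁, hp₁⟩)
  let c := (hΘ p p.2).chart p
  -- The first slice coordinate, read through the chart of `S`, is a smooth local left inverse of
  -- the inclusion; this makes the differential of the inclusion injective.
  have hρ : ContMDiffOn I 𝓘(ℝ, E₁) ∞ (fun q : M => c.symm ((Θ p p.2).symm q).1)
      ((Θ p p.2).target ∩ (Θ p p.2).symm ⁻¹' (Prod.fst ⁻¹' c.target)) :=
    (contMDiffOn_chart_symm (x := p)).comp (contDiff_fst.contMDiff.comp_contMDiffOn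
      ((hΘ p p.2).contMDiffOn_symm.mono inter_subset_left)) fun q hq => hq.2
  have hopen : IsOpen ((Θ p p.2).target ∩ (Θ p p.2).symm ⁻¹' (Prod.fst ⁻¹' c.target)) :=
    (Θ p p.2).isOpen_inter_preimage_symm (c.open_target.preimage continuous_fst)
  have hmem : (p : M) ∈ (Θ p p.2).target ∩ (Θ p p.2).symm ⁻¹' (Prod.fst ⁻¹' c.target) :=
    ⟨hpΘ p p.2, c.map_source (hpΘ p p.2)⟩
  intro v w hvw
  have key := mfderiv_injective_of_leftInverse (I := 𝓘(ℝ, E₁)) (J := I)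
    (f := (Subtype.val : S → M)) (x := p) (hval.mdifferentiable (by simp) p)
    ((hρ.contMDiffAt (hopen.mem_nhds hmem)).mdifferentiableAt (by simp)) (by
      filter_upwards [c.open_source.mem_nhds (hpΘ p p.2)] with q hq
      exact c.left_inv hq)
  rw [← key v, ← key w, hvw]

end Slices

/-! ### The exponential map of a Lie group -/

section PushForward

variable {E H M E' H' N : Type*} [NormedAddCommGroup E] [NormedSpace ℝ E] [TopologicalSpace H]
  {I : ModelWithCorners ℝ E H} [TopologicalSpace M] [ChartedSpace H M]
  [NormedAddCommGroup E'] [NormedSpace ℝ E'] [TopologicalSpace H']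
  {J : ModelWithCorners ℝ E' H'} [TopologicalSpace N] [ChartedSpace H' N]

theorem HasMFDerivAt.comp_curve {f : M → N} {γ : ℝ → M} {t : ℝ} {v : TangentSpace I (γ t)}
    {w : TangentSpace J (f (γ t))} (hf : MDifferentiableAt I J f (γ t))
    (hγ : HasMFDerivAt 𝓘(ℝ, ℝ) I γ t ((1 : ℝ →L[ℝ] ℝ).smulRight v))
    (h : mfderiv I J f (γ t) v = w) :
    HasMFDerivAt 𝓘(ℝ, ℝ) J (f ∘ γ) t ((1 : ℝ →L[ℝ] ℝ).smulRight w) := by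
  have h1 := HasMFDerivAt.comp t hf.hasMFDerivAt hγ
  subst h
  have hext (T S : ℝ →L[ℝ] E') (h : ∀ s, T s = S s) : T = S := ContinuousLinearMap.ext h
  refine (congrArg (fun T : ℝ →L[ℝ] E' => HasMFDerivAt 𝓘(ℝ, ℝ) J (f ∘ γ) t T)
    (hext _ _ fun s => ?_)).mp h1
  have h2 (T : E →L[ℝ] E') (u : E) : T (s • u) = s • T u := T.map_smul s u
  exact h2 (mfderiv I J f (γ t)) v

theorem IsMIntegralCurve.comp_related {f : M → N} {γ : ℝ → M} {V : (x : M) → TangentSpace I x}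
    {W : (x : N) → TangentSpace J x} (hγ : IsMIntegralCurve γ V)
    (hf : MDifferentiable I J f) (h : ∀ x, mfderiv I J f x (V x) = W (f x)) :
    IsMIntegralCurve (f ∘ γ) W :=
  fun t => (hγ t).comp_curve (hf _) (h _)

theorem IsMIntegralCurveOn.comp_related {f : M → N} {γ : ℝ → M} {V : (x : M) → TangentSpace I x}
    {W : (x : N) → TangentSpace J x} {s : Set ℝ} (hs : IsOpen s) (hγ : IsMIntegralCurveOn γ V s)
    (hf : MDifferentiable I J f) (h : ∀ x, mfderiv I J f x (V x) = W (f x)) :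
    IsMIntegralCurveOn (f ∘ γ) W s :=
  fun t ht => (((hγ t ht).hasMFDerivAt (hs.mem_nhds ht)).comp_curve (hf _) (h _)).hasMFDerivWithinAt

end PushForward

section LieGroup

variable {E K : Type*} [NormedAddCommGroup E] [NormedSpace ℝ E]
  [TopologicalSpace K] [ChartedSpace E K] [Group K] [LieGroup 𝓘(ℝ, E) ∞ K]
  {E' K' : Type*} [NormedAddCommGroup E'] [NormedSpace ℝ E']
  [TopologicalSpace K'] [ChartedSpace E' K'] [Group K'] [LieGroup 𝓘(ℝ, E') ∞ K']

-- A `T1` topological group is Hausdorff, and a manifold modelled on `E` is `T1`. The Hausdorff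
-- property is needed for uniqueness of integral curves.
omit [Group K] [LieGroup 𝓘(ℝ, E) ∞ K] in
theorem LieGroup.t2Space (E K : Type*) [NormedAddCommGroup E] [NormedSpace ℝ E]
    [TopologicalSpace K] [ChartedSpace E K] [Group K] [LieGroup 𝓘(ℝ, E) ∞ K] : T2Space K := by
  have := topologicalGroup_of_lieGroup 𝓘(ℝ, E) ∞ (G := K)
  have : T1Space K := ChartedSpace.t1Space E K
  infer_instance

theorem mdifferentiable_mul_left_lieGroup (g : K) :
    MDifferentiable 𝓘(ℝ, E) 𝓘(ℝ, E) (g * · : K → K) :=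
  (contMDiff_mul_left (I := 𝓘(ℝ, E)) (n := ∞) (a := g)).mdifferentiable (by simp)

theorem contMDiff_one_mulInvariantVectorField (v : GroupLieAlgebra 𝓘(ℝ, E) K) :
    ContMDiff 𝓘(ℝ, E) 𝓘(ℝ, E).tangent 1
      (fun g => (⟨g, mulInvariantVectorField v g⟩ : TangentBundle 𝓘(ℝ, E) K)) :=
  (contMDiff_mulInvariantVectorField v).of_le (by simp)

/-- Differentiate `f (g * x) = f g * f x` with respect to `x` at `1`. -/
theorem mfderiv_mulInvariantVectorField_of_hom (f : K →* K') (hf : ContMDiff 𝓘(ℝ, E) 𝓘(ℝ, E') ∞ f)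
    (v : GroupLieAlgebra 𝓘(ℝ, E) K) (g : K) :
    mfderiv 𝓘(ℝ, E) 𝓘(ℝ, E') f g (mulInvariantVectorField v g) =
      mulInvariantVectorField (mfderiv 𝓘(ℝ, E) 𝓘(ℝ, E') f 1 v : E') (f g) := by
  have hfm : MDifferentiable 𝓘(ℝ, E) 𝓘(ℝ, E') f := hf.mdifferentiable (by simp)
  have h1 := HasMFDerivAt.comp (1 : K) (hfm (g * 1)).hasMFDerivAt
    (mdifferentiable_mul_left_lieGroup g 1).hasMFDerivAt
  have h2 := HasMFDerivAt.comp (1 : K)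
    (mdifferentiable_mul_left_lieGroup (E := E') (f g) (f 1)).hasMFDerivAt (hfm 1).hasMFDerivAt
  have h12 : ((f g * ·) ∘ f : K → K') = f ∘ (g * ·) := by
    funext x
    simp
  rw [h12] at h2
  have h3 := congrArg (fun T : E →L[ℝ] E' => T v) (hasMFDerivAt_unique h1 h2)
  have h4 : (mfderiv 𝓘(ℝ, E) 𝓘(ℝ, E') f (g * 1) : E →L[ℝ] E') =
      mfderiv 𝓘(ℝ, E) 𝓘(ℝ, E') f g := by rw [mul_one]
  have h5 : (mfderiv 𝓘(ℝ, E') 𝓘(ℝ, E') (f g * · : K' → K') (f 1) : E' →L[ℝ] E') =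
      mfderiv 𝓘(ℝ, E') 𝓘(ℝ, E') (f g * · : K' → K') 1 := by rw [map_one]
  exact (congrArg (fun T : E →L[ℝ] E' => T
    (mfderiv 𝓘(ℝ, E) 𝓘(ℝ, E) (g * · : K → K) 1 v : E)) h4).symm.trans
    (h3.trans (congrArg (fun T : E' →L[ℝ] E' => T (mfderiv 𝓘(ℝ, E) 𝓘(ℝ, E') f 1 v : E')) h5))

theorem mfderiv_mul_left_mulInvariantVectorField (v : GroupLieAlgebra 𝓘(ℝ, E) K) (g h : K) :
    mfderiv 𝓘(ℝ, E) 𝓘(ℝ, E) (g * ·) h (mulInvariantVectorField v h) =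
      mulInvariantVectorField v (g * h) := by
  have h1 := HasMFDerivAt.comp (1 : K) (mdifferentiable_mul_left_lieGroup (E := E) g (h * 1)).hasMFDerivAt
    (mdifferentiable_mul_left_lieGroup (E := E) h 1).hasMFDerivAt
  have h12 : ((g * ·) ∘ (h * ·) : K → K) = (g * h * ·) := by
    funext x
    simp [mul_assoc]
  rw [h12] at h1
  have h4 : (mfderiv 𝓘(ℝ, E) 𝓘(ℝ, E) (g * · : K → K) (h * 1) : E →L[ℝ] E) =
      mfderiv 𝓘(ℝ, E) 𝓘(ℝ, E) (g * · : K → K) h := by rw [mul_one]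
  exact (congrArg (fun T : E →L[ℝ] E => T
    (mfderiv 𝓘(ℝ, E) 𝓘(ℝ, E) (h * · : K → K) 1 v : E)) h4).symm.trans
    (congrArg (fun T : E →L[ℝ] E => T v) h1.mfderiv).symm

variable [FiniteDimensional ℝ E] [FiniteDimensional ℝ E']

/-- Left translates of one local integral curve at `1` are integral curves through every point, all
on the same interval `(-ε, ε)`; this uniformity gives completeness. -/
theorem exists_isMIntegralCurve_mulInvariantVectorField (v : GroupLieAlgebra 𝓘(ℝ, E) K) :
    ∃ γ : ℝ → K, γ 0 = 1 ∧ IsMIntegralCurve γ (mulInvariantVectorField v) := by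
  have : T2Space K := LieGroup.t2Space E K
  have : CompleteSpace E := FiniteDimensional.complete ℝ E
  have : IsManifold 𝓘(ℝ, E) 1 K := IsManifold.of_le (n := ∞) (by simp)
  have hX := contMDiff_one_mulInvariantVectorField v
  obtain ⟨γ, hγ0, hγ⟩ := exists_isMIntegralCurveAt_of_contMDiffAt_boundaryless (t₀ := 0)
    (hX.contMDiffAt (x := 1))
  obtain ⟨ε, hε, hγ⟩ := isMIntegralCurveAt_iff'.1 hγ
  refine exists_isMIntegralCurve_of_isMIntegralCurveOn hX hε (fun g => ?_) 1
  refine ⟨(g * ·) ∘ γ, by simp [hγ0], ?_⟩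
  rw [Real.ball_eq_Ioo, zero_sub, zero_add] at hγ
  exact hγ.comp_related isOpen_Ioo (mdifferentiable_mul_left_lieGroup g)
    (mfderiv_mul_left_mulInvariantVectorField v g)

variable (K) in
/-- The exponential map of a Lie group. -/
noncomputable def lieExp (v : E) : K :=
  (exists_isMIntegralCurve_mulInvariantVectorField (E := E) (K := K) v).choose 1

/-- Uniqueness of integral curves: any curve on an open interval containing `0` and `1` computes the
exponential, so a solution found in a chart may be used. -/
theorem lieExp_eq_of_isMIntegralCurveOn {v : E} {γ : ℝ → K} (h0 : γ 0 = 1)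
    (hγ : IsMIntegralCurveOn γ (mulInvariantVectorField (I := 𝓘(ℝ, E)) (v : GroupLieAlgebra 𝓘(ℝ, E) K))
      (Ioo (-2) 2)) : lieExp K v = γ 1 := by
  have : T2Space K := LieGroup.t2Space E K
  have : IsManifold 𝓘(ℝ, E) 1 K := IsManifold.of_le (n := ∞) (by simp)
  have hs := (exists_isMIntegralCurve_mulInvariantVectorField (E := E) (K := K) v).choose_spec
  exact isMIntegralCurveOn_Ioo_eqOn_of_contMDiff_boundaryless (t₀ := 0) (by norm_num)
    (contMDiff_one_mulInvariantVectorField v) (hs.2.isMIntegralCurveOn _) hγ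
    (hs.1.trans h0.symm) (by norm_num)

/-- Homomorphisms carry integral curves of invariant fields to integral curves of invariant fields.
-/
theorem map_lieExp (f : K →* K') (hf : ContMDiff 𝓘(ℝ, E) 𝓘(ℝ, E') ∞ f) (v : E) :
    f (lieExp K v) = lieExp K' ((show E →L[ℝ] E' from mfderiv 𝓘(ℝ, E) 𝓘(ℝ, E') f 1) v) := by
  have hs := (exists_isMIntegralCurve_mulInvariantVectorField (E := E) (K := K) v).choose_spec
  refine (lieExp_eq_of_isMIntegralCurveOn (E := E') (K := K')
    (v := (show E →L[ℝ] E' from mfderiv 𝓘(ℝ, E) 𝓘(ℝ, E') f 1) v) (γ := f ∘ _) ?_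
    ((hs.2.comp_related (hf.mdifferentiable (by simp))
      (mfderiv_mulInvariantVectorField_of_hom f hf v)).isMIntegralCurveOn _)).symm
  simp [hs.1]

theorem lieExp_zero : lieExp K (0 : E) = 1 := by
  refine lieExp_eq_of_isMIntegralCurveOn (γ := fun _ => 1) rfl fun t _ => ?_
  have h := hasMFDerivAt_const (I := 𝓘(ℝ, ℝ)) (I' := 𝓘(ℝ, E)) (1 : K) t
  have hext (T S : ℝ →L[ℝ] E) (h : ∀ s, T s = S s) : T = S := ContinuousLinearMap.ext h
  refine HasMFDerivAt.hasMFDerivWithinAt ((congrArg (fun T : ℝ →L[ℝ] E =>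
    HasMFDerivAt 𝓘(ℝ, ℝ) 𝓘(ℝ, E) (fun _ => (1 : K)) t T) (hext _ _ fun s => ?_)).mp h)
  have h2 (T : E →L[ℝ] E) : 0 = s • T 0 := by simp
  exact h2 (mfderiv 𝓘(ℝ, E) 𝓘(ℝ, E) (1 * · : K → K) 1)

-- The tangent space at `x` is identified with `E` through the preferred chart at `x`, so that chart
-- has identity differential there.
omit [FiniteDimensional ℝ E] in
theorem mfderiv_chartAt_symm_self {M : Type*} [TopologicalSpace M] [ChartedSpace E M]
    [IsManifold 𝓘(ℝ, E) ∞ M] (x : M) (v : E) :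
    mfderiv 𝓘(ℝ, E) 𝓘(ℝ, E) (chartAt E x).symm (chartAt E x x) v = v := by
  have : IsManifold 𝓘(ℝ, E) 1 M := IsManifold.of_le (n := ∞) (by simp)
  have h := mfderivWithin_range_extChartAt_symm (I := 𝓘(ℝ, E)) (x := x)
  simp only [mfld_simps, mfderivWithin_univ] at h
  exact congrArg (fun T : E →L[ℝ] E => T v) h

/-- A smooth function defined near a point agrees near that point with a global smooth
function. -/
theorem ContDiffOn.exists_contDiff_eventuallyEq {F : Type*} [NormedAddCommGroup F] [NormedSpace ℝ F]
    {f : E → F} {S : Set E} (hf : ContDiffOn ℝ ∞ f S) (hS : IsOpen S) {c : E} (hc : c ∈ S) :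
    ∃ f' : E → F, ContDiff ℝ ∞ f' ∧ f' =ᶠ[𝓝 c] f := by
  obtain ⟨R, hR, hRS⟩ := Metric.isOpen_iff.1 hS c hc
  let χ : ContDiffBump c := ⟨R / 4, R / 2, by positivity, by linarith⟩
  refine ⟨fun z => χ z • f z, contDiff_iff_contDiffAt.2 fun z => ?_, ?_⟩
  · by_cases hz : z ∈ S
    · exact χ.contDiff.contDiffAt.smul (hf.contDiffAt (hS.mem_nhds hz))
    · have : (fun z => χ z • f z) =ᶠ[𝓝 z] fun _ => 0 := by
        have h1 : z ∈ (Metric.closedBall c (R / 2))ᶜ := fun h =>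
          hz (hRS (Metric.closedBall_subset_ball (by linarith) h))
        filter_upwards [Metric.isClosed_closedBall.isOpen_compl.mem_nhds h1] with y hy
        have : y ∉ Function.support χ := by
          rw [χ.support_eq]
          exact fun h => hy (Metric.ball_subset_closedBall h)
        rw [Function.notMem_support.1 this, zero_smul]
      exact contDiffAt_const.congr_of_eventuallyEq this
  · filter_upwards [Metric.closedBall_mem_nhds c χ.rIn_pos] with y hy
    rw [χ.one_of_mem_closedBall hy, one_smul]

variable (K) in
/-- In a chart at `1`, the invariant vector fields are given by a smooth function. -/
theorem exists_contDiff_mulInvariantVectorField :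
    ∃ (f : E → E →L[ℝ] E) (W : Set E), ContDiff ℝ ∞ f ∧ W ∈ 𝓝 (chartAt E (1 : K) 1) ∧
      W ⊆ (chartAt E (1 : K)).target ∧ (∀ v, f (chartAt E (1 : K) 1) v = v) ∧
      ∀ z ∈ W, ∀ v, mfderiv 𝓘(ℝ, E) 𝓘(ℝ, E) (chartAt E (1 : K)).symm z (f z v) =
        mulInvariantVectorField v ((chartAt E (1 : K)).symm z) := by
  let φ := chartAt E (1 : K)
  let c := φ 1
  have h1 : (1 : K) ∈ φ.source := mem_chart_source E 1
  have hc : c ∈ φ.target := φ.map_source h1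
  have hcs : φ.symm c = 1 := φ.left_inv h1
  have hφ : ContMDiffOn 𝓘(ℝ, E) 𝓘(ℝ, E) ∞ φ φ.source := contMDiffOn_chart
  have hφs : ContMDiffOn 𝓘(ℝ, E) 𝓘(ℝ, E) ∞ φ.symm φ.target := contMDiffOn_chart_symm
  have hcont : ContMDiffOn 𝓘(ℝ, E × E) 𝓘(ℝ, E) ∞ (fun p : E × E => φ.symm p.1 * φ.symm p.2)
      (φ.target ×ˢ φ.target) :=
    (hφs.comp (contDiff_fst.contMDiff (E := E × E)).contMDiffOn fun p hp => hp.1).mul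
      (hφs.comp (contDiff_snd.contMDiff (E := E × E)).contMDiffOn fun p hp => hp.2)
  let O : Set (E × E) := (φ.target ×ˢ φ.target) ∩
    (fun p : E × E => φ.symm p.1 * φ.symm p.2) ⁻¹' φ.source
  have hO : IsOpen O := hcont.continuousOn.isOpen_inter_preimage
    (φ.open_target.prod φ.open_target) φ.open_source
  let m : E × E → E := fun p => φ (φ.symm p.1 * φ.symm p.2)
  have hm : ContDiffOn ℝ ∞ m O := contMDiffOn_iff_contDiffOn.1
    (hφ.comp (hcont.mono inter_subset_left) fun p hp => hp.2)
  let S : Set E := (fun z => (z, c)) ⁻¹' O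
  have hS : IsOpen S := hO.preimage (by fun_prop)
  have hcS : c ∈ S := ⟨⟨hc, hc⟩, by simp [hcs, h1]⟩
  -- In the chart, left translation by the point with coordinate `z` is `m (z, ·)`; its derivative
  -- at the coordinate `c` of the identity carries `v` to the value of the invariant field.
  let f₀ : E → E →L[ℝ] E := fun z => (fderiv ℝ m (z, c)).comp (ContinuousLinearMap.inr ℝ E E)
  have hf₀ : ContDiffOn ℝ ∞ f₀ S :=
    ((hm.fderiv_of_isOpen hO (m := ∞) (by simp)).comp
      ((contDiff_id.prodMk contDiff_const).contDiffOn (s := S)) fun z hz => hz).clm_comp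
        contDiffOn_const
  obtain ⟨f, hf, hff⟩ := hf₀.exists_contDiff_eventuallyEq hS hcS
  refine ⟨f, {z | f z = f₀ z} ∩ S, hf, Filter.inter_mem hff (hS.mem_nhds hcS),
    fun z hz => hz.2.1.1, ?_, ?_⟩
  · intro v
    have hmc : ∀ᶠ w in 𝓝 c, m (c, w) = w := by
      filter_upwards [φ.open_target.mem_nhds hc] with w hw
      change φ (φ.symm c * φ.symm w) = w
      rw [hcs, one_mul, φ.right_inv hw]
    have h2 := ((hm.differentiableOn (by simp)).differentiableAt (hO.mem_nhds hcS)).hasFDerivAt.comp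
      c (hasFDerivAt_prodMk_right c c)
    have h3 := h2.unique ((hasFDerivAt_id c).congr_of_eventuallyEq hmc)
    rw [hff.self_of_nhds]
    exact congrArg (fun T : E →L[ℝ] E => T v) h3
  rintro z ⟨hz, hzS⟩ v
  rw [hz]
  have hmz : m (z, c) = z := by
    change φ (φ.symm z * φ.symm c) = z
    rw [hcs, mul_one, φ.right_inv hzS.1.1]
  have hd : HasMFDerivAt 𝓘(ℝ, E) 𝓘(ℝ, E) (fun w => m (z, w)) c (f₀ z) :=
    hasMFDerivAt_iff_hasFDerivAt.2
      (((hm.differentiableOn (by simp)).differentiableAt (hO.mem_nhds hzS)).hasFDerivAt.comp c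
        (hasFDerivAt_prodMk_right z c))
  have hφd : ∀ y ∈ φ.target, MDifferentiableAt 𝓘(ℝ, E) 𝓘(ℝ, E) φ.symm y := fun y hy =>
    (hφs.contMDiffAt (φ.open_target.mem_nhds hy)).mdifferentiableAt (by simp)
  have e1 := HasMFDerivAt.comp c (hφd (m (z, c)) (hmz.symm ▸ hzS.1.1)).hasMFDerivAt hd
  have e2 := HasMFDerivAt.comp c
    (mdifferentiable_mul_left_lieGroup (E := E) (φ.symm z) (φ.symm c)).hasMFDerivAt
    (hφd c hc).hasMFDerivAt
  have e12 : φ.symm ∘ (fun w => m (z, w)) =ᶠ[𝓝 c] (φ.symm z * ·) ∘ φ.symm := by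
    have hO' : IsOpen ((fun w : E => (z, w)) ⁻¹' O) := hO.preimage (by fun_prop)
    filter_upwards [hO'.mem_nhds hzS] with w hw
    exact φ.left_inv hw.2
  have e3 := congrArg (fun T : E →L[ℝ] E => T v)
    (hasMFDerivAt_unique (e1.congr_of_eventuallyEq e12.symm) e2)
  have e4 : (mfderiv 𝓘(ℝ, E) 𝓘(ℝ, E) φ.symm (m (z, c)) : E →L[ℝ] E) =
      mfderiv 𝓘(ℝ, E) 𝓘(ℝ, E) φ.symm z := by rw [hmz]
  have e5 : (mfderiv 𝓘(ℝ, E) 𝓘(ℝ, E) (φ.symm z * · : K → K) (φ.symm c) : E →L[ℝ] E) =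
      mfderiv 𝓘(ℝ, E) 𝓘(ℝ, E) (φ.symm z * · : K → K) 1 := by rw [hcs]
  have e6 : mfderiv 𝓘(ℝ, E) 𝓘(ℝ, E) φ.symm c v = v := mfderiv_chartAt_symm_self (1 : K) v
  refine (congrArg (fun T : E →L[ℝ] E => T (f₀ z v)) e4).symm.trans (e3.trans ?_)
  refine (congrArg (fun T : E →L[ℝ] E => T ((show E →L[ℝ] E from
    mfderiv 𝓘(ℝ, E) 𝓘(ℝ, E) φ.symm c) v)) e5).trans ?_
  exact congrArg (fun w : E => (show E →L[ℝ] E from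
    mfderiv 𝓘(ℝ, E) 𝓘(ℝ, E) (φ.symm z * · : K → K) 1) w) e6

variable (E K) in
/-- The exponential map is smooth near `0`, with derivative the identity at `0`. -/
theorem exists_contMDiffOn_lieExp : ∃ N : Set E, IsOpen N ∧ 0 ∈ N ∧
    ContMDiffOn 𝓘(ℝ, E) 𝓘(ℝ, E) ∞ (lieExp K : E → K) N ∧
    ∀ v : E, (show E →L[ℝ] E from mfderiv 𝓘(ℝ, E) 𝓘(ℝ, E) (lieExp K : E → K) 0) v = v := by
  have : CompleteSpace E := FiniteDimensional.complete ℝ E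
  obtain ⟨f, W, hf, hW, hWt, hfc, hfX⟩ := exists_contDiff_mulInvariantVectorField (E := E) K
  let φ := chartAt E (1 : K)
  let c := φ 1
  have h1 : (1 : K) ∈ φ.source := mem_chart_source E 1
  have hc : c ∈ φ.target := φ.map_source h1
  have hcs : φ.symm c = 1 := φ.left_inv h1
  have hφs : ContMDiffOn 𝓘(ℝ, E) 𝓘(ℝ, E) ∞ φ.symm φ.target := contMDiffOn_chart_symm
  have hφd : ∀ y ∈ φ.target, MDifferentiableAt 𝓘(ℝ, E) 𝓘(ℝ, E) φ.symm y := fun y hy =>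
    (hφs.contMDiffAt (φ.open_target.mem_nhds hy)).mdifferentiableAt (by simp)
  -- In the chart the integral curves satisfy `γ' = f γ v`, which is linear in `v`. Confinement to
  -- `W` keeps them where `f` really represents the invariant fields.
  obtain ⟨N, γ, hN, h0N, hγ0, hγ, hγW, hγs, hγd⟩ := hf.exists_solution_smooth_in_parameter
    (ContinuousLinearMap.id ℝ (E →L[ℝ] E)) c hW
  have hexp : ∀ v ∈ N, lieExp K v = φ.symm (γ v 1) := by
    intro v hv
    refine lieExp_eq_of_isMIntegralCurveOn (γ := φ.symm ∘ γ v) ?_ fun t ht => ?_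
    · exact (congrArg φ.symm (hγ0 v hv)).trans hcs
    · refine (HasMFDerivAt.comp_curve (hφd _ (hWt (hγW v hv t))) ?_
        (hfX _ (hγW v hv t) v)).hasMFDerivWithinAt
      refine hasMFDerivAt_iff_hasFDerivAt.2 ?_
      have := (hγ v hv t ht).hasFDerivAt
      convert! this using 1
  have hγ1 : γ 0 1 = c := by
    have h := hexp 0 h0N
    rw [lieExp_zero] at h
    exact (φ.symm.injOn (hWt (hγW 0 h0N 1)) hc (h.symm.trans hcs.symm))
  refine ⟨N, hN, h0N, ?_, fun v => ?_⟩
  · exact (hφs.comp (contMDiffOn_iff_contDiffOn.2 hγs) fun v hv => hWt (hγW v hv 1)).congr hexp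
  · have e1 := HasMFDerivAt.comp (0 : E) (hφd (γ 0 1) (hWt (hγW 0 h0N 1))).hasMFDerivAt
      (hasMFDerivAt_iff_hasFDerivAt.2 hγd)
    have e2 := e1.congr_of_eventuallyEq (f₁ := (lieExp K : E → K))
      (Filter.eventually_of_mem (hN.mem_nhds h0N) hexp)
    refine (congrArg (fun T : E →L[ℝ] E => T v) e2.mfderiv).trans ?_
    have e4 : (mfderiv 𝓘(ℝ, E) 𝓘(ℝ, E) φ.symm (γ 0 1) : E →L[ℝ] E) =
      mfderiv 𝓘(ℝ, E) 𝓘(ℝ, E) φ.symm c := by rw [hγ1]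
    refine (congrArg (fun T : E →L[ℝ] E => T (f c v)) e4).trans ?_
    refine (mfderiv_chartAt_symm_self (1 : K) _).trans (hfc v)

end LieGroup

/-! ### Differentials of homomorphisms of Lie groups -/

section Related

variable {E E' : Type*} [NormedAddCommGroup E] [NormedSpace ℝ E] [NormedAddCommGroup E']
  [NormedSpace ℝ E']

/-- Lie brackets of related vector fields are related. -/
theorem VectorField.fderiv_lieBracket_of_related {F : E → E'} {V W : E → E} {V' W' : E' → E'}
    {c : E} (hF : ContDiffAt ℝ 2 F c) (hV : DifferentiableAt ℝ V c) (hW : DifferentiableAt ℝ W c)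
    (hV' : DifferentiableAt ℝ V' (F c)) (hW' : DifferentiableAt ℝ W' (F c))
    (hVV : ∀ᶠ z in 𝓝 c, fderiv ℝ F z (V z) = V' (F z))
    (hWW : ∀ᶠ z in 𝓝 c, fderiv ℝ F z (W z) = W' (F z)) :
    fderiv ℝ F c (VectorField.lieBracket ℝ V W c) = VectorField.lieBracket ℝ V' W' (F c) := by
  have hF1 : DifferentiableAt ℝ F c := hF.differentiableAt (by simp)
  have hF2 : DifferentiableAt ℝ (fderiv ℝ F) c :=
    (hF.fderiv_right (m := 1) (by norm_num)).differentiableAt (by simp)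
  -- This is the relation `DF(z) X(z) = X'(F z)` differentiated in the direction `u`. In the
  -- difference of the two instances the second-derivative terms cancel by symmetry.
  have key : ∀ {X : E → E} {X' : E' → E'}, DifferentiableAt ℝ X c → DifferentiableAt ℝ X' (F c) →
      (∀ᶠ z in 𝓝 c, fderiv ℝ F z (X z) = X' (F z)) → ∀ u, fderiv ℝ F c (fderiv ℝ X c u) +
        fderiv ℝ (fderiv ℝ F) c u (X c) = fderiv ℝ X' (F c) (fderiv ℝ F c u) := by
    intro X X' hX hX' h u
    have h1 := hF2.hasFDerivAt.clm_apply hX.hasFDerivAt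
    have h2 := (hX'.hasFDerivAt.comp c hF1.hasFDerivAt).congr_of_eventuallyEq h
    simpa using congrArg (fun T : E →L[ℝ] E' => T u) (h1.unique h2)
  have hs : IsSymmSndFDerivAt ℝ F c := hF.isSymmSndFDerivAt (by simp)
  have e1 := key hV hV' hVV (W c)
  have e2 := key hW hW' hWW (V c)
  rw [hs.eq (W c) (V c)] at e1
  rw [VectorField.lieBracket, VectorField.lieBracket, map_sub, ← hVV.self_of_nhds,
    ← hWW.self_of_nhds, ← e1, ← e2]
  abel

end Related

section LieBracket

variable {E K : Type*} [NormedAddCommGroup E] [NormedSpace ℝ E]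
  [TopologicalSpace K] [ChartedSpace E K] [Group K] [LieGroup 𝓘(ℝ, E) ∞ K]
  {E' K' : Type*} [NormedAddCommGroup E'] [NormedSpace ℝ E']
  [TopologicalSpace K'] [ChartedSpace E' K'] [Group K'] [LieGroup 𝓘(ℝ, E') ∞ K']

omit [Group K] [LieGroup 𝓘(ℝ, E) ∞ K] in
theorem isInvertible_mfderiv_chartAt_symm [IsManifold 𝓘(ℝ, E) ∞ K] (x : K) {z : E}
    (hz : z ∈ (chartAt E x).target) :
    (show E →L[ℝ] E from mfderiv 𝓘(ℝ, E) 𝓘(ℝ, E) (chartAt E x).symm z).IsInvertible := by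
  have : IsManifold 𝓘(ℝ, E) 1 K := IsManifold.of_le (n := ∞) (by simp)
  have h := isInvertible_mfderivWithin_extChartAt_symm (I := 𝓘(ℝ, E)) (x := x) (y := z)
    (by simpa using hz)
  simp only [mfld_simps, mfderivWithin_univ] at h
  exact h

variable [FiniteDimensional ℝ E] [FiniteDimensional ℝ E']

omit [FiniteDimensional ℝ E] in
/-- The Lie bracket of a Lie group in terms of the expression in a chart of the invariant vector
fields. -/
theorem GroupLieAlgebra.bracket_eq_fderiv {f : E → E →L[ℝ] E} {W : Set E}
    (hW : W ∈ 𝓝 (chartAt E (1 : K) 1)) (hWt : W ⊆ (chartAt E (1 : K)).target)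
    (hX : ∀ z ∈ W, ∀ v, mfderiv 𝓘(ℝ, E) 𝓘(ℝ, E) (chartAt E (1 : K)).symm z (f z v) =
        mulInvariantVectorField v ((chartAt E (1 : K)).symm z))
    (v w : GroupLieAlgebra 𝓘(ℝ, E) K) : (⁅v, w⁆ : GroupLieAlgebra 𝓘(ℝ, E) K) =
      VectorField.lieBracket ℝ (fun z => f z v) (fun z => f z w) (chartAt E (1 : K) 1) := by
  have : IsManifold 𝓘(ℝ, E) 1 K := IsManifold.of_le (n := ∞) (by simp)
  -- The manifold bracket is computed from pullbacks of the fields by the inverse chart; near the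
  -- base point these pullbacks are `f · v` because the differential of the inverse chart is
  -- invertible.
  have key : ∀ v : GroupLieAlgebra 𝓘(ℝ, E) K, (fun z => (show E →L[ℝ] E from
      mfderiv 𝓘(ℝ, E) 𝓘(ℝ, E) (chartAt E (1 : K)).symm z).inverse
        (mulInvariantVectorField v ((chartAt E (1 : K)).symm z)))
      =ᶠ[𝓝 (chartAt E (1 : K) 1)] fun z => f z v := by
    intro v
    filter_upwards [hW] with z hz
    have h := isInvertible_mfderiv_chartAt_symm (1 : K) (hWt hz)
    exact h.inverse_apply_eq.2 (hX z hz v).symm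
  rw [GroupLieAlgebra.bracket_def]
  change VectorField.mlieBracketWithin 𝓘(ℝ, E) _ _ univ (1 : K) = _
  rw [VectorField.mlieBracketWithin_apply]
  have h0 := mfderiv_extChartAt_self (I := 𝓘(ℝ, E)) (x := (1 : K))
  refine (congrArg (fun T : E →L[ℝ] E => T.inverse _) h0).trans ?_
  refine (congrArg (fun T : E →L[ℝ] E => T _) ContinuousLinearMap.inverse_id).trans ?_
  have h1 := Filter.EventuallyEq.lieBracket_vectorField_eq (𝕜 := ℝ) (key v) (key w)
  refine Eq.trans ?_ h1
  change VectorField.lieBracketWithin ℝ _ _ _ _ = _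
  rw [← VectorField.lieBracketWithin_univ]
  simp only [mfld_simps]
  have e (v : GroupLieAlgebra 𝓘(ℝ, E) K) : (VectorField.mpullbackWithin 𝓘(ℝ, E) 𝓘(ℝ, E)
      (chartAt E (1 : K)).symm (mulInvariantVectorField v) univ : E → E) = fun z => (show E →L[ℝ] E
      from mfderiv 𝓘(ℝ, E) 𝓘(ℝ, E) (chartAt E (1 : K)).symm z).inverse
        (mulInvariantVectorField v ((chartAt E (1 : K)).symm z)) := by
    funext z
    rw [VectorField.mpullbackWithin_apply, mfderivWithin_univ]
    rfl
  exact congrArg₂ (fun V W : E → E => VectorField.lieBracketWithin ℝ V W univ _) (e v) (e w)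

/-- The differential at `1` of a smooth homomorphism of Lie groups preserves Lie brackets. -/
theorem mfderiv_one_bracket (ι : K →* K') (hι : ContMDiff 𝓘(ℝ, E) 𝓘(ℝ, E') ∞ ι)
    (v w : GroupLieAlgebra 𝓘(ℝ, E) K) (v' w' : GroupLieAlgebra 𝓘(ℝ, E') K')
    (hv : mfderiv 𝓘(ℝ, E) 𝓘(ℝ, E') ι 1 v = v') (hw : mfderiv 𝓘(ℝ, E) 𝓘(ℝ, E') ι 1 w = w') :
    mfderiv 𝓘(ℝ, E) 𝓘(ℝ, E') ι 1 ⁅v, w⁆ = (⁅v', w'⁆ : GroupLieAlgebra 𝓘(ℝ, E') K') := by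
  obtain ⟨f, W, hf, hW, hWt, hfc, hfX⟩ := exists_contDiff_mulInvariantVectorField (E := E) K
  obtain ⟨f', W', hf', hW', hWt', hfc', hfX'⟩ :=
    exists_contDiff_mulInvariantVectorField (E := E') K'
  let ψ := chartAt E (1 : K)
  let φ := chartAt E' (1 : K')
  let c := ψ 1
  have h1 : (1 : K) ∈ ψ.source := mem_chart_source E 1
  have h1' : (1 : K') ∈ φ.source := mem_chart_source E' 1
  have hc : c ∈ ψ.target := ψ.map_source h1
  have hcs : ψ.symm c = 1 := ψ.left_inv h1
  have hψs : ContMDiffOn 𝓘(ℝ, E) 𝓘(ℝ, E) ∞ ψ.symm ψ.target := contMDiffOn_chart_symm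
  have hφ : ContMDiffOn 𝓘(ℝ, E') 𝓘(ℝ, E') ∞ φ φ.source := contMDiffOn_chart
  have hφs : ContMDiffOn 𝓘(ℝ, E') 𝓘(ℝ, E') ∞ φ.symm φ.target := contMDiffOn_chart_symm
  have hιψ : ContMDiffOn 𝓘(ℝ, E) 𝓘(ℝ, E') ∞ (ι ∘ ψ.symm) ψ.target := hι.comp_contMDiffOn hψs
  let S : Set E := ψ.target ∩ (ι ∘ ψ.symm) ⁻¹' φ.source
  have hS : IsOpen S := hιψ.continuousOn.isOpen_inter_preimage ψ.open_target φ.open_source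
  have hcS : c ∈ S := ⟨hc, by simp [hcs, h1']⟩
  let F : E → E' := fun z => φ (ι (ψ.symm z))
  have hF : ContDiffOn ℝ ∞ F S := contMDiffOn_iff_contDiffOn.1
    (hφ.comp (hιψ.mono inter_subset_left) fun z hz => hz.2)
  have hFc : F c = φ 1 := by simp [F, hcs]
  have hφd : ∀ y ∈ φ.target, MDifferentiableAt 𝓘(ℝ, E') 𝓘(ℝ, E') φ.symm y := fun y hy =>
    (hφs.contMDiffAt (φ.open_target.mem_nhds hy)).mdifferentiableAt (by simp)
  have hψd : ∀ y ∈ ψ.target, MDifferentiableAt 𝓘(ℝ, E) 𝓘(ℝ, E) ψ.symm y := fun y hy =>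
    (hψs.contMDiffAt (ψ.open_target.mem_nhds hy)).mdifferentiableAt (by simp)
  -- The invariant fields of `v` and `v'` are related by `ι`. Applying the chain rule to `φ.symm ∘ F
  -- = ι ∘ ψ.symm` and cancelling the invertible differential of `φ.symm` expresses this in charts.
  have hrel : ∀ (v : GroupLieAlgebra 𝓘(ℝ, E) K) (v' : GroupLieAlgebra 𝓘(ℝ, E') K'),
      mfderiv 𝓘(ℝ, E) 𝓘(ℝ, E') ι 1 v = v' →
      ∀ᶠ z in 𝓝 c, fderiv ℝ F z (f z v) = f' (F z) v' := by
    intro v v' hv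
    have hFW : ∀ᶠ z in 𝓝 c, F z ∈ W' := (hF.continuousOn.continuousAt (hS.mem_nhds hcS))
      (by rw [hFc]; exact hW')
    filter_upwards [hW, hFW, hS.mem_nhds hcS] with z hz hzW hzS
    have hFd : HasMFDerivAt 𝓘(ℝ, E) 𝓘(ℝ, E') F z (fderiv ℝ F z) := hasMFDerivAt_iff_hasFDerivAt.2
      ((hF.differentiableOn (by simp)).differentiableAt (hS.mem_nhds hzS)).hasFDerivAt
    have e1 := HasMFDerivAt.comp z (hφd (F z) (hWt' hzW)).hasMFDerivAt hFd
    have e2 := HasMFDerivAt.comp z (hι.mdifferentiable (by simp) (ψ.symm z)).hasMFDerivAt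
      (hψd z hzS.1).hasMFDerivAt
    have e12 : φ.symm ∘ F =ᶠ[𝓝 z] ι ∘ ψ.symm := by
      filter_upwards [hS.mem_nhds hzS] with y hy
      exact φ.left_inv hy.2
    have e3 := congrArg (fun T : E →L[ℝ] E' => T (f z v))
      (hasMFDerivAt_unique (e1.congr_of_eventuallyEq e12.symm) e2)
    have hFz : φ.symm (F z) = ι (ψ.symm z) := φ.left_inv hzS.2
    have e4 : (mulInvariantVectorField v' (φ.symm (F z)) : E') =
        mulInvariantVectorField v' (ι (ψ.symm z)) := by rw [hFz]
    have e5 := congrArg (fun u : E => (show E →L[ℝ] E' from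
      mfderiv 𝓘(ℝ, E) 𝓘(ℝ, E') ι (ψ.symm z)) u) (hfX z hz v)
    have e6 := mfderiv_mulInvariantVectorField_of_hom ι hι v (ψ.symm z)
    have e7 : (mulInvariantVectorField (I := 𝓘(ℝ, E'))
        (mfderiv 𝓘(ℝ, E) 𝓘(ℝ, E') ι 1 v : E') (ι (ψ.symm z)) : E') =
        mulInvariantVectorField v' (ι (ψ.symm z)) :=
      congrArg (fun u : E' => (mulInvariantVectorField (I := 𝓘(ℝ, E'))
        (u : GroupLieAlgebra 𝓘(ℝ, E') K') (ι (ψ.symm z)) : E')) hv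
    obtain ⟨T, hT⟩ := isInvertible_mfderiv_chartAt_symm (1 : K') (hWt' hzW)
    refine T.injective ?_
    have hT' : ∀ u, T u = (show E' →L[ℝ] E' from mfderiv 𝓘(ℝ, E') 𝓘(ℝ, E') φ.symm (F z)) u :=
      fun u => congrArg (fun R : E' →L[ℝ] E' => R u) hT
    rw [hT', hT']
    exact e3.trans (e5.trans (e6.trans (e7.trans (e4.symm.trans (hfX' (F z) hzW v').symm))))
  have hF' : ∀ u : E, fderiv ℝ F c u = (show E →L[ℝ] E' from mfderiv 𝓘(ℝ, E) 𝓘(ℝ, E') ι 1) u := by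
    intro u
    have h := (hrel u _ rfl).self_of_nhds
    rw [hFc] at h
    exact (congrArg (fderiv ℝ F c) (hfc u)).symm.trans (h.trans (hfc' _))
  rw [GroupLieAlgebra.bracket_eq_fderiv hW hWt hfX v w,
    GroupLieAlgebra.bracket_eq_fderiv hW' hWt' hfX' v' w']
  have hd : ∀ u, DifferentiableAt ℝ (fun z => f z u) c := fun u =>
    ((hf.differentiable (by simp)).clm_apply (differentiable_const u)) c
  have hd' : ∀ u, DifferentiableAt ℝ (fun z => f' z u) (F c) := fun u =>
    ((hf'.differentiable (by simp)).clm_apply (differentiable_const u)) _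
  have h := VectorField.fderiv_lieBracket_of_related
    ((hF.contDiffAt (hS.mem_nhds hcS)).of_le ENat.LEInfty.out) (hd v) (hd w) (hd' v')
    (hd' w') (hrel v v' hv) (hrel w w' hw)
  rw [hF', hFc] at h
  exact h

end LieBracket

/-! ### Connected Lie subgroups and exponentials -/

section ConnectedLieSubgroup

variable {E K : Type*} [NormedAddCommGroup E] [NormedSpace ℝ E] [FiniteDimensional ℝ E]
  [TopologicalSpace K] [ChartedSpace E K] [Group K] [LieGroup 𝓘(ℝ, E) ∞ K]

-- By the inverse function theorem the exponential is a local diffeomorphism at `0`.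
variable (E K) in
theorem image_lieExp_mem_nhds {N : Set E} (hN : N ∈ 𝓝 0) : lieExp K '' N ∈ 𝓝 (1 : K) := by
  have : CompleteSpace E := FiniteDimensional.complete ℝ E
  have : IsManifold 𝓘(ℝ, E) ∞ K := inferInstance
  obtain ⟨O, hO, h0O, hexp, hd⟩ := exists_contMDiffOn_lieExp E K
  obtain ⟨Θ, h0, hΘO, hΘ, -, -⟩ := hexp.exists_openPartialHomeomorph hO h0O
    (ContinuousLinearEquiv.refl ℝ E) hd
  have h1 := Θ.image_mem_nhds h0 (Filter.inter_mem hN (Θ.open_source.mem_nhds h0))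
  rw [← hΘ h0, lieExp_zero] at h1
  refine Filter.mem_of_superset h1 ?_
  rintro _ ⟨v, hv, rfl⟩
  exact ⟨v, hv.1, hΘ hv.2⟩

omit [FiniteDimensional ℝ E] in
theorem Subgroup.eq_top_of_mem_nhds_one {L : Type*} [TopologicalSpace L] [Group L]
    [IsTopologicalGroup L] [ConnectedSpace L] (H : Subgroup L) (hH : (H : Set L) ∈ 𝓝 1) : H = ⊤ := by
  have h1 := H.isOpen_of_mem_nhds hH
  have h2 : IsClopen (H : Set L) := ⟨H.isClosed_of_isOpen h1, h1⟩
  exact SetLike.coe_injective (h2.eq_univ ⟨1, H.one_mem⟩)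

/-- Naturality of the exponential under the immersed homomorphism `ι`: a vector `dι w` exponentiates
to `ι (exp w)`. -/
theorem IsConnectedLieSubgroup.lieExp_mem {H : Subgroup K}
    {h : Submodule ℝ (GroupLieAlgebra 𝓘(ℝ, E) K)} (hH : IsConnectedLieSubgroup H h) {v : E}
    (hv : v ∈ h) : lieExp K v ∈ H := by
  obtain ⟨n, L, _, _, _, _, _, ι, -, hι, rfl, rfl⟩ := hH
  obtain ⟨w, hw⟩ := hv
  exact ⟨lieExp (E := EuclideanSpace ℝ (Fin n)) L w, (map_lieExp ι hι.contMDiff w).trans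
    (congrArg (lieExp K) hw)⟩

/-- A connected Lie subgroup is generated by the exponentials of small vectors of its Lie
algebra. -/
theorem IsConnectedLieSubgroup.le_of_lieExp_mem {H : Subgroup K}
    {h : Submodule ℝ (GroupLieAlgebra 𝓘(ℝ, E) K)} (hH : IsConnectedLieSubgroup H h)
    (H' : Subgroup K) {N : Set E} (hN : N ∈ 𝓝 0) (hH' : ∀ v ∈ N, v ∈ h → lieExp K v ∈ H') :
    H ≤ H' := by
  obtain ⟨n, L, _, _, _, _, _, ι, -, hι, rfl, rfl⟩ := hH
  have : IsTopologicalGroup L := topologicalGroup_of_lieGroup (𝓡 n) ∞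
  let T : EuclideanSpace ℝ (Fin n) →L[ℝ] E := mfderiv (𝓡 n) 𝓘(ℝ, E) ι 1
  have hTN : T ⁻¹' N ∈ 𝓝 0 := T.continuous.continuousAt.preimage_mem_nhds (by rwa [map_zero])
  -- The argument takes place in the intrinsic topology of `L`, not in that induced from `K`: the
  -- preimage of `H'` contains a neighborhood of `1`, hence is all of the connected group `L`.
  have htop : H'.comap ι = ⊤ := by
    refine Subgroup.eq_top_of_mem_nhds_one _
      (Filter.mem_of_superset (image_lieExp_mem_nhds _ L hTN) ?_)
    rintro _ ⟨w, hw, rfl⟩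
    change ι (lieExp L w) ∈ H'
    rw [map_lieExp ι hι.contMDiff]
    exact hH' _ hw ⟨w, rfl⟩
  rintro _ ⟨l, rfl⟩
  exact (htop ▸ Subgroup.mem_top l : l ∈ H'.comap ι)

end ConnectedLieSubgroup

/-! ### Smooth local parametrizations and sections of the family of subgroups. -/

section Family

variable {EB B : Type*} [NormedAddCommGroup EB] [NormedSpace ℝ EB]
  [TopologicalSpace B] [ChartedSpace EB B]
  {E K : Type*} [NormedAddCommGroup E] [NormedSpace ℝ E] [FiniteDimensional ℝ E]
  [TopologicalSpace K] [ChartedSpace E K] [Group K] [LieGroup 𝓘(ℝ, E) ∞ K]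
  {r : ℕ} {g : B → Submodule ℝ (GroupLieAlgebra 𝓘(ℝ, E) K)} {G : B → Subgroup K}

/-- Near a point of the base, a smooth family of parametrizations of the subgroups `G x` near
`1`. -/
theorem exists_smooth_family_param (hg : IsSmoothSubbundle (F := E) 𝓘(ℝ, EB) r g)
    (hG : ∀ x, IsConnectedLieSubgroup (G x) (g x)) (x₀ : B) :
    ∃ (U : Set (B × EuclideanSpace ℝ (Fin r))) (e : B × EuclideanSpace ℝ (Fin r) → K)
      (S : EuclideanSpace ℝ (Fin r) →L[ℝ] E), IsOpen U ∧ (x₀, 0) ∈ U ∧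
      ContMDiffOn (𝓘(ℝ, EB).prod 𝓘(ℝ, EuclideanSpace ℝ (Fin r))) 𝓘(ℝ, E) ∞ e U ∧
      (∀ p ∈ U, e p ∈ G p.1) ∧ e (x₀, 0) = 1 ∧
      HasMFDerivAt 𝓘(ℝ, EuclideanSpace ℝ (Fin r)) 𝓘(ℝ, E) (fun u => e (x₀, u)) 0 S ∧
      Function.Injective S ∧ (S : EuclideanSpace ℝ (Fin r) →ₗ[ℝ] E).range = g x₀ ∧
      ∃ N ∈ 𝓝 (0 : E), ∀ v ∈ N, v ∈ g x₀ → ∃ u, (x₀, u) ∈ U ∧ e (x₀, u) = lieExp K v := by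
  obtain ⟨U, hU, hx₀, s, hs, hsU⟩ := hg x₀
  obtain ⟨N, hN, h0N, hexp, hd⟩ := exists_contMDiffOn_lieExp E K
  let ν : B × EuclideanSpace ℝ (Fin r) → E := fun p => ∑ i, p.2 i • s i p.1
  have hν : ContMDiffOn (𝓘(ℝ, EB).prod 𝓘(ℝ, EuclideanSpace ℝ (Fin r))) 𝓘(ℝ, E) ∞ ν
      (U ×ˢ univ) := by
    refine contMDiffOn_finsetSum fun i _ => ?_
    have h1 : ContMDiff (𝓘(ℝ, EB).prod 𝓘(ℝ, EuclideanSpace ℝ (Fin r))) 𝓘(ℝ, ℝ) ∞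
        fun p : B × EuclideanSpace ℝ (Fin r) => p.2 i :=
      (EuclideanSpace.proj i : EuclideanSpace ℝ (Fin r) →L[ℝ] ℝ).contMDiff.comp contMDiff_snd
    refine h1.contMDiffOn.smul ?_
    exact (hs i).comp contMDiffOn_fst fun p hp => hp.1
  let S : EuclideanSpace ℝ (Fin r) →L[ℝ] E :=
    ∑ i, (EuclideanSpace.proj i : EuclideanSpace ℝ (Fin r) →L[ℝ] ℝ).smulRight (s i x₀)
  have hS : ∀ u, S u = ν (x₀, u) := fun u => by simp [S, ν]
  have hli := (hsU x₀ hx₀).1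
  have hsp : ∀ x ∈ U, ∀ v : E, v ∈ Submodule.span ℝ (range fun i => s i x) ↔ v ∈ g x :=
    fun x hx v => SetLike.ext_iff.1 (hsU x hx).2 v
  have hνg : ∀ x ∈ U, ∀ u, ν (x, u) ∈ g x := by
    intro x hx u
    exact (hsp x hx _).1 <| Submodule.sum_mem _ fun i _ => Submodule.smul_mem _ _ (Submodule.subset_span ⟨i, rfl⟩)
  have hrange : ∀ v ∈ g x₀, ∃ u, S u = v := by
    intro v hv
    obtain ⟨c, hc⟩ := (Submodule.mem_span_range_iff_exists_fun ℝ).1 ((hsp x₀ hx₀ v).2 hv)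
    exact ⟨WithLp.toLp 2 c, by rw [hS]; exact hc⟩
  refine ⟨(U ×ˢ univ) ∩ ν ⁻¹' N, fun p => lieExp K (ν p), S,
    hν.continuousOn.isOpen_inter_preimage (hU.prod isOpen_univ) hN,
    ⟨⟨hx₀, mem_univ _⟩, by simpa [ν] using h0N⟩, hexp.comp (hν.mono inter_subset_left)
    fun p hp => hp.2, fun p hp => (hG p.1).lieExp_mem (hνg _ hp.1.1 _), by simp [ν, lieExp_zero],
    ?_, ?_, ?_, N, hN.mem_nhds h0N, ?_⟩
  · have hid : (mfderiv 𝓘(ℝ, E) 𝓘(ℝ, E) (lieExp K : E → K) 0 : E →L[ℝ] E) =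
        ContinuousLinearMap.id ℝ E := ContinuousLinearMap.ext hd
    have h1 := ((hexp.contMDiffAt (hN.mem_nhds h0N)).mdifferentiableAt (by simp)).hasMFDerivAt
    rw [hid, ← map_zero S] at h1
    have h2 := HasMFDerivAt.comp (0 : EuclideanSpace ℝ (Fin r)) h1
      (hasMFDerivAt_iff_hasFDerivAt.2 S.hasFDerivAt)
    exact h2.congr_of_eventuallyEq (.of_forall fun u => congrArg (lieExp K) (hS u).symm)
  · rw [injective_iff_map_eq_zero]
    intro u hu
    rw [hS] at hu
    ext i
    exact Fintype.linearIndependent_iff.1 hli _ hu i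
  · ext v
    refine ⟨?_, hrange v⟩
    rintro ⟨u, rfl⟩
    exact (hS u) ▸ hνg x₀ hx₀ u
  · intro v hv hvg
    obtain ⟨u, rfl⟩ := hrange v hvg
    exact ⟨u, ⟨⟨hx₀, mem_univ _⟩, by rw [mem_preimage, ← hS]; exact hv⟩, by rw [hS]⟩

/-- Through every point of `G x₀` there is a smooth local section of the family `G`. -/
theorem exists_smooth_section (hg : IsSmoothSubbundle (F := E) 𝓘(ℝ, EB) r g)
    (hG : ∀ x, IsConnectedLieSubgroup (G x) (g x)) {x₀ : B} {k : K} (hk : k ∈ G x₀) :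
    ∃ (U : Set B) (σ : B → K), IsOpen U ∧ x₀ ∈ U ∧ ContMDiffOn 𝓘(ℝ, EB) 𝓘(ℝ, E) ∞ σ U ∧
      (∀ x ∈ U, σ x ∈ G x) ∧ σ x₀ = k := by
  let H : Subgroup K :=
    { carrier := {k | ∃ (U : Set B) (σ : B → K), IsOpen U ∧ x₀ ∈ U ∧
        ContMDiffOn 𝓘(ℝ, EB) 𝓘(ℝ, E) ∞ σ U ∧ (∀ x ∈ U, σ x ∈ G x) ∧ σ x₀ = k}
      one_mem' := ⟨univ, fun _ => 1, isOpen_univ, mem_univ _, contMDiffOn_const,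
        fun x _ => (G x).one_mem, rfl⟩
      mul_mem' := by
        rintro _ _ ⟨U, σ, hU, hx, hσ, hσG, rfl⟩ ⟨U', σ', hU', hx', hσ', hσG', rfl⟩
        exact ⟨U ∩ U', fun x => σ x * σ' x, hU.inter hU', ⟨hx, hx'⟩,
          (hσ.mono inter_subset_left).mul (hσ'.mono inter_subset_right),
          fun x hx => (G x).mul_mem (hσG x hx.1) (hσG' x hx.2), rfl⟩
      inv_mem' := by
        rintro _ ⟨U, σ, hU, hx, hσ, hσG, rfl⟩
        exact ⟨U, fun x => (σ x)⁻¹, hU, hx, hσ.inv, fun x hx => (G x).inv_mem (hσG x hx), rfl⟩ }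
  obtain ⟨U, e, S, hU, hxU, he, heG, -, -, -, -, N, hN, hNU⟩ := exists_smooth_family_param hg hG x₀
  refine (hG x₀).le_of_lieExp_mem H hN (fun v hv hvg => ?_) hk
  -- With the coefficients `u` frozen, letting the base point vary extends `exp v` to the section `x
  -- ↦ e (x, u)`.
  obtain ⟨u, huU, hu⟩ := hNU v hv hvg
  have hc : ContMDiff 𝓘(ℝ, EB) (𝓘(ℝ, EB).prod 𝓘(ℝ, EuclideanSpace ℝ (Fin r))) ∞
    fun x : B => (x, u) := contMDiff_id.prodMk contMDiff_const
  exact ⟨(fun x => (x, u)) ⁻¹' U, fun x => e (x, u), hU.preimage hc.continuous, huU,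
    he.comp hc.contMDiffOn fun x hx => hx, fun x hx => heG _ hx, hu⟩

end Family

/-! ### Slices -/

section Slices

open Module

theorem Manifold.IsImmersionAt.mfderiv_injective {E H M E' H' N : Type*} [NormedAddCommGroup E]
    [NormedSpace ℝ E] [FiniteDimensional ℝ E] [TopologicalSpace H] {I : ModelWithCorners ℝ E H}
    [I.Boundaryless] [TopologicalSpace M] [ChartedSpace H M] [IsManifold I ∞ M]
    [NormedAddCommGroup E'] [NormedSpace ℝ E'] [FiniteDimensional ℝ E'] [TopologicalSpace H']
    {J : ModelWithCorners ℝ E' H'} [J.Boundaryless] [TopologicalSpace N] [ChartedSpace H' N]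
    [IsManifold J ∞ N] {f : M → N} {x : M} (hf : IsImmersionAt I J ∞ f x) :
    Function.Injective (mfderiv I J f x) := by
  obtain ⟨V, ρ, hV, hxV, hρ, h⟩ := hf.exists_leftInverse
  exact Function.LeftInverse.injective (g := mfderiv J I ρ (f x)) fun v =>
    mfderiv_injective_of_leftInverse (hf.contMDiffAt.mdifferentiableAt (by simp))
      ((hρ.contMDiffAt (hV.mem_nhds hxV)).mdifferentiableAt (by simp)) h v

/-- The parametrization is the inverse of the chart at `a`, translated so that `0` goes to `a`; its
differential at `0` is therefore that of the inclusion. -/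
theorem exists_param_of_isImmersionAt {E K : Type*} [NormedAddCommGroup E] [NormedSpace ℝ E]
    [FiniteDimensional ℝ E] [TopologicalSpace K] [ChartedSpace E K] [IsManifold 𝓘(ℝ, E) ∞ K]
    {E₂ : Type*} [NormedAddCommGroup E₂] [NormedSpace ℝ E₂] [FiniteDimensional ℝ E₂]
    {A : Set K} [ChartedSpace E₂ A] [IsManifold 𝓘(ℝ, E₂) ∞ A]
    (hA : IsImmersion 𝓘(ℝ, E₂) 𝓘(ℝ, E) ∞ (Subtype.val : A → K)) (a : A) :
    ∃ (D : Set E₂) (α : E₂ → K) (T : E₂ →L[ℝ] E), IsOpen D ∧ 0 ∈ D ∧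
      ContMDiffOn 𝓘(ℝ, E₂) 𝓘(ℝ, E) ∞ α D ∧ α 0 = a ∧ (∀ y ∈ D, α y ∈ A) ∧
      (∀ y ∈ D, α y = a → y = 0) ∧ HasMFDerivAt 𝓘(ℝ, E₂) 𝓘(ℝ, E) α 0 T ∧
      Function.Injective T ∧ (T : E₂ →ₗ[ℝ] E).range =
        (mfderiv 𝓘(ℝ, E₂) 𝓘(ℝ, E) (Subtype.val : A → K) a).range := by
  let ψ := chartAt E₂ a
  let c := ψ a
  have ha : a ∈ ψ.source := mem_chart_source E₂ a
  have hc : c ∈ ψ.target := ψ.map_source ha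
  have hψs : ContMDiffOn 𝓘(ℝ, E₂) 𝓘(ℝ, E₂) ∞ ψ.symm ψ.target := contMDiffOn_chart_symm
  let τ : E₂ → E₂ := fun y => y + c
  have hτ : ContDiff ℝ ∞ τ := contDiff_id.add contDiff_const
  let T : E₂ →L[ℝ] E := mfderiv 𝓘(ℝ, E₂) 𝓘(ℝ, E) (Subtype.val : A → K) a
  have hval : MDifferentiableAt 𝓘(ℝ, E₂) 𝓘(ℝ, E) (Subtype.val : A → K) a :=
    hA.contMDiff.mdifferentiable (by simp) a
  refine ⟨τ ⁻¹' ψ.target, fun y => ψ.symm (τ y), T, ψ.open_target.preimage hτ.continuous,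
    by simpa [τ] using hc, ?_, ?_, fun y _ => (ψ.symm (τ y)).2, ?_, ?_,
    (hA.isImmersionAt a).mfderiv_injective, rfl⟩
  · exact hA.contMDiff.comp_contMDiffOn (hψs.comp hτ.contMDiff.contMDiffOn fun y hy => hy)
  · simp [τ, c, ψ.left_inv ha]
  · intro y hy h
    have h1 : ψ.symm (τ y) = ψ.symm c := (Subtype.ext h).trans (ψ.left_inv ha).symm
    have h2 := ψ.symm.injOn hy hc h1
    simpa [τ] using h2
  · have e1 : HasMFDerivAt 𝓘(ℝ, E₂) 𝓘(ℝ, E₂) τ 0 (ContinuousLinearMap.id ℝ E₂) :=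
      hasMFDerivAt_iff_hasFDerivAt.2 ((hasFDerivAt_id _).add_const c)
    have e2 := ((hψs.contMDiffAt (ψ.open_target.mem_nhds hc)).mdifferentiableAt
      (by simp)).hasMFDerivAt
    have hid : (mfderiv 𝓘(ℝ, E₂) 𝓘(ℝ, E₂) ψ.symm c : E₂ →L[ℝ] E₂) = ContinuousLinearMap.id ℝ E₂ :=
      ContinuousLinearMap.ext fun v => mfderiv_chartAt_symm_self (E := E₂) a v
    have hτ0 : τ 0 = c := by simp [τ]
    have e3 : HasMFDerivAt 𝓘(ℝ, E₂) 𝓘(ℝ, E) (Subtype.val : A → K) (ψ.symm c) T := by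
      have : ψ.symm c = a := ψ.left_inv ha
      rw [this]
      exact hval.hasMFDerivAt
    rw [hid] at e2
    have e4 := HasMFDerivAt.comp c e3 e2
    rw [← hτ0] at e4
    exact HasMFDerivAt.comp (0 : E₂) e4 e1

variable {E K : Type*} [NormedAddCommGroup E] [NormedSpace ℝ E]
  [TopologicalSpace K] [ChartedSpace E K] [Group K] [LieGroup 𝓘(ℝ, E) ∞ K]
  {E₁ E₂ : Type*} [NormedAddCommGroup E₁] [NormedSpace ℝ E₁] [NormedAddCommGroup E₂]
  [NormedSpace ℝ E₂]

theorem mfderiv_mul_left_injective_lieGroup (k h : K) :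
    Function.Injective (mfderiv 𝓘(ℝ, E) 𝓘(ℝ, E) (k * · : K → K) h) := by
  refine Function.LeftInverse.injective
    (g := mfderiv 𝓘(ℝ, E) 𝓘(ℝ, E) (k⁻¹ * · : K → K) (k * h)) fun v => ?_
  exact mfderiv_injective_of_leftInverse (mdifferentiable_mul_left_lieGroup k h)
    (mdifferentiable_mul_left_lieGroup k⁻¹ _) (.of_forall fun y => by simp) v

/-- The product of parametrizations of transversal submanifolds of a Lie group through `1` is
immersive at the base point. -/
theorem exists_hasMFDerivAt_mul_mul {ε : E₁ → K} {α : E₂ → K} {S : E₁ →L[ℝ] E} {T : E₂ →L[ℝ] E}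
    (hε : HasMFDerivAt 𝓘(ℝ, E₁) 𝓘(ℝ, E) ε 0 S) (hα : HasMFDerivAt 𝓘(ℝ, E₂) 𝓘(ℝ, E) α 0 T)
    (hε1 : ε 0 = 1) (hα1 : α 0 = 1) (hS : Function.Injective S) (hT : Function.Injective T)
    (hST : Disjoint (S : E₁ →ₗ[ℝ] E).range (T : E₂ →ₗ[ℝ] E).range) (k : K) :
    ∃ D : E₁ × E₂ →L[ℝ] E, HasMFDerivAt 𝓘(ℝ, E₁ × E₂) 𝓘(ℝ, E)
      (fun p : E₁ × E₂ => k * (ε p.1 * α p.2)) 0 D ∧ Function.Injective D := by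
  have hf : HasMFDerivAt 𝓘(ℝ, E₁ × E₂) 𝓘(ℝ, E₁) (Prod.fst : E₁ × E₂ → E₁) 0
    (ContinuousLinearMap.fst ℝ E₁ E₂) := hasMFDerivAt_iff_hasFDerivAt.2 hasFDerivAt_fst
  have hs : HasMFDerivAt 𝓘(ℝ, E₁ × E₂) 𝓘(ℝ, E₂) (Prod.snd : E₁ × E₂ → E₂) 0
    (ContinuousLinearMap.snd ℝ E₁ E₂) := hasMFDerivAt_iff_hasFDerivAt.2 hasFDerivAt_snd
  let P : E₁ × E₂ → K := fun p => ε p.1 * α p.2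
  have hm : MDifferentiableAt (𝓘(ℝ, E).prod 𝓘(ℝ, E)) 𝓘(ℝ, E) (fun p : K × K => p.1 * p.2)
      (ε 0, α 0) :=
    (contMDiff_mul 𝓘(ℝ, E) ∞ (G := K)).mdifferentiable (by simp) _
  have hP : MDifferentiableAt 𝓘(ℝ, E₁ × E₂) 𝓘(ℝ, E) P 0 := by
    have h1 := (HasMFDerivAt.comp (0 : E₁ × E₂) hε hf).mdifferentiableAt
    have h2 := (HasMFDerivAt.comp (0 : E₁ × E₂) hα hs).mdifferentiableAt
    exact MDifferentiableAt.comp (0 : E₁ × E₂) hm (h1.prodMk h2)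
  let D₀ : E₁ × E₂ →L[ℝ] E := mfderiv 𝓘(ℝ, E₁ × E₂) 𝓘(ℝ, E) P 0
  have hD₀ : HasMFDerivAt 𝓘(ℝ, E₁ × E₂) 𝓘(ℝ, E) P 0 D₀ := hP.hasMFDerivAt
  have hl : ∀ u, D₀ (u, 0) = S u := by
    have e1 : HasMFDerivAt 𝓘(ℝ, E₁) 𝓘(ℝ, E₁ × E₂) (fun u : E₁ => (u, (0 : E₂))) 0
      (ContinuousLinearMap.inl ℝ E₁ E₂) :=
        hasMFDerivAt_iff_hasFDerivAt.2 (hasFDerivAt_prodMk_left _ _)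
    have e2 := HasMFDerivAt.comp (0 : E₁) hD₀ e1
    have e3 : (P ∘ fun u : E₁ => (u, (0 : E₂))) = ε := by
      funext u
      simp [P, hα1]
    rw [e3] at e2
    exact fun u => congrArg (fun R : E₁ →L[ℝ] E => R u) (hasMFDerivAt_unique e2 hε)
  have hr : ∀ u, D₀ (0, u) = T u := by
    have e1 : HasMFDerivAt 𝓘(ℝ, E₂) 𝓘(ℝ, E₁ × E₂) (fun u : E₂ => ((0 : E₁), u)) 0
      (ContinuousLinearMap.inr ℝ E₁ E₂) :=
        hasMFDerivAt_iff_hasFDerivAt.2 (hasFDerivAt_prodMk_right _ _)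
    have e2 := HasMFDerivAt.comp (0 : E₂) hD₀ e1
    have e3 : (P ∘ fun u : E₂ => ((0 : E₁), u)) = α := by
      funext u
      simp [P, hε1]
    rw [e3] at e2
    exact fun u => congrArg (fun R : E₂ →L[ℝ] E => R u) (hasMFDerivAt_unique e2 hα)
  have hinj : Function.Injective D₀ := by
    rw [injective_iff_map_eq_zero]
    rintro ⟨u, y⟩ h
    have h1 : S u + T y = 0 := by
      rw [← hl, ← hr, ← map_add]
      simpa using h
    -- Here `S u = T (-y)` lies in both ranges, which are disjoint.
    have h2 : S u = 0 := by
      refine Submodule.disjoint_def.1 hST _ ⟨u, rfl⟩ ⟨-y, ?_⟩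
      simpa using (eq_neg_of_add_eq_zero_left h1).symm
    have h3 : T y = 0 := by simpa [h2] using h1
    rw [Prod.mk_eq_zero]
    exact ⟨hS (h2.trans S.map_zero.symm), hT (h3.trans T.map_zero.symm)⟩
  refine ⟨_, HasMFDerivAt.comp (0 : E₁ × E₂)
    (mdifferentiable_mul_left_lieGroup (E := E) k (P 0)).hasMFDerivAt hD₀, ?_⟩
  exact (mfderiv_mul_left_injective_lieGroup k (P 0)).comp hinj

/-- The inverse function theorem, for an injective differential between spaces of the same
dimension. -/
theorem ContMDiffOn.exists_openPartialHomeomorph_of_injective {E₁ E' H' N : Type*}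
    [NormedAddCommGroup E₁] [NormedSpace ℝ E₁] [FiniteDimensional ℝ E₁]
    [NormedAddCommGroup E'] [NormedSpace ℝ E'] [FiniteDimensional ℝ E'] [TopologicalSpace H']
    {J : ModelWithCorners ℝ E' H'} [J.Boundaryless] [TopologicalSpace N] [ChartedSpace H' N]
    [IsManifold J ∞ N] {f : E₁ → N} {U : Set E₁}
    (hf : ContMDiffOn 𝓘(ℝ, E₁) J ∞ f U) (hU : IsOpen U) {a : E₁} (ha : a ∈ U)
    {D : E₁ →L[ℝ] E'} (hD : HasMFDerivAt 𝓘(ℝ, E₁) J f a D) (hinj : Function.Injective D)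
    (hd : finrank ℝ E₁ = finrank ℝ E') :
    ∃ Θ : OpenPartialHomeomorph E₁ N, a ∈ Θ.source ∧ Θ.source ⊆ U ∧ EqOn f Θ Θ.source ∧
      ContMDiffOn 𝓘(ℝ, E₁) J ∞ Θ Θ.source ∧ ContMDiffOn J 𝓘(ℝ, E₁) ∞ Θ.symm Θ.target := by
  have : CompleteSpace E₁ := FiniteDimensional.complete ℝ E₁
  let e : E₁ ≃L[ℝ] E' :=
    (LinearEquiv.ofInjectiveOfFinrankEq (D : E₁ →ₗ[ℝ] E') hinj hd).toContinuousLinearEquiv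
  refine hf.exists_openPartialHomeomorph hU ha e fun v => ?_
  exact congrArg (fun R : E₁ →L[ℝ] E' => R v) hD.mfderiv

end Slices

/-! ### Slices for the single subgroups and for their union. -/

section FamilySlices

open Module

variable {EB B : Type*} [NormedAddCommGroup EB] [NormedSpace ℝ EB] [FiniteDimensional ℝ EB]
  [TopologicalSpace B] [ChartedSpace EB B] [IsManifold 𝓘(ℝ, EB) ∞ B]
  {E K : Type*} [NormedAddCommGroup E] [NormedSpace ℝ E] [FiniteDimensional ℝ E]
  [TopologicalSpace K] [ChartedSpace E K] [Group K] [LieGroup 𝓘(ℝ, E) ∞ K]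
  {r : ℕ} {g : B → Submodule ℝ (GroupLieAlgebra 𝓘(ℝ, E) K)} {G : B → Subgroup K}
  {E₁ E₂ : Type*} [NormedAddCommGroup E₁] [NormedSpace ℝ E₁] [FiniteDimensional ℝ E₁]
  [NormedAddCommGroup E₂] [NormedSpace ℝ E₂] [FiniteDimensional ℝ E₂]

/-- A parametrized submanifold through `1`, complementary to the Lie algebra `h` at `1`, which meets
the subgroups `G x`, `x ∈ V`, at `1` only. -/
structure IsTransversal (h : Submodule ℝ E) (G : B → Subgroup K) (V : Set B) (D : Set E₂)
    (α : E₂ → K) (T : E₂ →L[ℝ] E) : Prop where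
  isOpen_domain : IsOpen D
  zero_mem : 0 ∈ D
  contMDiffOn : ContMDiffOn 𝓘(ℝ, E₂) 𝓘(ℝ, E) ∞ α D
  map_zero : α 0 = 1
  hasMFDerivAt : HasMFDerivAt 𝓘(ℝ, E₂) 𝓘(ℝ, E) α 0 T
  injective : Function.Injective T
  isCompl : IsCompl (T : E₂ →ₗ[ℝ] E).range h
  isOpen : IsOpen V
  eq_zero : ∀ x ∈ V, ∀ y ∈ D, α y ∈ G x → y = 0

-- The complement condition forces `m = finrank ℝ E - r`. Thus all points of the base can use the
-- same model space for the transversal, as one family of slices requires.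
omit [FiniteDimensional ℝ EB] [IsManifold 𝓘(ℝ, EB) ∞ B] in
theorem exists_isTransversal (x₀ : B) {h : Submodule ℝ E} (hr : finrank ℝ h = r)
    (hA : ∃ (A : Set K) (m : ℕ) (_ : ChartedSpace (EuclideanSpace ℝ (Fin m)) A)
      (_ : IsManifold (𝓡 m) ∞ A) (V : Set B) (h1 : (1 : K) ∈ A),
      IsSmoothEmbedding (𝓡 m) 𝓘(ℝ, E) ∞ (Subtype.val : A → K) ∧
      IsCompl (mfderiv (𝓡 m) 𝓘(ℝ, E) (Subtype.val : A → K) ⟨1, h1⟩).range h ∧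
      IsOpen V ∧ x₀ ∈ V ∧ ∀ x ∈ V, (G x : Set K) ∩ A = {1}) :
    r + (finrank ℝ E - r) = finrank ℝ E ∧
    ∃ (V : Set B) (D : Set (EuclideanSpace ℝ (Fin (finrank ℝ E - r))))
      (α : EuclideanSpace ℝ (Fin (finrank ℝ E - r)) → K)
      (T : EuclideanSpace ℝ (Fin (finrank ℝ E - r)) →L[ℝ] E),
      x₀ ∈ V ∧ IsTransversal h G V D α T := by
  obtain ⟨A, m, _, _, V, h1, hA, hc, hV, hxV, hVA⟩ := hA
  obtain ⟨D, α, T, hD, h0, hα, hα0, hαA, hα1, hαT, hT, hTr⟩ :=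
    exists_param_of_isImmersionAt hA.isImmersion ⟨1, h1⟩
  have hc' : IsCompl (T : EuclideanSpace ℝ (Fin m) →ₗ[ℝ] E).range h := by
    rw [hTr]
    exact hc
  have hfin := Submodule.finrank_add_eq_of_isCompl hc'
  rw [LinearMap.finrank_range_of_inj hT, finrank_euclideanSpace_fin, hr] at hfin
  have hm : m = finrank ℝ E - r := by omega
  subst hm
  refine ⟨by omega, V, D, α, T, hxV, hD, h0, hα, hα0, hαT, hT, hc', hV, fun x hx y hy hyG => ?_⟩
  refine hα1 y hy ?_
  have : α y ∈ (G x : Set K) ∩ A := ⟨hyG, hαA y hy⟩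
  rw [hVA x hx] at this
  exact this

omit [FiniteDimensional ℝ EB] [IsManifold 𝓘(ℝ, EB) ∞ B] [FiniteDimensional ℝ E]
  [LieGroup 𝓘(ℝ, E) ∞ K] in
theorem IsSmoothSubbundle.finrank_eq (hg : IsSmoothSubbundle (F := E) 𝓘(ℝ, EB) r g) (x : B) :
    finrank ℝ (g x) = r := by
  obtain ⟨U, -, hx, s, -, hs⟩ := hg x
  have h := finrank_span_eq_card (hs x hx).1
  rw [Fintype.card_fin] at h
  rw [← h]
  exact congrArg (fun W : Submodule ℝ E => finrank ℝ W) (hs x hx).2.symm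

omit [FiniteDimensional ℝ EB] [IsManifold 𝓘(ℝ, EB) ∞ B] in
/-- Slices for the subgroups `G x`. -/
theorem exists_isSlice_subgroup (hg : IsSmoothSubbundle (F := E) 𝓘(ℝ, EB) r g)
    (hG : ∀ x, IsConnectedLieSubgroup (G x) (g x)) {x₀ : B} {V : Set B} {D : Set E₂}
    {α : E₂ → K} {T : E₂ →L[ℝ] E} (hT : IsTransversal (E := E) (g x₀) G V D α T) (hx₀ : x₀ ∈ V)
    (hd : r + finrank ℝ E₂ = finrank ℝ E) {k : K} (hk : k ∈ G x₀) :
    ∃ Θ : OpenPartialHomeomorph (EuclideanSpace ℝ (Fin r) × E₂) K, k ∈ Θ.target ∧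
      IsSlice 𝓘(ℝ, E) (G x₀ : Set K) Θ := by
  obtain ⟨U, e, S, hU, h0U, he, heG, he1, hS, hSi, hSr, -⟩ := exists_smooth_family_param hg hG x₀
  have hdisj : Disjoint (S : EuclideanSpace ℝ (Fin r) →ₗ[ℝ] E).range (T : E₂ →ₗ[ℝ] E).range := by
    rw [hSr]
    exact hT.isCompl.symm.disjoint
  obtain ⟨P, hP, hPi⟩ := exists_hasMFDerivAt_mul_mul hS hT.hasMFDerivAt he1 hT.map_zero hSi
    hT.injective hdisj k
  let O : Set (EuclideanSpace ℝ (Fin r) × E₂) := ((fun p => (x₀, p.1)) ⁻¹' U) ∩ (Prod.snd ⁻¹' D)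
  have hO : IsOpen O := (hU.preimage (by fun_prop)).inter (hT.isOpen_domain.preimage continuous_snd)
  have h0O : (0 : EuclideanSpace ℝ (Fin r) × E₂) ∈ O := ⟨h0U, hT.zero_mem⟩
  have hc : ContMDiff 𝓘(ℝ, EuclideanSpace ℝ (Fin r) × E₂)
      (𝓘(ℝ, EB).prod 𝓘(ℝ, EuclideanSpace ℝ (Fin r))) ∞
      fun p : EuclideanSpace ℝ (Fin r) × E₂ => (x₀, p.1) :=
    contMDiff_const.prodMk contDiff_fst.contMDiff
  have hsm : ContMDiffOn 𝓘(ℝ, EuclideanSpace ℝ (Fin r) × E₂) 𝓘(ℝ, E) ∞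
      (fun p : EuclideanSpace ℝ (Fin r) × E₂ => k * (e (x₀, p.1) * α p.2)) O :=
    contMDiffOn_const.mul ((he.comp hc.contMDiffOn fun p hp => hp.1).mul
      (hT.contMDiffOn.comp (contDiff_snd.contMDiff.contMDiffOn) fun p hp => hp.2))
  obtain ⟨Θ, h0Θ, hΘO, hΘ, hΘs, hΘs'⟩ := hsm.exists_openPartialHomeomorph_of_injective hO h0O hP hPi
    (by simpa using hd)
  refine ⟨Θ, ?_, hΘs, hΘs', fun z hz => ?_⟩
  · have := Θ.map_source h0Θ
    rw [← hΘ h0Θ] at this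
    simpa [he1, hT.map_zero] using this
  · rw [← hΘ hz]
    have hzO := hΘO hz
    change k * (e (x₀, z.1) * α z.2) ∈ G x₀ ↔ _
    -- Both `k` and `e (x₀, z.1)` lie in `G x₀`, so only the transversal factor decides membership.
    rw [(G x₀).mul_mem_cancel_left hk, (G x₀).mul_mem_cancel_left (heG _ hzO.1)]
    refine ⟨hT.eq_zero x₀ hx₀ _ hzO.2, fun h => ?_⟩
    rw [h, hT.map_zero]
    exact (G x₀).one_mem

omit [TopologicalSpace B] [TopologicalSpace K] in
theorem mem_familyUnion {x : B} {k : K} : (x, k) ∈ familyUnion G ↔ k ∈ G x := by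
  simp [familyUnion]

/-- Slices for the union of the subgroups `G x`. -/
theorem exists_isSlice_familyUnion (hg : IsSmoothSubbundle (F := E) 𝓘(ℝ, EB) r g)
    (hG : ∀ x, IsConnectedLieSubgroup (G x) (g x)) {x₀ : B} {V : Set B} {D : Set E₂}
    {α : E₂ → K} {T : E₂ →L[ℝ] E} (hT : IsTransversal (E := E) (g x₀) G V D α T) (hx₀ : x₀ ∈ V)
    (hd : r + finrank ℝ E₂ = finrank ℝ E) {k : K} (hk : k ∈ G x₀)
    (q : E₁ ≃L[ℝ] EB × EuclideanSpace ℝ (Fin r)) :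
    ∃ Θ : OpenPartialHomeomorph (E₁ × E₂) (B × K), (x₀, k) ∈ Θ.target ∧
      IsSlice (𝓘(ℝ, EB).prod 𝓘(ℝ, E)) (familyUnion G) Θ := by
  obtain ⟨U, e, S, hU, h0U, he, heG, he1, hS, hSi, hSr, -⟩ := exists_smooth_family_param hg hG x₀
  obtain ⟨Uσ, σ, hUσ, hxσ, hσ, hσG, hσx⟩ := exists_smooth_section hg hG hk
  have hdisj : Disjoint (S : EuclideanSpace ℝ (Fin r) →ₗ[ℝ] E).range (T : E₂ →ₗ[ℝ] E).range := by
    rw [hSr]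
    exact hT.isCompl.symm.disjoint
  obtain ⟨P, hP, hPi⟩ := exists_hasMFDerivAt_mul_mul hS hT.hasMFDerivAt he1 hT.map_zero hSi
    hT.injective hdisj k
  let φ := chartAt EB x₀
  have hxφ : x₀ ∈ φ.source := mem_chart_source EB x₀
  have hcφ : φ x₀ ∈ φ.target := φ.map_source hxφ
  have hφx : φ.symm (φ x₀) = x₀ := φ.left_inv hxφ
  have hφs : ContMDiffOn 𝓘(ℝ, EB) 𝓘(ℝ, EB) ∞ φ.symm φ.target := contMDiffOn_chart_symm
  let w₀ : E₁ := q.symm (φ x₀, 0)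
  have hq₁ : ContDiff ℝ ∞ fun z : E₁ × E₂ => (q z.1).1 :=
    contDiff_fst.comp (q.contDiff.comp contDiff_fst)
  have hq₂ : ContDiff ℝ ∞ fun z : E₁ × E₂ => (q z.1).2 :=
    contDiff_snd.comp (q.contDiff.comp contDiff_fst)
  let O₁ : Set (E₁ × E₂) := (fun z => (q z.1).1) ⁻¹' φ.target
  have hO₁ : IsOpen O₁ := φ.open_target.preimage hq₁.continuous
  let b : E₁ × E₂ → B := fun z => φ.symm (q z.1).1
  have hb : ContMDiffOn 𝓘(ℝ, E₁ × E₂) 𝓘(ℝ, EB) ∞ b O₁ :=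
    hφs.comp hq₁.contMDiff.contMDiffOn fun z hz => hz
  let O : Set (E₁ × E₂) := (O₁ ∩ (fun z => (b z, (q z.1).2)) ⁻¹' U) ∩ (O₁ ∩ b ⁻¹' (Uσ ∩ V)) ∩
    Prod.snd ⁻¹' D
  have hbu : ContMDiffOn 𝓘(ℝ, E₁ × E₂) (𝓘(ℝ, EB).prod 𝓘(ℝ, EuclideanSpace ℝ (Fin r))) ∞
      (fun z : E₁ × E₂ => (b z, (q z.1).2)) O₁ := hb.prodMk hq₂.contMDiff.contMDiffOn
  have hO : IsOpen O := ((hbu.continuousOn.isOpen_inter_preimage hO₁ hU).inter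
    (hb.continuousOn.isOpen_inter_preimage hO₁ (hUσ.inter hT.isOpen))).inter
      (hT.isOpen_domain.preimage continuous_snd)
  have hb₀ : b (w₀, 0) = x₀ := by simp [b, w₀, hφx]
  have hO₁₀ : (w₀, 0) ∈ O₁ := by simpa [O₁, w₀] using hcφ
  have h0O : (w₀, 0) ∈ O := by
    refine ⟨⟨⟨hO₁₀, ?_⟩, hO₁₀, ?_⟩, hT.zero_mem⟩
    · rw [mem_preimage, hb₀]
      simpa [w₀] using h0U
    · rw [mem_preimage, hb₀]
      exact ⟨hxσ, hx₀⟩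
  let κ : E₁ × E₂ → K := fun z => σ (b z) * (e (b z, (q z.1).2) * α z.2)
  have hκ : ContMDiffOn 𝓘(ℝ, E₁ × E₂) 𝓘(ℝ, E) ∞ κ O :=
    (hσ.comp (hb.mono fun z hz => hz.1.1.1) fun z hz => hz.1.2.2.1).mul
      ((he.comp (hbu.mono fun z hz => hz.1.1.1) fun z hz => hz.1.1.2).mul
        (hT.contMDiffOn.comp (contDiff_snd.contMDiff.contMDiffOn) fun p hp => hp.2))
  have hΨ : ContMDiffOn 𝓘(ℝ, E₁ × E₂) (𝓘(ℝ, EB).prod 𝓘(ℝ, E)) ∞ (fun z => (b z, κ z)) O :=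
    (hb.mono fun z hz => hz.1.1.1).prodMk hκ
  obtain ⟨R, hR⟩ : ∃ R : E₁ × E₂ →L[ℝ] EB, ∀ z, R z = (q z.1).1 :=
    ⟨(ContinuousLinearMap.fst ℝ EB (EuclideanSpace ℝ (Fin r))).comp
      ((q : E₁ →L[ℝ] EB × EuclideanSpace ℝ (Fin r)).comp (ContinuousLinearMap.fst ℝ E₁ E₂)),
      fun z => rfl⟩
  have hRb : HasMFDerivAt 𝓘(ℝ, E₁ × E₂) 𝓘(ℝ, EB) b (w₀, 0) R := by
    have hid : (mfderiv 𝓘(ℝ, EB) 𝓘(ℝ, EB) φ.symm (φ x₀) : EB →L[ℝ] EB) =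
        ContinuousLinearMap.id ℝ EB :=
      ContinuousLinearMap.ext fun v => mfderiv_chartAt_symm_self (E := EB) x₀ v
    have e1 := ((hφs.contMDiffAt (φ.open_target.mem_nhds hcφ)).mdifferentiableAt
      (by simp)).hasMFDerivAt
    have e2 : R (w₀, 0) = φ x₀ := by simp [hR, w₀]
    rw [hid, ← e2] at e1
    have e3 : HasMFDerivAt 𝓘(ℝ, E₁ × E₂) 𝓘(ℝ, EB) R (w₀, 0) R :=
      hasMFDerivAt_iff_hasFDerivAt.2 R.hasFDerivAt
    have e4 := HasMFDerivAt.comp (w₀, (0 : E₂)) e1 e3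
    exact e4.congr_of_eventuallyEq (.of_forall fun z => congrArg φ.symm (hR z).symm)
  let Q : E₁ × E₂ →L[ℝ] E := mfderiv 𝓘(ℝ, E₁ × E₂) 𝓘(ℝ, E) κ (w₀, 0)
  have hQ : HasMFDerivAt 𝓘(ℝ, E₁ × E₂) 𝓘(ℝ, E) κ (w₀, 0) Q :=
    ((hκ.contMDiffAt (hO.mem_nhds h0O)).mdifferentiableAt (by simp)).hasMFDerivAt
  -- The map `j` includes the vertical directions, in which the base point stays `x₀`. Along them
  -- `κ` is the product in the single group `K`, whose differential `P` is known to be injective.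
  obtain ⟨j, hj⟩ : ∃ j : EuclideanSpace ℝ (Fin r) × E₂ →L[ℝ] E₁ × E₂,
      ∀ p, j p = (q.symm (0, p.1), p.2) :=
    ⟨((q.symm : EB × EuclideanSpace ℝ (Fin r) →L[ℝ] E₁).comp
      (ContinuousLinearMap.inr ℝ EB _)).prodMap (ContinuousLinearMap.id ℝ E₂), fun p => rfl⟩
  have hQj : ∀ p, Q (j p) = P p := by
    have e1 : HasMFDerivAt 𝓘(ℝ, EuclideanSpace ℝ (Fin r) × E₂) 𝓘(ℝ, E₁ × E₂)
        (fun p => (w₀, (0 : E₂)) + j p) 0 j :=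
      hasMFDerivAt_iff_hasFDerivAt.2 (j.hasFDerivAt.const_add _)
    have e2 : (w₀, (0 : E₂)) + j 0 = (w₀, 0) := by simp
    rw [← e2] at hQ
    have e3 := HasMFDerivAt.comp (0 : EuclideanSpace ℝ (Fin r) × E₂) hQ e1
    have e4 : (κ ∘ fun p => (w₀, (0 : E₂)) + j p) =
        fun p : EuclideanSpace ℝ (Fin r) × E₂ => k * (e (x₀, p.1) * α p.2) := by
      funext p
      simp [κ, b, hj, w₀, hφx, hσx]
    rw [e4] at e3
    exact fun p => congrArg (fun A : EuclideanSpace ℝ (Fin r) × E₂ →L[ℝ] E => A p)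
      (hasMFDerivAt_unique e3 hP)
  -- The differential is triangular: a kernel vector has zero base component, hence is vertical, and
  -- there `Q` is `P`. Thus the derivatives of `σ` and `e` along the base never have to be computed.
  have hinj : Function.Injective (R.prod Q) := by
    rw [injective_iff_map_eq_zero]
    rintro ⟨w, y⟩ h
    obtain ⟨h1, h2⟩ := Prod.mk_eq_zero.1 h
    have h1' : (q w).1 = 0 := (hR (w, y)).symm.trans h1
    have hw : j ((q w).2, y) = (w, y) := by
      have : ((0 : EB), (q w).2) = q w := by rw [← h1']
      simp [hj, this]
    have h2' : Q (w, y) = 0 := h2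
    rw [← hw, hQj] at h2'
    have h3 := (injective_iff_map_eq_zero P).1 hPi _ h2'
    rw [← hw, h3, map_zero]
  obtain ⟨Θ, h0Θ, hΘO, hΘ, hΘs, hΘs'⟩ := hΨ.exists_openPartialHomeomorph_of_injective hO h0O
    (hRb.prodMk hQ) hinj (by
      have := q.toLinearEquiv.finrank_eq
      simp only [finrank_prod, finrank_euclideanSpace_fin] at this ⊢
      omega)
  refine ⟨Θ, ?_, hΘs, hΘs', fun z hz => ?_⟩
  · have := Θ.map_source h0Θ
    rw [← hΘ h0Θ] at this
    simpa [κ, hb₀, w₀, hσx, he1, hT.map_zero] using this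
  · rw [← hΘ hz]
    have hzO := hΘO hz
    -- The factors `σ (b z)` and `e (b z, _)` lie in `G (b z)`; what remains is `α z.2 ∈ G (b z)`,
    -- where triviality of the intersection is needed over all nearby base points.
    rw [mem_familyUnion, (G (b z)).mul_mem_cancel_left (hσG _ hzO.1.2.2.1),
      (G (b z)).mul_mem_cancel_left (heG _ hzO.1.1.2)]
    refine ⟨hT.eq_zero (b z) hzO.1.2.2.2 _ hzO.2, fun h => ?_⟩
    rw [h, hT.map_zero]
    exact (G (b z)).one_mem

end FamilySlices

/-! ### Maps into submanifolds -/

section Embedding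

variable {E H M E' H' N E'' H'' P : Type*}
  [NormedAddCommGroup E] [NormedSpace ℝ E] [TopologicalSpace H] {I : ModelWithCorners ℝ E H}
  [TopologicalSpace M] [ChartedSpace H M]
  [NormedAddCommGroup E'] [NormedSpace ℝ E'] [TopologicalSpace H'] {J : ModelWithCorners ℝ E' H'}
  [TopologicalSpace N] [ChartedSpace H' N]
  [NormedAddCommGroup E''] [NormedSpace ℝ E''] [TopologicalSpace H'']
  {J' : ModelWithCorners ℝ E'' H''} [TopologicalSpace P] [ChartedSpace H'' P]

/-- For an immersion, smoothness of `φ ∘ f` gives that of `f` once `f` is continuous; the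
topological embedding supplies the continuity. -/
theorem Manifold.IsSmoothEmbedding.contMDiffAt_of_comp {φ : N → P} (hφ : IsSmoothEmbedding J J' ∞ φ)
    {f : M → N} {x : M} (hf : ContMDiffAt I J' ∞ (φ ∘ f) x) : ContMDiffAt I J ∞ f x :=
  (ContMDiffAt.iff_comp_isImmersionAt (hφ.isImmersion.isImmersionAt (f x))).2
    ⟨hφ.isEmbedding.isInducing.continuousAt_iff.2 hf.continuousAt, hf⟩

theorem Manifold.IsSmoothEmbedding.contMDiff_of_comp {φ : N → P} (hφ : IsSmoothEmbedding J J' ∞ φ)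
    {f : M → N} (hf : ContMDiff I J' ∞ (φ ∘ f)) : ContMDiff I J ∞ f :=
  fun x => hφ.contMDiffAt_of_comp (hf x)

theorem Manifold.IsSmoothEmbedding.contMDiffOn_of_comp {φ : N → P}
    (hφ : IsSmoothEmbedding J J' ∞ φ) {f : M → N} {U : Set M} (hU : IsOpen U)
    (hf : ContMDiffOn I J' ∞ (φ ∘ f) U) : ContMDiffOn I J ∞ f U :=
  fun _ hx => (hφ.contMDiffAt_of_comp (hf.contMDiffAt (hU.mem_nhds hx))).contMDiffWithinAt

/-- An immersion has a left inverse valid near `x` in `N`. For an embedding this neighborhood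
contains the trace of an open set of `P`, so the identity holds at all points of `N` mapped into
`V`. -/
theorem Manifold.IsSmoothEmbedding.exists_leftInverse [FiniteDimensional ℝ E'] [J.Boundaryless]
    [IsManifold J ∞ N] [FiniteDimensional ℝ E''] [J'.Boundaryless] [IsManifold J' ∞ P]
    {φ : N → P} (hφ : IsSmoothEmbedding J J' ∞ φ) (x : N) :
    ∃ (V : Set P) (ρ : P → N), IsOpen V ∧ φ x ∈ V ∧ ContMDiffOn J' J ∞ ρ V ∧
      ∀ y, φ y ∈ V → ρ (φ y) = y := by
  obtain ⟨V, ρ, hV, hxV, hρ, h⟩ := (hφ.isImmersion.isImmersionAt x).exists_leftInverse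
  rw [hφ.isEmbedding.isInducing.nhds_eq_comap x] at h
  obtain ⟨W, hW, hxW, hWρ⟩ : ∃ W : Set P, IsOpen W ∧ φ x ∈ W ∧ ∀ y, φ y ∈ W → ρ (φ y) = y := by
    obtain ⟨W, hW, hWρ⟩ := Filter.mem_comap.1 h
    obtain ⟨W', hW', hW'o, hxW'⟩ := mem_nhds_iff.1 hW
    exact ⟨W', hW'o, hxW', fun y hy => hWρ (show y ∈ φ ⁻¹' W from hW' hy)⟩
  exact ⟨V ∩ W, ρ, hV.inter hW, ⟨hxV, hxW⟩, hρ.mono inter_subset_left, fun y hy => hWρ y hy.2⟩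

end Embedding

/-! ### The groupoid structure on the union. -/

section Bundle

set_option linter.unusedSectionVars false

open Module

variable {EB B : Type*} [NormedAddCommGroup EB] [NormedSpace ℝ EB] [FiniteDimensional ℝ EB]
  [TopologicalSpace B] [ChartedSpace EB B] [IsManifold 𝓘(ℝ, EB) ∞ B]
  {E K : Type*} [NormedAddCommGroup E] [NormedSpace ℝ E] [FiniteDimensional ℝ E]
  [TopologicalSpace K] [ChartedSpace E K] [Group K] [LieGroup 𝓘(ℝ, E) ∞ K]
  {r : ℕ} {g : B → Submodule ℝ (GroupLieAlgebra 𝓘(ℝ, E) K)} {G : B → Subgroup K}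
  {n : ℕ} [ChartedSpace (EuclideanSpace ℝ (Fin n)) (familyUnion G)]
  [IsManifold (𝓡 n) ∞ (familyUnion G)]

omit [TopologicalSpace B] [TopologicalSpace K] [FiniteDimensional ℝ EB] [ChartedSpace EB B]
  [IsManifold 𝓘(ℝ, EB) ∞ B] [FiniteDimensional ℝ E] [ChartedSpace E K] [LieGroup 𝓘(ℝ, E) ∞ K]
  [ChartedSpace (EuclideanSpace ℝ (Fin n)) (familyUnion G)] [IsManifold (𝓡 n) ∞ (familyUnion G)] in
theorem familyUnion.snd_mem (p : familyUnion G) : p.1.2 ∈ G p.1.1 := mem_familyUnion.1 p.2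

/-- The point `(x, k)` of the union of the subgroups `G x`. -/
def familyUnion.mk (x : B) (k : K) (hk : k ∈ G x) : familyUnion G := ⟨(x, k), mem_familyUnion.2 hk⟩

variable (hval : IsSmoothEmbedding (𝓡 n) (𝓘(ℝ, EB).prod 𝓘(ℝ, E)) ∞
  (Subtype.val : familyUnion G → B × K))

include hval

theorem familyUnion.contMDiff_fst :
    ContMDiff (𝓡 n) 𝓘(ℝ, EB) ∞ (fun p : familyUnion G => p.1.1) :=
  _root_.contMDiff_fst.comp hval.isImmersion.contMDiff

theorem familyUnion.contMDiff_snd :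
    ContMDiff (𝓡 n) 𝓘(ℝ, E) ∞ (fun p : familyUnion G => p.1.2) :=
  _root_.contMDiff_snd.comp hval.isImmersion.contMDiff

/-- Off the neighborhood `U` the section takes the unit as a default, so that it is a right inverse
of the projection over all of `B`. -/
theorem familyUnion.exists_section (hg : IsSmoothSubbundle (F := E) 𝓘(ℝ, EB) r g)
    (hG : ∀ x, IsConnectedLieSubgroup (G x) (g x)) (p : familyUnion G) :
    ∃ (U : Set B) (s : B → familyUnion G), IsOpen U ∧ p.1.1 ∈ U ∧
      ContMDiffOn 𝓘(ℝ, EB) (𝓡 n) ∞ s U ∧ s p.1.1 = p ∧ ∀ x, (s x).1.1 = x := by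
  classical
  obtain ⟨U, σ, hU, hxU, hσ, hσG, hσx⟩ := exists_smooth_section hg hG (familyUnion.snd_mem p)
  let s : B → familyUnion G := fun x =>
    if hx : x ∈ U then familyUnion.mk x (σ x) (hσG x hx) else familyUnion.mk x 1 (G x).one_mem
  refine ⟨U, s, hU, hxU, hval.contMDiffOn_of_comp hU ?_, ?_, fun x => ?_⟩
  · exact (contMDiffOn_id.prodMk hσ).congr fun x hx => by simp [s, hx, familyUnion.mk]
  · simp only [s, hxU, dite_true]
    exact Subtype.ext (Prod.ext rfl hσx)
  · by_cases hx : x ∈ U <;> simp [s, hx, familyUnion.mk]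

/-- A local section through `p` provides a right inverse of the differential. -/
theorem familyUnion.mfderiv_fst_surjective (hg : IsSmoothSubbundle (F := E) 𝓘(ℝ, EB) r g)
    (hG : ∀ x, IsConnectedLieSubgroup (G x) (g x)) (p : familyUnion G) :
    Function.Surjective (mfderiv (𝓡 n) 𝓘(ℝ, EB) (fun p : familyUnion G => p.1.1) p) := by
  obtain ⟨U, s, hU, hxU, hs, hsx, hsU⟩ := familyUnion.exists_section hval hg hG p
  intro v
  have hs' : MDifferentiableAt 𝓘(ℝ, EB) (𝓡 n) s p.1.1 :=
    (hs.contMDiffAt (hU.mem_nhds hxU)).mdifferentiableAt (by simp)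
  have h := mfderiv_injective_of_leftInverse hs'
    ((familyUnion.contMDiff_fst hval).mdifferentiable (by simp) _) (.of_forall hsU) v
  refine ⟨(show EB →L[ℝ] EuclideanSpace ℝ (Fin n) from mfderiv 𝓘(ℝ, EB) (𝓡 n) s p.1.1) v, ?_⟩
  have e : (mfderiv (𝓡 n) 𝓘(ℝ, EB) (fun p : familyUnion G => p.1.1) (s p.1.1) :
      EuclideanSpace ℝ (Fin n) →L[ℝ] EB) =
      mfderiv (𝓡 n) 𝓘(ℝ, EB) (fun p : familyUnion G => p.1.1) p := by rw [hsx]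
  exact (congrArg (fun T : EuclideanSpace ℝ (Fin n) →L[ℝ] EB => T _) e).symm.trans h

theorem familyUnion.isSubmersion_fst (hg : IsSmoothSubbundle (F := E) 𝓘(ℝ, EB) r g)
    (hG : ∀ x, IsConnectedLieSubgroup (G x) (g x)) (hn : finrank ℝ EB + r = n) :
    IsSubmersion (𝓡 n) 𝓘(ℝ, EB) ∞ (fun p : familyUnion G => p.1.1) := by
  refine IsSubmersionOfComplement.isSubmersion (F := EuclideanSpace ℝ (Fin r)) fun p => ?_
  exact (familyUnion.contMDiff_fst hval).contMDiffOn.isSubmersionAtOfComplement _ isOpen_univ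
    (mem_univ p) (familyUnion.mfderiv_fst_surjective hval hg hG p) (by simpa using hn)

/-- The union of a smooth family of connected Lie subgroups, as a bundle of Lie groups. -/
noncomputable def familyUnion.lieGroupBundle (hg : IsSmoothSubbundle (F := E) 𝓘(ℝ, EB) r g)
    (hG : ∀ x, IsConnectedLieSubgroup (G x) (g x)) (hn : finrank ℝ EB + r = n) :
    LieGroupBundle (B := B) (X := familyUnion G) 𝓘(ℝ, EB) (𝓡 n) where
  source p := p.1.1
  target p := p.1.1
  isSubmersion_source := familyUnion.isSubmersion_fst hval hg hG hn
  isSubmersion_target := familyUnion.isSubmersion_fst hval hg hG hn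
  comp p q hpq := familyUnion.mk p.1.1 (p.1.2 * q.1.2)
    ((G _).mul_mem (snd_mem p) (hpq ▸ snd_mem q))
  inv p := familyUnion.mk p.1.1 p.1.2⁻¹ ((G _).inv_mem (snd_mem p))
  unit x := familyUnion.mk x 1 (G x).one_mem
  source_comp p q hpq := hpq
  target_comp p q hpq := rfl
  comp_assoc p q k _ _ := Subtype.ext (Prod.ext rfl (mul_assoc _ _ _))
  source_unit x := rfl
  target_unit x := rfl
  unit_comp p := Subtype.ext (Prod.ext rfl (one_mul _))
  comp_unit p := Subtype.ext (Prod.ext rfl (mul_one _))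
  source_inv p := rfl
  target_inv p := rfl
  inv_comp p := Subtype.ext (Prod.ext rfl (inv_mul_cancel _))
  comp_inv p := Subtype.ext (Prod.ext rfl (mul_inv_cancel _))
  smooth_comp := by
    rintro ⟨⟨p, q⟩, hpq⟩
    obtain ⟨V, ρ, hV, hxV, hρ, h⟩ := hval.exists_leftInverse (familyUnion.mk p.1.1 (p.1.2 * q.1.2)
      ((G _).mul_mem (snd_mem p) (hpq ▸ snd_mem q)))
    -- This product makes sense for all pairs but lies over the union in general only for composable
    -- ones. The local retraction `ρ` brings it back into the union and restores the composition
    -- there.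
    let F : familyUnion G × familyUnion G → B × K := fun z => (z.1.1.1, z.1.1.2 * z.2.1.2)
    have hF : ContMDiff ((𝓡 n).prod (𝓡 n)) (𝓘(ℝ, EB).prod 𝓘(ℝ, E)) ∞ F :=
      ((contMDiff_fst hval).comp _root_.contMDiff_fst).prodMk
        (((contMDiff_snd hval).comp _root_.contMDiff_fst).mul
          ((contMDiff_snd hval).comp _root_.contMDiff_snd))
    refine ⟨F ⁻¹' V, ρ ∘ F, hV.preimage hF.continuous, hxV, hρ.comp hF.contMDiffOn fun z hz => hz, ?_⟩
    exact fun z hz => h (familyUnion.mk _ _ _) hz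
  contMDiff_inv := hval.contMDiff_of_comp ((contMDiff_fst hval).prodMk (contMDiff_snd hval).inv)
  contMDiff_unit := hval.contMDiff_of_comp (contMDiff_id.prodMk contMDiff_const)
  source_eq_target := rfl

end Bundle

/-! ### Smooth maps into a single tangent space. -/

section ConstBase

variable {EB HB B E K : Type*} [NormedAddCommGroup EB] [NormedSpace ℝ EB] [TopologicalSpace HB]
  {I : ModelWithCorners ℝ EB HB} [TopologicalSpace B] [ChartedSpace HB B]
  [NormedAddCommGroup E] [NormedSpace ℝ E]
  [TopologicalSpace K] [ChartedSpace E K] [IsManifold 𝓘(ℝ, E) 1 K]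

/-- A map into a single tangent space is smooth as a map into the tangent bundle if and only if it
is smooth as a map into a vector space. -/
theorem contMDiffOn_tangentBundle_mk_iff (c : K) {W : B → E} {U : Set B} :
    ContMDiffOn I 𝓘(ℝ, E).tangent ∞ (fun x => (⟨c, W x⟩ : TangentBundle 𝓘(ℝ, E) K)) U ↔
      ContMDiffOn I 𝓘(ℝ, E) ∞ W U := by
  -- The trivialization centered at `c` is the identity on the fiber over `c`.
  have key (w : E) : (trivializationAt E (TangentSpace 𝓘(ℝ, E)) c
      (⟨c, w⟩ : TangentBundle 𝓘(ℝ, E) K)).2 = w := by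
    rw [TangentBundle.trivializationAt_eq_localTriv]
    exact (tangentBundleCore 𝓘(ℝ, E) K).coordChange_self (achart E c) c (mem_chart_source E c) w
  refine forall₂_congr fun x hx => ?_
  rw [Bundle.contMDiffWithinAt_totalSpace]
  simp only [key]
  exact and_iff_right contMDiffWithinAt_const

end ConstBase

/-! ### The vertical tangent spaces at the units. -/

section Bundle

set_option linter.unusedSectionVars false

open Module

variable {EB B : Type*} [NormedAddCommGroup EB] [NormedSpace ℝ EB] [FiniteDimensional ℝ EB]
  [TopologicalSpace B] [ChartedSpace EB B] [IsManifold 𝓘(ℝ, EB) ∞ B]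
  {E K : Type*} [NormedAddCommGroup E] [NormedSpace ℝ E] [FiniteDimensional ℝ E]
  [TopologicalSpace K] [ChartedSpace E K] [Group K] [LieGroup 𝓘(ℝ, E) ∞ K]
  {r : ℕ} {g : B → Submodule ℝ (GroupLieAlgebra 𝓘(ℝ, E) K)} {G : B → Subgroup K}
  {n : ℕ} [ChartedSpace (EuclideanSpace ℝ (Fin n)) (familyUnion G)]
  [IsManifold (𝓡 n) ∞ (familyUnion G)]

omit [FiniteDimensional ℝ EB] [IsManifold 𝓘(ℝ, EB) ∞ B]
  [ChartedSpace (EuclideanSpace ℝ (Fin n)) (familyUnion G)] [IsManifold (𝓡 n) ∞ (familyUnion G)] in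
theorem exists_subgroup_param (hg : IsSmoothSubbundle (F := E) 𝓘(ℝ, EB) r g)
    (hG : ∀ x, IsConnectedLieSubgroup (G x) (g x)) (x : B) :
    ∃ (U : Set (EuclideanSpace ℝ (Fin r))) (ε : EuclideanSpace ℝ (Fin r) → G x)
      (S : EuclideanSpace ℝ (Fin r) →L[ℝ] E), IsOpen U ∧ 0 ∈ U ∧ ε 0 = 1 ∧
      ContMDiffOn 𝓘(ℝ, EuclideanSpace ℝ (Fin r)) 𝓘(ℝ, E) ∞ (fun u => (ε u : K)) U ∧
      HasMFDerivAt 𝓘(ℝ, EuclideanSpace ℝ (Fin r)) 𝓘(ℝ, E) (fun u => (ε u : K)) 0 S ∧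
      (S : EuclideanSpace ℝ (Fin r) →ₗ[ℝ] E).range = g x := by
  classical
  obtain ⟨U, e, S, hU, h0U, he, heG, he1, hS, hSi, hSr, -⟩ := exists_smooth_family_param hg hG x
  have hc : ContMDiff 𝓘(ℝ, EuclideanSpace ℝ (Fin r))
      (𝓘(ℝ, EB).prod 𝓘(ℝ, EuclideanSpace ℝ (Fin r))) ∞
      fun u : EuclideanSpace ℝ (Fin r) => (x, u) :=
    contMDiff_const.prodMk contMDiff_id
  let U' : Set (EuclideanSpace ℝ (Fin r)) := (fun u => (x, u)) ⁻¹' U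
  have hU' : IsOpen U' := hU.preimage hc.continuous
  let ε : EuclideanSpace ℝ (Fin r) → G x := fun u => if hu : (x, u) ∈ U then ⟨e (x, u), heG _ hu⟩
    else 1
  have hε : ∀ u ∈ U', (ε u : K) = e (x, u) := fun u hu => by
    simp only [ε, show (x, u) ∈ U from hu, dite_true]
  refine ⟨U', ε, S, hU', h0U, Subtype.ext ((hε 0 h0U).trans he1), ?_, ?_, hSr⟩
  · exact (he.comp hc.contMDiffOn fun u hu => hu).congr hε
  · exact hS.congr_of_eventuallyEq (Filter.eventually_of_mem (hU'.mem_nhds h0U) hε)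

variable (hval : IsSmoothEmbedding (𝓡 n) (𝓘(ℝ, EB).prod 𝓘(ℝ, E)) ∞
  (Subtype.val : familyUnion G → B × K))

include hval

theorem familyUnion.mfderiv_val_apply (p : familyUnion G) (v : EuclideanSpace ℝ (Fin n)) :
    mfderiv (𝓡 n) (𝓘(ℝ, EB).prod 𝓘(ℝ, E)) (Subtype.val : familyUnion G → B × K) p v =
      (mfderiv (𝓡 n) 𝓘(ℝ, EB) (fun p : familyUnion G => p.1.1) p v,
        mfderiv (𝓡 n) 𝓘(ℝ, E) (fun p : familyUnion G => p.1.2) p v) := by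
  have h1 := ((familyUnion.contMDiff_fst hval).mdifferentiable (by simp) p).hasMFDerivAt
  have h2 := ((familyUnion.contMDiff_snd hval).mdifferentiable (by simp) p).hasMFDerivAt
  exact congrArg (fun T : EuclideanSpace ℝ (Fin n) →L[ℝ] EB × E => T v) (h1.prodMk h2).mfderiv

/-- The inclusion into `B × K` is an immersion, and its differential has these two components. -/
theorem familyUnion.eq_zero_of_mfderiv_eq_zero (p : familyUnion G) (v : EuclideanSpace ℝ (Fin n))
    (h1 : (mfderiv (𝓡 n) 𝓘(ℝ, EB) (fun p : familyUnion G => p.1.1) p v : EB) = 0)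
    (h2 : (mfderiv (𝓡 n) 𝓘(ℝ, E) (fun p : familyUnion G => p.1.2) p v : E) = 0) : v = 0 := by
  have hinj := (hval.isImmersion.isImmersionAt p).mfderiv_injective
  let T : EuclideanSpace ℝ (Fin n) →L[ℝ] EB × E :=
    mfderiv (𝓡 n) (𝓘(ℝ, EB).prod 𝓘(ℝ, E)) (Subtype.val : familyUnion G → B × K) p
  have h : T v = T 0 := by
    rw [map_zero]
    exact (familyUnion.mfderiv_val_apply hval p v).trans (Prod.ext h1 h2)
  exact hinj h

/-- The differential of the projection to `K` maps the kernel of the differential of the projection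
to `B` onto `g x`. -/
theorem familyUnion.map_ker_mfderiv (hg : IsSmoothSubbundle (F := E) 𝓘(ℝ, EB) r g)
    (hG : ∀ x, IsConnectedLieSubgroup (G x) (g x)) (hn : finrank ℝ EB + r = n) (x : B)
    (p : familyUnion G) (hp : p = familyUnion.mk x 1 (G x).one_mem)
    (R : EuclideanSpace ℝ (Fin n) →L[ℝ] EB) (D : EuclideanSpace ℝ (Fin n) →L[ℝ] E)
    (hR : R = mfderiv (𝓡 n) 𝓘(ℝ, EB) (fun p : familyUnion G => p.1.1) p)
    (hD : D = mfderiv (𝓡 n) 𝓘(ℝ, E) (fun p : familyUnion G => p.1.2) p) :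
    (R : EuclideanSpace ℝ (Fin n) →ₗ[ℝ] EB).ker.map (D : EuclideanSpace ℝ (Fin n) →ₗ[ℝ] E) =
      g x := by
  have hinj : ∀ v, R v = 0 → D v = 0 → v = 0 := fun v h1 h2 =>
    familyUnion.eq_zero_of_mfderiv_eq_zero hval p v (by rw [← hR]; exact h1) (by rw [← hD]; exact h2)
  have hRs : Function.Surjective R := by
    rw [hR]
    exact familyUnion.mfderiv_fst_surjective hval hg hG p
  have hRd : HasMFDerivAt (𝓡 n) 𝓘(ℝ, EB) (fun p : familyUnion G => p.1.1) p R := by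
    rw [hR]
    exact ((familyUnion.contMDiff_fst hval).mdifferentiable (by simp) p).hasMFDerivAt
  have hDd : HasMFDerivAt (𝓡 n) 𝓘(ℝ, E) (fun p : familyUnion G => p.1.2) p D := by
    rw [hD]
    exact ((familyUnion.contMDiff_snd hval).mdifferentiable (by simp) p).hasMFDerivAt
  have hker : finrank ℝ (R : EuclideanSpace ℝ (Fin n) →ₗ[ℝ] EB).ker = r := by
    have := (R : EuclideanSpace ℝ (Fin n) →ₗ[ℝ] EB).finrank_range_add_finrank_ker
    rw [LinearMap.range_eq_top.2 hRs, finrank_top, finrank_euclideanSpace_fin] at this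
    omega
  have hmap : finrank ℝ ((R : EuclideanSpace ℝ (Fin n) →ₗ[ℝ] EB).ker.map
      (D : EuclideanSpace ℝ (Fin n) →ₗ[ℝ] E)) = r := by
    rw [← LinearMap.range_domRestrict, LinearMap.finrank_range_of_inj, hker]
    refine (injective_iff_map_eq_zero _).2 fun v hv => Subtype.ext (hinj v v.2 hv)
  obtain ⟨h, hh⟩ : ∃ h : Submodule ℝ E, h = g x := ⟨_, rfl⟩
  have hgr : finrank ℝ h = r := by
    rw [hh]
    exact hg.finrank_eq x
  rw [← hh]
  -- Both spaces have dimension `r`, so one inclusion suffices. The vectors of `g x` are obtained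
  -- from the parametrization `τ`, which stays in the fiber over `x` and hence has vertical
  -- derivative.
  refine (Submodule.eq_of_le_of_finrank_eq ?_ (hgr.trans hmap.symm)).symm
  obtain ⟨U, ε, S, hU, h0U, hε0, hε, hS, hSr⟩ := exists_subgroup_param hg hG x
  let τ : EuclideanSpace ℝ (Fin r) → familyUnion G := fun u => familyUnion.mk x (ε u) (ε u).2
  have hτ : ContMDiffOn 𝓘(ℝ, EuclideanSpace ℝ (Fin r)) (𝓡 n) ∞ τ U :=
    hval.contMDiffOn_of_comp hU (contMDiffOn_const.prodMk hε)
  have hτ0 : τ 0 = p := by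
    rw [hp]
    exact Subtype.ext (Prod.ext rfl (congrArg Subtype.val hε0))
  have hτd := ((hτ.contMDiffAt (hU.mem_nhds h0U)).mdifferentiableAt (by simp)).hasMFDerivAt
  rw [← hτ0] at hRd hDd
  have e1 := HasMFDerivAt.comp (0 : EuclideanSpace ℝ (Fin r)) hRd hτd
  have e2 := HasMFDerivAt.comp (0 : EuclideanSpace ℝ (Fin r)) hDd hτd
  have e3 := hasMFDerivAt_const (I := 𝓘(ℝ, EuclideanSpace ℝ (Fin r))) (I' := 𝓘(ℝ, EB)) x
    (0 : EuclideanSpace ℝ (Fin r))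
  intro w hw
  have hw' : w ∈ (S : EuclideanSpace ℝ (Fin r) →ₗ[ℝ] E).range := by
    rw [hSr, ← hh]
    exact hw
  obtain ⟨u, rfl⟩ := hw'
  exact ⟨(show EuclideanSpace ℝ (Fin r) →L[ℝ] EuclideanSpace ℝ (Fin n) from
    mfderiv 𝓘(ℝ, EuclideanSpace ℝ (Fin r)) (𝓡 n) τ 0) u,
    congrArg (fun T : EuclideanSpace ℝ (Fin r) →L[ℝ] EB => T u) (hasMFDerivAt_unique e1 e3),
    congrArg (fun T : EuclideanSpace ℝ (Fin r) →L[ℝ] E => T u) (hasMFDerivAt_unique e2 hS)⟩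

end Bundle

/-! ### Identification of the bundle of Lie algebras, and the Lie groups in the fibers. -/

section Bundle

set_option linter.unusedSectionVars false

open Module

variable {EB B : Type*} [NormedAddCommGroup EB] [NormedSpace ℝ EB] [FiniteDimensional ℝ EB]
  [TopologicalSpace B] [ChartedSpace EB B] [IsManifold 𝓘(ℝ, EB) ∞ B]
  {E K : Type*} [NormedAddCommGroup E] [NormedSpace ℝ E] [FiniteDimensional ℝ E]
  [TopologicalSpace K] [ChartedSpace E K] [Group K] [LieGroup 𝓘(ℝ, E) ∞ K]
  {r : ℕ} {g : B → Submodule ℝ (GroupLieAlgebra 𝓘(ℝ, E) K)} {G : B → Subgroup K}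
  {n : ℕ} [ChartedSpace (EuclideanSpace ℝ (Fin n)) (familyUnion G)]
  [IsManifold (𝓡 n) ∞ (familyUnion G)]

theorem familyUnion.identifiesLie (hval : IsSmoothEmbedding (𝓡 n) (𝓘(ℝ, EB).prod 𝓘(ℝ, E)) ∞
      (Subtype.val : familyUnion G → B × K))
    (hg : IsSmoothSubbundle (F := E) 𝓘(ℝ, EB) r g)
    (hG : ∀ x, IsConnectedLieSubgroup (G x) (g x)) (hn : finrank ℝ EB + r = n) :
    (familyUnion.lieGroupBundle hval hg hG hn).IdentifiesLie (F := E)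
      (fun x => mfderiv (𝓡 n) 𝓘(ℝ, E) (fun p : familyUnion G => p.1.2)
        ((familyUnion.lieGroupBundle hval hg hG hn).unit x)) g where
  bijOn x := by
    let p : familyUnion G := familyUnion.mk x 1 (G x).one_mem
    let R : EuclideanSpace ℝ (Fin n) →L[ℝ] EB :=
      mfderiv (𝓡 n) 𝓘(ℝ, EB) (fun p : familyUnion G => p.1.1) p
    let D : EuclideanSpace ℝ (Fin n) →L[ℝ] E :=
      mfderiv (𝓡 n) 𝓘(ℝ, E) (fun p : familyUnion G => p.1.2) p
    have hmap := SetLike.ext_iff.1 (familyUnion.map_ker_mfderiv hval hg hG hn x p rfl R D rfl rfl)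
    refine ⟨fun v hv => (hmap (D v)).1 ⟨v, hv, rfl⟩, fun v hv w hw h => ?_, fun w hw => ?_⟩
    · have hv' : R v = 0 := hv
      have hw' : R w = 0 := hw
      have h' : D v = D w := h
      have h1 : R (v - w) = 0 := (R.map_sub v w).trans (by rw [hv', hw', sub_zero])
      have h2 : D (v - w) = 0 := (D.map_sub v w).trans (by rw [h', sub_self])
      exact sub_eq_zero.1 (familyUnion.eq_zero_of_mfderiv_eq_zero hval p _ h1 h2)
    · obtain ⟨v, hv, hvw⟩ := (hmap w).2 hw
      exact ⟨v, hv, hvw⟩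
  smooth_iff σ hσ U hU := by
    have : IsManifold 𝓘(ℝ, EB) 1 B := IsManifold.of_le (n := ∞) (by simp)
    have : IsManifold 𝓘(ℝ, E) 1 K := IsManifold.of_le (n := ∞) (by simp)
    have : IsManifold (𝓡 n) 1 (familyUnion G) := IsManifold.of_le (n := ∞) (by simp)
    rw [← contMDiffOn_tangentBundle_mk_iff (1 : K)]
    constructor
    -- The projection to `K` sends every unit to `1`, so its tangent map lands in the single tangent
    -- space at `1`.
    · exact fun h => ((familyUnion.contMDiff_snd hval).contMDiff_tangentMap (m := ∞)
        (by simp)).comp_contMDiffOn h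
    · intro h x₀ hx₀
      obtain ⟨V, ρ, hV, hxV, hρ, hρV⟩ :=
        hval.exists_leftInverse (familyUnion.mk x₀ 1 (G x₀).one_mem)
      -- A vertical vector `σ x` becomes `(0, D (σ x))` in the tangent space of `B × K` at `(x, 1)`.
      -- This section is smooth, and the differential of the local left inverse `ρ` carries it back
      -- to `σ`.
      have hZ : ContMDiffOn 𝓘(ℝ, EB) (𝓘(ℝ, EB).prod 𝓘(ℝ, E)).tangent ∞ (fun x =>
          (⟨(x, 1), (0, mfderiv (𝓡 n) 𝓘(ℝ, E) (fun p : familyUnion G => p.1.2)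
            (familyUnion.mk x 1 (G x).one_mem) (σ x))⟩ :
            TangentBundle (𝓘(ℝ, EB).prod 𝓘(ℝ, E)) (B × K))) U :=
        contMDiff_equivTangentBundleProd_symm.comp_contMDiffOn
          ((Bundle.contMDiff_zeroSection ℝ (TangentSpace 𝓘(ℝ, EB) : B → Type _)).contMDiffOn.prodMk h)
      have hc : Continuous fun x : B => (x, (1 : K)) := by fun_prop
      have hU' : IsOpen (U ∩ (fun x => (x, (1 : K))) ⁻¹' V) := hU.inter (hV.preimage hc)
      have hmain := (hρ.contMDiffOn_tangentMapWithin (m := ∞) (by simp) hV.uniqueMDiffOn).comp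
        (hZ.mono (inter_subset_left : U ∩ (fun x => (x, (1 : K))) ⁻¹' V ⊆ U)) fun x hx => hx.2
      refine ((hmain.congr fun x hx => ?_).contMDiffAt
        (hU'.mem_nhds ⟨hx₀, hxV⟩)).contMDiffWithinAt
      let p : familyUnion G := familyUnion.mk x 1 (G x).one_mem
      have hd := familyUnion.mfderiv_val_apply hval p (σ x)
      have h0 : (mfderiv (𝓡 n) 𝓘(ℝ, EB) (fun p : familyUnion G => p.1.1) p (σ x) : EB) = 0 := hσ x
      have hpV : ((p : familyUnion G) : B × K) ∈ V := hx.2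
      have hρd : MDifferentiableAt (𝓘(ℝ, EB).prod 𝓘(ℝ, E)) (𝓡 n) ρ p.1 :=
        (hρ.contMDiffAt (hV.mem_nhds hpV)).mdifferentiableAt (by simp)
      have hl := mfderiv_injective_of_leftInverse (I := 𝓡 n)
        (hval.isImmersion.contMDiff.mdifferentiable (by simp) p) hρd
        (Filter.eventually_of_mem ((hV.preimage continuous_subtype_val).mem_nhds hpV)
          fun y hy => hρV y hy) (σ x)
      rw [Function.comp_apply, tangentMapWithin_eq_tangentMap (hV.uniqueMDiffOn _ hpV) hρd]
      refine Bundle.TotalSpace.ext (hρV p hpV).symm ?_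
      exact heq_of_eq (hl.symm.trans (congrArg (fun w : EB × E =>
        (show EB × E →L[ℝ] EuclideanSpace ℝ (Fin n) from
          mfderiv (𝓘(ℝ, EB).prod 𝓘(ℝ, E)) (𝓡 n) ρ p.1) w) (hd.trans (Prod.ext h0 rfl))))

/-- The fiber of the union is a Lie group, embedded in the union, with the expected Lie algebra. -/
theorem familyUnion.exists_lieGroup_fiber {g : B → LieSubalgebra ℝ (GroupLieAlgebra 𝓘(ℝ, E) K)}
    (hval : IsSmoothEmbedding (𝓡 n) (𝓘(ℝ, EB).prod 𝓘(ℝ, E)) ∞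
      (Subtype.val : familyUnion G → B × K))
    (hg : IsSmoothSubbundle (F := E) 𝓘(ℝ, EB) r (fun x => (g x).toSubmodule))
    (hG : ∀ x, IsConnectedLieSubgroup (G x) (g x).toSubmodule) (hn : finrank ℝ EB + r = n) (x : B)
    {E₂ : Type*} [NormedAddCommGroup E₂] [NormedSpace ℝ E₂] [FiniteDimensional ℝ E₂]
    {V : Set B} {D : Set E₂} {α : E₂ → K} {T : E₂ →L[ℝ] E}
    (hT : IsTransversal (E := E) (g x).toSubmodule G V D α T) (hx : x ∈ V)
    (hd : r + finrank ℝ E₂ = finrank ℝ E) :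
    ∃ (_ : ChartedSpace (EuclideanSpace ℝ (Fin r)) (G x)) (_ : LieGroup (𝓡 r) ∞ (G x)),
      IsSmoothEmbedding (𝓡 r) (𝓡 n) ∞ (fiberInclusion G x) ∧
      ∃ φ : GroupLieAlgebra (𝓡 r) (G x) →ₗ⁅ℝ⁆ GroupLieAlgebra 𝓘(ℝ, E) K,
        (∀ v, φ v = mfderiv (𝓡 r) 𝓘(ℝ, E) (Subtype.val : G x → K) 1 v) ∧ φ.range = g x := by
  obtain ⟨_, _, hi⟩ : ∃ (_ : ChartedSpace (EuclideanSpace ℝ (Fin r)) (G x))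
      (_ : IsManifold (𝓡 r) ∞ (G x)),
      IsSmoothEmbedding (𝓡 r) 𝓘(ℝ, E) ∞ (Subtype.val : G x → K) :=
    exists_isSmoothEmbedding_of_isSlice (EuclideanSpace ℝ (Fin r)) E₂
      (fun k hk => exists_isSlice_subgroup hg hG hT hx hd hk) (fun _ => by simpa using hd)
  have hs : ContMDiff (𝓡 r) 𝓘(ℝ, E) ∞ (Subtype.val : G x → K) := hi.isImmersion.contMDiff
  have : ContMDiffMul (𝓡 r) ∞ (G x) :=
    ⟨hi.contMDiff_of_comp ((hs.comp _root_.contMDiff_fst).mul (hs.comp _root_.contMDiff_snd))⟩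
  have : LieGroup (𝓡 r) ∞ (G x) := ⟨hi.contMDiff_of_comp hs.inv⟩
  have hsd : MDifferentiable (𝓡 r) 𝓘(ℝ, E) (Subtype.val : G x → K) := hs.mdifferentiable (by simp)
  have hfs : ContMDiff (𝓡 r) (𝓡 n) ∞ (fiberInclusion G x) :=
    hval.contMDiff_of_comp (contMDiff_const.prodMk hs)
  have hinj : ∀ k : G x, Function.Injective (mfderiv (𝓡 r) 𝓘(ℝ, E) (Subtype.val : G x → K) k) :=
    fun k => (hi.isImmersion.isImmersionAt k).mfderiv_injective
  refine ⟨inferInstance, inferInstance, ⟨?_, ?_⟩, ?_⟩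
  · refine IsImmersionOfComplement.isImmersion (F := EB) fun k => ?_
    refine hfs.contMDiffOn.isImmersionAtOfComplement EB isOpen_univ (mem_univ k) ?_
      (by simp; omega)
    -- Followed by the projection to `K`, the fiber inclusion is the inclusion of `G x` in `K`,
    -- whose differential is injective; the topological embedding property follows in the same way.
    have h1 := HasMFDerivAt.comp k ((familyUnion.contMDiff_snd hval).mdifferentiable (by simp)
      (fiberInclusion G x k)).hasMFDerivAt (hfs.mdifferentiable (by simp) k).hasMFDerivAt
    have h2 := hasMFDerivAt_unique h1 (hsd k).hasMFDerivAt
    refine Function.Injective.of_comp (f := (show EuclideanSpace ℝ (Fin n) →L[ℝ] E from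
      mfderiv (𝓡 n) 𝓘(ℝ, E) (fun p : familyUnion G => p.1.2) (fiberInclusion G x k))) ?_
    intro v w hvw
    refine hinj k ?_
    rw [← h2]
    exact hvw
  · refine Topology.IsEmbedding.of_comp hfs.continuous
      (continuous_snd.comp continuous_subtype_val) ?_
    exact hi.isEmbedding
  · let A : EuclideanSpace ℝ (Fin r) →L[ℝ] E := mfderiv (𝓡 r) 𝓘(ℝ, E) (Subtype.val : G x → K) 1
    have hA : (A : EuclideanSpace ℝ (Fin r) →ₗ[ℝ] E).range = (g x).toSubmodule := by
      obtain ⟨h, hh⟩ : ∃ h : Submodule ℝ E, h = (g x).toSubmodule := ⟨_, rfl⟩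
      have hgr : finrank ℝ h = r := by
        rw [hh]
        exact hg.finrank_eq x
      rw [← hh]
      -- Again equality follows from one inclusion and equal dimension `r`; the inclusion uses the
      -- local parametrization of `G x` by exponentials.
      refine (Submodule.eq_of_le_of_finrank_eq ?_ (hgr.trans ?_)).symm
      · obtain ⟨U, ε, S, hU, h0U, hε0, hε, hS, hSr⟩ := exists_subgroup_param hg hG x
        have hε' := hi.contMDiffOn_of_comp hU hε
        have e0 := (hsd 1).hasMFDerivAt
        rw [← hε0] at e0
        have e1 := HasMFDerivAt.comp (0 : EuclideanSpace ℝ (Fin r)) e0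
          ((hε'.contMDiffAt (hU.mem_nhds h0U)).mdifferentiableAt (by simp)).hasMFDerivAt
        have e2 := hasMFDerivAt_unique e1 hS
        intro w hw
        have hw' : w ∈ (S : EuclideanSpace ℝ (Fin r) →ₗ[ℝ] E).range := by
          rw [hSr, ← hh]
          exact hw
        obtain ⟨u, rfl⟩ := hw'
        have e3 : (mfderiv (𝓡 r) 𝓘(ℝ, E) (Subtype.val : G x → K) (ε 0) :
            EuclideanSpace ℝ (Fin r) →L[ℝ] E) = A := by rw [hε0]
        refine ⟨(show EuclideanSpace ℝ (Fin r) →L[ℝ] EuclideanSpace ℝ (Fin r) from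
          mfderiv 𝓘(ℝ, EuclideanSpace ℝ (Fin r)) (𝓡 r) ε 0) u, ?_⟩
        exact (congrArg (fun R : EuclideanSpace ℝ (Fin r) →L[ℝ] E => R _) e3).symm.trans
          (congrArg (fun R : EuclideanSpace ℝ (Fin r) →L[ℝ] E => R u) e2)
      · have hAi : Function.Injective A := hinj 1
        rw [LinearMap.finrank_range_of_inj hAi, finrank_euclideanSpace_fin]
    let φ : GroupLieAlgebra (𝓡 r) (G x) →ₗ⁅ℝ⁆ GroupLieAlgebra 𝓘(ℝ, E) K :=
      { toLinearMap := (mfderiv (𝓡 r) 𝓘(ℝ, E) (Subtype.val : G x → K) 1).toLinearMap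
        map_lie' := fun {v w} => mfderiv_one_bracket (G x).subtype hs v w _ _ rfl rfl }
    refine ⟨φ, fun v => rfl, ?_⟩
    refine SetLike.ext fun w => ?_
    exact SetLike.ext_iff.1 hA w

end Bundle

/-! ### Assembly of the theorem. -/

theorem mainTheorem6 {EB B : Type*} [NormedAddCommGroup EB] [NormedSpace ℝ EB]
    [FiniteDimensional ℝ EB] [TopologicalSpace B] [ChartedSpace EB B] [IsManifold 𝓘(ℝ, EB) ∞ B]
    {E K : Type*} [NormedAddCommGroup E] [NormedSpace ℝ E] [FiniteDimensional ℝ E]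
    [TopologicalSpace K] [ChartedSpace E K] [Group K] [LieGroup 𝓘(ℝ, E) ∞ K]
    (r : ℕ) (g : B → LieSubalgebra ℝ (GroupLieAlgebra 𝓘(ℝ, E) K))
    (hg : IsSmoothSubbundle (F := E) 𝓘(ℝ, EB) r (fun x => (g x).toSubmodule))
    (G : B → Subgroup K)
    (hG : ∀ x, IsConnectedLieSubgroup (G x) (g x).toSubmodule)
    (hA : ∀ x₀ : B, ∃ (A : Set K) (m : ℕ) (_ : ChartedSpace (EuclideanSpace ℝ (Fin m)) A)
      (_ : IsManifold (𝓡 m) ∞ A) (V : Set B) (h1 : (1 : K) ∈ A),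
      IsSmoothEmbedding (𝓡 m) 𝓘(ℝ, E) ∞ (Subtype.val : A → K) ∧
      IsCompl (mfderiv (𝓡 m) 𝓘(ℝ, E) (Subtype.val : A → K) ⟨1, h1⟩).range (g x₀).toSubmodule ∧
      IsOpen V ∧ x₀ ∈ V ∧ ∀ x ∈ V, (G x : Set K) ∩ A = {1}) :
    ∃ (n : ℕ) (_ : ChartedSpace (EuclideanSpace ℝ (Fin n)) (familyUnion G))
      (_ : IsManifold (𝓡 n) ∞ (familyUnion G)),
      IsSmoothEmbedding (𝓡 n) (𝓘(ℝ, EB).prod 𝓘(ℝ, E)) ∞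
        (Subtype.val : familyUnion G → B × K) ∧
      ∃ 𝒢 : LieGroupBundle (B := B) (X := familyUnion G) 𝓘(ℝ, EB) (𝓡 n),
        -- the structure maps are the ones coming from `B × K`
        (∀ p, 𝒢.source p = p.1.1) ∧
        (∀ p q hpq, (𝒢.comp p q hpq : B × K) = (p.1.1, p.1.2 * q.1.2)) ∧
        (∀ p, (𝒢.inv p : B × K) = (p.1.1, p.1.2⁻¹)) ∧
        (∀ x, (𝒢.unit x : B × K) = (x, 1)) ∧
        -- the bundle `Lie(𝒢)` is `g`, as a vector bundle
        𝒢.IdentifiesLie (F := E)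
          (fun x => mfderiv (𝓡 n) 𝓘(ℝ, E) (fun p : familyUnion G => p.1.2) (𝒢.unit x))
          (fun x => (g x).toSubmodule) ∧
        -- each fiber is the Lie group `G x`, with the Lie algebra `g x`
        ∀ x, ∃ (_ : ChartedSpace (EuclideanSpace ℝ (Fin r)) (G x))
          (_ : LieGroup (𝓡 r) ∞ (G x)),
          IsSmoothEmbedding (𝓡 r) (𝓡 n) ∞ (fiberInclusion G x) ∧
          ∃ φ : GroupLieAlgebra (𝓡 r) (G x) →ₗ⁅ℝ⁆ GroupLieAlgebra 𝓘(ℝ, E) K,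
            (∀ v, φ v = mfderiv (𝓡 r) 𝓘(ℝ, E) (Subtype.val : G x → K) 1 v) ∧
            φ.range = g x := by
  have ht := fun x => exists_isTransversal (G := G) x (h := (show Submodule ℝ E from (g x).toSubmodule))
    (hg.finrank_eq x) (hA x)
  obtain ⟨_, _, hval⟩ := exists_isSmoothEmbedding_of_isSlice
    (I := 𝓘(ℝ, EB).prod 𝓘(ℝ, E)) (S := familyUnion G)
    (EuclideanSpace ℝ (Fin (Module.finrank ℝ EB + r)))
    (EuclideanSpace ℝ (Fin (Module.finrank ℝ E - r)))
    (by
      rintro ⟨x, k⟩ hk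
      obtain ⟨hd, V, D, α, T, hx, hT⟩ := ht x
      exact exists_isSlice_familyUnion hg hG hT hx (by simpa using hd) (mem_familyUnion.1 hk)
        (ContinuousLinearEquiv.ofFinrankEq (by simp)))
    (by
      -- A point of the base is needed to know `r ≤ finrank ℝ E`, so that the truncated subtraction
      -- in the transversal dimension is exact.
      rintro ⟨⟨x, k⟩, -⟩
      have hd := (ht x).1
      simp only [finrank_euclideanSpace_fin, Module.finrank_prod]
      omega)
  refine ⟨_, _, _, hval, familyUnion.lieGroupBundle hval hg hG rfl, fun p => rfl,
    fun p q hpq => rfl, fun p => rfl, fun x => rfl, familyUnion.identifiesLie hval hg hG rfl,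
    fun x => ?_⟩
  obtain ⟨hd, V, D, α, T, hx, hT⟩ := ht x
  exact familyUnion.exists_lieGroup_fiber hval hg hG rfl x hT hx (by simpa using hd)
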